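/- Let $1<p<\infty$, $0<q<p$ and $\alpha=\frac1q-\frac1p$. For $b,f:\mathbb R\to\mathbb C$ and $\beta\in\mathbb R$ put $$\mathcal H_\beta(b,f)(x)=\int_{-\infty}^{\infty}\big[b(x+\beta(s-x))-b(x)\big]\,f(s)\,\frac{ds}{x-s}.$$ Let $\|b\|_{\Lambda_\alpha(\mathbb R)}=\sup_{x\in\mathbb R,\,h\ne0}|h|^{-\alpha}|\Delta_h^{k}b(x)|$, where $\Delta_hb(x)=b(x+h)-b(x)$ and $k=\lfloor\alpha\rfloor+1$, be the homogeneous Lipschitz (Hölder–Zygmund) seminorm. For $0<r<\infty$ let $H^r(\mathbb R)$ be the real Hardy space of tempered distributions $u$ with $\|u\|_{H^r(\mathbb R)}=\|\mathcal M u\|_{L^r(\mathbb R)}<\infty$, where $\mathcal M$ is the grand maximal function $\mathcal Mu(x)=\sup_{t>0}\sup_{\varphi}|(u*\varphi_t)(x)|$, $\varphi_t(s)=t^{-1}\varphi(s/t)$, the inner supremum being over Schwartz functions $\varphi$ with $(1+|y|)^{2(M+1)}|\varphi^{(j)}(y)|\le1$ for all $y\in\mathbb R$ and $0\le j\le M:=\lfloor1/r\rfloor+1$.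 A locally integrable function is said to be in $H^r(\mathbb R)$ if some distribution in $H^r(\mathbb R)$ acts on $C_c^\infty$ by integration against it, and its norm is then the norm of that (unique) distribution. There exist an integer $N$ and a function $C:\mathbb R\to(0,\infty)$, both depending only on $p$ and $q$, with $C$ bounded on every compact subset of $\mathbb R$, such that for every $\beta\in\mathbb R$, every $b\in C^N(\mathbb R)$ with $\|b\|_{\Lambda_\alpha(\mathbb R)}<\infty$ and every locally integrable $f\in H^q(\mathbb R)$: 1. if $q\ge1$, or if $f$ is a Schwartz function, or if $b$ is bounded and $f\in L^1(\mathbb R)$, then the integral defining $\mathcal H_\beta(b,f)(x)$ converges absolutely for every $x\in\mathbb R$; 2. whenever this integral converges absolutely for almost every $x\in\mathbb R$, the function $\mathcal H_\beta(b,f)$ belongs to $H^p(\mathbb R)$ and $$\|\mathcal H_\beta(b,f)\|_{H^p(\mathbb R)}\le C(\beta)\,\|f\|_{H^q(\mathbb R)}\,\|b\|_{\Lambda_\alpha(\mathbb R)}.$$ -/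

import Mathlib

open MeasureTheory
open scoped SchwartzMap ENNReal

noncomputable section

/-- The homogeneous Lipschitz (Hölder–Zygmund) seminorm of order `α > 0` on the real line,
`sup_{x, h ≠ 0} |Δ_h^k b(x)| / |h|^α`, where `k = ⌊α⌋ + 1` is the smallest integer `> α` and
`Δ_h b(x) = b(x + h) - b(x)`. -/
def lipSeminorm (α : ℝ) (b : ℝ → ℂ) : ℝ≥0∞ :=
  ⨆ (x : ℝ) (h : ℝ) (_ : h ≠ 0),
    ‖(fwdDiff h)^[⌊α⌋₊ + 1] b x‖ₑ / ENNReal.ofReal (|h| ^ α)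

/-- The test functions of order `N` adapted to the point `x` and the scale `t`. For `t > 0` these
are exactly the functions `ψ(s) = t⁻¹ φ((x - s) / t)` with `φ` a Schwartz function such that
`(1 + |y|)^(2 (N + 1)) |φ^(k)(y)| ≤ 1` for all `y` and all `k ≤ N`. -/
def IsAdapted (N : ℕ) (x t : ℝ) (ψ : 𝓢(ℝ, ℂ)) : Prop :=
  ∀ k ≤ N, ∀ s : ℝ,
    t ^ (k + 1) * (1 + |x - s| / t) ^ (2 * (N + 1)) * ‖iteratedDeriv k (⇑ψ) s‖ ≤ 1

/-- The grand maximal function of order `N` of a tempered distribution `u`,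
`M_N u (x) = sup_{t > 0} sup_φ |(u * φ_t)(x)|`, with `φ_t(s) = t⁻¹ φ(s / t)` and `φ` running over
the Schwartz functions normalized as in `IsAdapted`. -/
def grandMaximal (N : ℕ) (u : 𝓢'(ℝ, ℂ)) (x : ℝ) : ℝ≥0∞ :=
  ⨆ (t : ℝ) (_ : 0 < t) (ψ : 𝓢(ℝ, ℂ)) (_ : IsAdapted N x t ψ), ‖u ψ‖ₑ

/-- The (quasi-)norm of the real Hardy space `H^p(ℝ)`, `0 < p < ∞`: the `L^p` (quasi-)norm of the
grand maximal function, of order `⌊1/p⌋ + 1`. A tempered distribution belongs to `H^p(ℝ)` iff this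
is finite. -/
def hardyNorm (p : ℝ) (u : 𝓢'(ℝ, ℂ)) : ℝ≥0∞ :=
  (∫⁻ x : ℝ, grandMaximal (⌊1 / p⌋₊ + 1) u x ^ p) ^ (1 / p)

/-- The tempered distribution `u` is (given by) the locally integrable function `f`. -/
def IsGivenBy (u : 𝓢'(ℝ, ℂ)) (f : ℝ → ℂ) : Prop :=
  LocallyIntegrable f ∧
    ∀ φ : 𝓢(ℝ, ℂ), HasCompactSupport (⇑φ) → u φ = ∫ s : ℝ, f s * φ s

/-- The integrand `s ↦ [b(x + β(s - x)) - b(x)] f(s) / (x - s)` of `H_β(b, f)(x)`. -/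
def bilinIntegrand (β : ℝ) (b f : ℝ → ℂ) (x s : ℝ) : ℂ :=
  (b (x + β * (s - x)) - b x) * f s / ((x - s : ℝ) : ℂ)

/-- `H_β(b, f)(x) = ∫ [b(x + β(s - x)) - b(x)] f(s) ds / (x - s)`. -/
def bilinHilbert (β : ℝ) (b f : ℝ → ℂ) (x : ℝ) : ℂ :=
  ∫ s : ℝ, bilinIntegrand β b f x s

end

/-! ### Geometric sums over dyadic scales. -/

section DyadicSums

/-! Fix x and put B(s) = b(x + β(s - x)). Up to sign, the integrand is f(s) times the difference
quotient (B(s) - B(x))/(s - x). The k-th differences of B are bounded by A|h|^α with A = |β|^α ‖b‖,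
uniformly in x, and nothing else about b, β or x enters the estimate. The aim is to bound
|H_β(b,f)(x)| pointwise by a discrete fractional integral of order α of the grand maximal function
Mf. This gives L^p control from Mf ∈ L^q, and for p > 1 an L^p function lies in H^p because its
grand maximal function is dominated by the Hardy–Littlewood one.

For q < 1 absolute values cannot be put on f, so cancellation is kept by testing f on smooth
functions only. B is split as a sum over t = 2^i of pieces D_t whose m-th derivatives are O(A
t^(α-m)). The difference quotient of D_t at x is O(A t^α/(t + |s - x|)) and smooth at scale t
(`norm_iteratedDeriv_segAvg_deriv_le`). A partition of unity cuts it into bumps on the intervals I_n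
of radius t about x + nt. Each is A t^α (1 + |n|)⁻¹ times a normalised test function, so its pairing
with f is at most that factor times the infimum of Mf over I_n (`exists_enorm_cutPairing_le`).
Summing over n and i gives `dyadicPotential` (`exists_enorm_integral_mul_segAvg_le`).

The pieces come from averages over translates rather than from the Fourier transform, so B may be
any continuous function, with no growth assumed. The low frequencies left over at scale T = 2^J are
disposed of directly: the cut-off quotient is a test function of size O((1 + log T) T^α), while the
infimum of Mf over an interval of length comparable to T is O(T^(-1/q)), and α < 1/q.

The fractional integration theorem (`exists_lintegral_dyadicPotential_le`) is a Hedberg argument.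
Infima over intervals of length comparable to t satisfy t Σ_n (inf Mf)^q ≤ ‖Mf‖_q^q even when q < 1.
This bound wins at large scales, while a bound through the maximal function of (Mf)^θ, θ < min(1,
q), wins at small ones.

Absolute convergence is a separate, elementary matter: the quotient is continuous across s = x since
b is C¹, so only its growth at infinity has to be compared with the decay of f. -/

lemma ENNReal.tsum_two_rpow_neg_mul_abs_ne_top {δ : ℝ} (hδ : 0 < δ) :
    ∑' k : ℤ, (2 : ℝ≥0∞) ^ (-δ * |(k : ℝ)|) ≠ ∞ := by
  have hgeom : ∑' n : ℕ, ((2 : ℝ≥0∞) ^ (-δ)) ^ n ≠ ∞ := by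
    rw [ENNReal.tsum_geometric]
    apply ENNReal.inv_ne_top.2
    apply ne_of_gt; apply tsub_pos_of_lt
    exact ENNReal.rpow_lt_one_of_one_lt_of_neg (by norm_num) (by linarith)
  rw [tsum_of_nat_of_neg_add_one ENNReal.summable ENNReal.summable]
  refine ENNReal.add_ne_top.2 ⟨?_, ?_⟩
  · refine ne_top_of_le_ne_top hgeom (ENNReal.tsum_le_tsum fun n => ?_)
    rw [← ENNReal.rpow_natCast, ← ENNReal.rpow_mul]
    simp
  · refine ne_top_of_le_ne_top hgeom (ENNReal.tsum_le_tsum fun n => ?_)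
    rw [← ENNReal.rpow_natCast, ← ENNReal.rpow_mul]
    apply ENNReal.rpow_le_rpow_of_exponent_le (by norm_num)
    push_cast
    rw [abs_neg, abs_of_nonneg (by positivity)]
    nlinarith

/-- A bilateral sum peaked at `k₀` is bounded by its largest term. -/
lemma ENNReal.tsum_two_rpow_neg_mul_abs_sub (δ : ℝ) (k₀ : ℤ) :
    ∑' k : ℤ, (2 : ℝ≥0∞) ^ (-δ * |((k - k₀ : ℤ) : ℝ)|) =
      ∑' k : ℤ, (2 : ℝ≥0∞) ^ (-δ * |(k : ℝ)|) :=
  (Equiv.subRight k₀).tsum_eq (fun k : ℤ => (2 : ℝ≥0∞) ^ (-δ * |(k : ℝ)|))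

lemma ENNReal.exists_two_rpow_lt {v : ℝ≥0∞} (h0 : v ≠ 0) (h1 : v ≠ ∞) :
    ∃ k : ℤ, (2 : ℝ≥0∞) ^ (k : ℝ) < v ∧ v ≤ (2 : ℝ≥0∞) ^ ((k : ℝ) + 1) := by
  obtain ⟨k, hk⟩ := ENNReal.exists_mem_Ioc_zpow h0 h1 (y := 2) (by norm_num) (by norm_num)
  refine ⟨k, ?_, ?_⟩
  · rw [ENNReal.rpow_intCast]; exact hk.1
  · have := hk.2
    rw [← ENNReal.rpow_intCast] at this
    push_cast at this
    exact this

/-- The term with 2^k < v ≤ 2^(k+1) alone suffices when v is positive and finite. This is half of a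
dyadic layer-cake formula; the next lemma is the other half. -/
lemma ENNReal.rpow_le_tsum_dyadic {r : ℝ} (hr : 0 < r) (v : ℝ≥0∞) :
    v ^ r ≤ 2 ^ r * ∑' k : ℤ, if (2 : ℝ≥0∞) ^ (k : ℝ) < v then (2 : ℝ≥0∞) ^ ((k : ℝ) * r) else 0 := by
  rcases eq_or_ne v 0 with rfl | h0
  · simp [ENNReal.zero_rpow_of_pos hr]
  rcases eq_or_ne v ∞ with rfl | h1
  · have : ∑' k : ℤ, (if (2 : ℝ≥0∞) ^ (k : ℝ) < ∞ then (2 : ℝ≥0∞) ^ ((k : ℝ) * r) else 0) = ∞ := by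
      rw [eq_top_iff]
      calc ∞ = ∑' _ : ℕ, (1 : ℝ≥0∞) := (ENNReal.tsum_const_eq_top_of_ne_zero one_ne_zero).symm
        _ ≤ ∑' n : ℕ, (fun k : ℤ => if (2 : ℝ≥0∞) ^ (k : ℝ) < ∞ then
              (2 : ℝ≥0∞) ^ ((k : ℝ) * r) else 0) (n : ℤ) := by
            refine ENNReal.tsum_le_tsum fun n => ?_
            simp only
            rw [if_pos (by simp)]
            rw [← ENNReal.rpow_zero (x := 2)]
            exact ENNReal.rpow_le_rpow_of_exponent_le (by norm_num) (by positivity)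
        _ ≤ _ := ENNReal.tsum_comp_le_tsum_of_injective Nat.cast_injective _
    rw [this, ENNReal.mul_top]
    · simp
    · simp
  obtain ⟨k, hk1, hk2⟩ := ENNReal.exists_two_rpow_lt h0 h1
  calc v ^ r ≤ ((2 : ℝ≥0∞) ^ ((k : ℝ) + 1)) ^ r := ENNReal.rpow_le_rpow hk2 hr.le
    _ = 2 ^ r * (2 : ℝ≥0∞) ^ ((k : ℝ) * r) := by
        rw [← ENNReal.rpow_mul, ← ENNReal.rpow_add _ _ (by norm_num) (by norm_num)]
        ring_nf
    _ ≤ _ := by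
        gcongr
        refine le_trans ?_ (ENNReal.le_tsum k)
        rw [if_pos hk1]

/-- Since δ > 0 the terms grow geometrically up to the last admissible k, which dominates the sum.
-/
lemma ENNReal.tsum_dyadic_le_rpow {δ : ℝ} (hδ : 0 < δ) (v : ℝ≥0∞) :
    (∑' k : ℤ, if (2 : ℝ≥0∞) ^ (k : ℝ) < v then (2 : ℝ≥0∞) ^ ((k : ℝ) * δ) else 0) ≤
      (∑' k : ℤ, (2 : ℝ≥0∞) ^ (-δ * |(k : ℝ)|)) * v ^ δ := by
  rcases eq_or_ne v 0 with rfl | h0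
  · simp
  rcases eq_or_ne v ∞ with rfl | h1
  · rw [ENNReal.top_rpow_of_pos hδ, ENNReal.mul_top]
    · simp
    · intro h
      have := ENNReal.tsum_eq_zero.1 h 0
      simp at this
  obtain ⟨k₀, hk1, hk2⟩ := ENNReal.exists_two_rpow_lt h0 h1
  rw [← ENNReal.tsum_two_rpow_neg_mul_abs_sub δ k₀, ← ENNReal.tsum_mul_right]
  refine ENNReal.tsum_le_tsum fun k => ?_
  split_ifs with h
  · have hk : k ≤ k₀ := by
      by_contra! hlt
      have : (2 : ℝ≥0∞) ^ ((k₀ : ℝ) + 1) ≤ (2 : ℝ≥0∞) ^ (k : ℝ) :=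
        ENNReal.rpow_le_rpow_of_exponent_le (by norm_num) (by exact_mod_cast hlt)
      exact absurd (h.trans_le hk2) (not_lt.2 this)
    calc (2 : ℝ≥0∞) ^ ((k : ℝ) * δ)
        = (2 : ℝ≥0∞) ^ (-δ * |((k - k₀ : ℤ) : ℝ)|) * ((2 : ℝ≥0∞) ^ (k₀ : ℝ)) ^ δ := by
          rw [← ENNReal.rpow_mul, ← ENNReal.rpow_add _ _ (by norm_num) (by norm_num),
            abs_of_nonpos (by exact_mod_cast sub_nonpos.2 hk)]
          push_cast
          ring_nf
      _ ≤ _ := by gcongr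
  · exact zero_le

/-- The sum over all dyadic scales of the smaller of a decreasing and an increasing geometric
sequence is controlled by the value at the crossing point. -/
lemma ENNReal.tsum_min_two_rpow_le {c d : ℝ} (hc : 0 < c) (hd : 0 < d) :
    ∃ K : ℝ≥0∞, K ≠ ∞ ∧ ∀ P Q : ℝ≥0∞, P ≠ ∞ →
      ∑' i : ℤ, min ((2 : ℝ≥0∞) ^ (-c * (i : ℝ)) * P) ((2 : ℝ≥0∞) ^ (d * (i : ℝ)) * Q) ≤
        K * (P ^ (d / (c + d)) * Q ^ (c / (c + d))) := by
  refine ⟨(2 : ℝ≥0∞) ^ (c + d) * ∑' k : ℤ, (2 : ℝ≥0∞) ^ (-(min c d) * |(k : ℝ)|),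
    ENNReal.mul_ne_top (by simp [ENNReal.rpow_eq_top_iff])
      (ENNReal.tsum_two_rpow_neg_mul_abs_ne_top (lt_min hc hd)), fun P Q hP => ?_⟩
  have hcd : 0 < c + d := by linarith
  rcases eq_or_ne P 0 with rfl | hP0
  · simp
  rcases eq_or_ne Q 0 with rfl | hQ0
  · simp
  rcases eq_or_ne Q ∞ with rfl | hQ
  · rw [ENNReal.top_rpow_of_pos (by positivity), ENNReal.mul_top, ENNReal.mul_top]
    · simp
    · refine mul_ne_zero (by simp [ENNReal.rpow_eq_zero_iff]) fun h => ?_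
      have := ENNReal.tsum_eq_zero.1 h 0
      simp at this
    · simp [ENNReal.rpow_eq_zero_iff, hP0, hP]
  lift P to NNReal using hP
  lift Q to NNReal using hQ
  have hP' : 0 < (P : ℝ) := by
    have : P ≠ 0 := by exact_mod_cast hP0
    positivity
  have hQ' : 0 < (Q : ℝ) := by
    have : Q ≠ 0 := by exact_mod_cast hQ0
    positivity
  obtain ⟨x, hx⟩ : ∃ x : ℝ, (P : ℝ≥0∞) = 2 ^ x := by
    refine ⟨Real.logb 2 P, ?_⟩
    rw [← ENNReal.coe_ofNat, ← ENNReal.coe_rpow_of_ne_zero (by norm_num)]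
    congr 1
    ext
    simp [Real.rpow_logb, hP']
  obtain ⟨y, hy⟩ : ∃ x : ℝ, (Q : ℝ≥0∞) = 2 ^ x := by
    refine ⟨Real.logb 2 Q, ?_⟩
    rw [← ENNReal.coe_ofNat, ← ENNReal.coe_rpow_of_ne_zero (by norm_num)]
    congr 1
    ext
    simp [Real.rpow_logb, hQ']
  rw [hx, hy]
  -- With P = 2^x and Q = 2^y the two sequences agree at the real index τ, with common value 2^(y +
  -- dτ), the claimed product of powers. The factor 2^(c + d) in the constant pays for rounding τ
  -- down to an integer.
  set τ := (x - y) / (c + d) with hτ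
  have hxy : x = y + (c + d) * τ := by rw [hτ]; field_simp; ring
  set k₀ := ⌊τ⌋
  rw [← ENNReal.tsum_two_rpow_neg_mul_abs_sub _ k₀, ← ENNReal.tsum_mul_left,
    ← ENNReal.tsum_mul_right]
  refine ENNReal.tsum_le_tsum fun i => ?_
  have h2 : ∀ u w : ℝ, (2 : ℝ≥0∞) ^ u * 2 ^ w = 2 ^ (u + w) := fun u w =>
    (ENNReal.rpow_add _ _ (by norm_num) (by norm_num)).symm
  rw [h2, h2, ← ENNReal.rpow_mul, ← ENNReal.rpow_mul, h2, h2, h2]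
  have e : x * (d / (c + d)) + y * (c / (c + d)) = y + d * τ := by
    rw [hxy]; field_simp; ring
  rw [e]
  have hk1 : (k₀ : ℝ) ≤ τ := Int.floor_le τ
  have hk2 : τ < k₀ + 1 := Int.lt_floor_add_one τ
  have hm1 : min c d ≤ c := min_le_left _ _
  have hm2 : min c d ≤ d := min_le_right _ _
  have hm0 : 0 < min c d := lt_min hc hd
  push_cast
  rcases le_or_gt i k₀ with h | h
  · refine (min_le_right _ _).trans (ENNReal.rpow_le_rpow_of_exponent_le (by norm_num) ?_)
    have h' : (i : ℝ) ≤ k₀ := by exact_mod_cast h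
    rw [abs_of_nonpos (by linarith)]
    nlinarith
  · refine (min_le_left _ _).trans (ENNReal.rpow_le_rpow_of_exponent_le (by norm_num) ?_)
    have h' : (k₀ : ℝ) + 1 ≤ i := by exact_mod_cast h
    rw [abs_of_nonneg (by linarith), hxy]
    nlinarith

end DyadicSums

/-! ### The Hardy–Littlewood maximal theorem for functions with values in [0, ∞]. -/

section HardyLittlewood

open Metric Set

/-- The uncentred Hardy–Littlewood maximal function on the real line. -/
noncomputable def hlMax (g : ℝ → ℝ≥0∞) (x : ℝ) : ℝ≥0∞ :=
  ⨆ (c : ℝ) (r : ℝ) (_ : 0 < r) (_ : x ∈ ball c r), (∫⁻ y in ball c r, g y) / ENNReal.ofReal (2 * r)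

lemma lintegral_ball_le_hlMax (g : ℝ → ℝ≥0∞) {x c r : ℝ} (hr : 0 < r) (hx : x ∈ ball c r) :
    ∫⁻ y in ball c r, g y ≤ ENNReal.ofReal (2 * r) * hlMax g x := by
  have : (∫⁻ y in ball c r, g y) / ENNReal.ofReal (2 * r) ≤ hlMax g x :=
    le_iSup_of_le c <| le_iSup_of_le r <| le_iSup_of_le hr <| le_iSup_of_le hx le_rfl
  rwa [ENNReal.div_le_iff (by simp [hr]) ENNReal.ofReal_ne_top, mul_comm] at this

lemma lt_hlMax_iff {g : ℝ → ℝ≥0∞} {x : ℝ} {l : ℝ≥0∞} :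
    l < hlMax g x ↔ ∃ c r : ℝ, 0 < r ∧ x ∈ ball c r ∧
      l * ENNReal.ofReal (2 * r) < ∫⁻ y in ball c r, g y := by
  simp only [hlMax, lt_iSup_iff, exists_prop]
  refine exists_congr fun c => exists_congr fun r => ?_
  refine and_congr_right fun hr => and_congr_right fun _ => ?_
  rw [ENNReal.lt_div_iff_mul_lt (Or.inl (by simp [hr])) (Or.inl ENNReal.ofReal_ne_top)]

/-- A ball that witnesses a large average at x also contains the points near x, so superlevel sets
are open. No measurability of `g` is needed. -/
lemma measurable_hlMax (g : ℝ → ℝ≥0∞) : Measurable (hlMax g) := by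
  refine measurable_of_Ioi fun l => IsOpen.measurableSet ?_
  rw [Metric.isOpen_iff]
  intro x hx
  obtain ⟨c, r, hr, hxc, h⟩ := lt_hlMax_iff.1 hx
  obtain ⟨ε, hε, hsub⟩ := Metric.isOpen_iff.1 isOpen_ball x hxc
  exact ⟨ε, hε, fun y hy => lt_hlMax_iff.2 ⟨c, r, hr, hsub hy, h⟩⟩

/-- The weak type `(1, 1)` inequality. -/
lemma mul_volume_lt_hlMax_le (g : ℝ → ℝ≥0∞) {l : ℝ≥0∞} (hl : l ≠ 0) (hl' : l ≠ ∞) :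
    l * volume {x | l < hlMax g x} ≤ 4 * ∫⁻ y, g y := by
  rcases eq_or_ne (∫⁻ y, g y) ∞ with hg | hg
  · rw [hg]; simp
  let t : Set (ℝ × ℝ) := {z | 0 < z.2 ∧ l * ENNReal.ofReal (2 * z.2) < ∫⁻ y in ball z.1 z.2, g y}
  have hR : ∀ z ∈ t, z.2 ≤ ((∫⁻ y, g y) / l).toReal := by
    rintro ⟨c, r⟩ ⟨hr, h⟩
    simp only at hr h ⊢
    have h1 : l * ENNReal.ofReal (2 * r) ≤ ∫⁻ y, g y := h.le.trans (setLIntegral_le_lintegral _ _)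
    have h2 : ENNReal.ofReal r ≤ (∫⁻ y, g y) / l := by
      rw [ENNReal.le_div_iff_mul_le (Or.inl hl) (Or.inl hl'), mul_comm]
      refine le_trans ?_ h1
      gcongr
      linarith
    exact (ENNReal.ofReal_le_iff_le_toReal (ENNReal.div_ne_top hg hl)).1 h2
  -- Vitali covering admits any enlargement factor above 3; the 4 chosen here is the constant of the
  -- weak type bound.
  obtain ⟨v, hvt, hvd, hcov⟩ := Vitali.exists_disjoint_subfamily_covering_enlargement_ball
    t (fun z => z.1) (fun z => z.2) _ hR 4 (by norm_num)
  have hvc : v.Countable := by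
    refine hvd.countable_of_isOpen (fun z _ => isOpen_ball) fun z hz => ?_
    exact nonempty_ball.2 (hvt hz).1
  have hsub : {x | l < hlMax g x} ⊆ ⋃ z ∈ v, ball z.1 (4 * z.2) := by
    intro x hx
    obtain ⟨c, r, hr, hxc, h⟩ := lt_hlMax_iff.1 hx
    obtain ⟨z, hz, hzs⟩ := hcov (c, r) ⟨hr, h⟩
    exact mem_biUnion hz (hzs hxc)
  calc l * volume {x | l < hlMax g x}
      ≤ l * volume (⋃ z ∈ v, ball z.1 (4 * z.2)) := by gcongr
    _ ≤ l * ∑' z : v, volume (ball z.1.1 (4 * z.1.2)) := by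
        gcongr
        exact measure_biUnion_le volume hvc _
    _ = ∑' z : v, 4 * (l * ENNReal.ofReal (2 * z.1.2)) := by
        rw [← ENNReal.tsum_mul_left]
        congr 1
        ext z
        have : 0 < z.1.2 := (hvt z.2).1
        rw [Real.volume_ball, show 2 * (4 * z.1.2) = 4 * (2 * z.1.2) by ring,
          ENNReal.ofReal_mul (by norm_num), ENNReal.ofReal_ofNat]
        ring
    _ ≤ ∑' z : v, 4 * ∫⁻ y in ball z.1.1 z.1.2, g y := by
        refine ENNReal.tsum_le_tsum fun z => ?_
        gcongr
        exact (hvt z.2).2.le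
    _ = 4 * ∫⁻ y in ⋃ z ∈ v, ball z.1 z.2, g y := by
        rw [ENNReal.tsum_mul_left, lintegral_biUnion hvc (fun _ _ => measurableSet_ball) hvd]
    _ ≤ 4 * ∫⁻ y, g y := by
        gcongr
        exact Measure.restrict_le_self

/-- The maximal function is controlled at level `2 l` by the part of `g` above the level `l`. -/
lemma mul_volume_two_mul_lt_hlMax_le {g : ℝ → ℝ≥0∞} {l : ℝ≥0∞} (hl : l ≠ 0)
    (hl' : l ≠ ∞) :
    l * volume {x | 2 * l < hlMax g x} ≤ 4 * ∫⁻ y, if l < g y then g y else 0 := by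
  set g₁ : ℝ → ℝ≥0∞ := fun y => if l < g y then g y else 0
  refine le_trans (mul_le_mul_right (measure_mono fun x hx => ?_) l)
    (mul_volume_lt_hlMax_le g₁ hl hl')
  obtain ⟨c, r, hr, hxc, h⟩ := lt_hlMax_iff.1 hx
  refine lt_hlMax_iff.2 ⟨c, r, hr, hxc, ?_⟩
  have h1 : ∫⁻ y in ball c r, g y ≤ (∫⁻ y in ball c r, g₁ y) + l * ENNReal.ofReal (2 * r) := by
    calc ∫⁻ y in ball c r, g y ≤ ∫⁻ y in ball c r, (g₁ y + l) := by
          refine lintegral_mono fun y => ?_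
          simp only [g₁]
          split_ifs with hy
          · exact le_self_add
          · simpa using hy
      _ = _ := by
          rw [lintegral_add_right _ measurable_const]
          simp [Real.volume_ball]
  have h2 := h.trans_le h1
  rw [two_mul, add_mul] at h2
  exact lt_of_add_lt_add_right h2

/-- The strong type `(r, r)` inequality, `r > 1`. -/
lemma exists_lintegral_hlMax_rpow_le {r : ℝ} (hr : 1 < r) :
    ∃ K : ℝ≥0∞, K ≠ ∞ ∧ ∀ g : ℝ → ℝ≥0∞, Measurable g →
      ∫⁻ x, hlMax g x ^ r ≤ K * ∫⁻ x, g x ^ r := by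
  set G := ∑' k : ℤ, (2 : ℝ≥0∞) ^ (-(r - 1) * |(k : ℝ)|)
  have hG : G ≠ ∞ := ENNReal.tsum_two_rpow_neg_mul_abs_ne_top (by linarith)
  refine ⟨2 ^ r * (8 * (G * 2 ^ (r - 1))), ?_, fun g hg => ?_⟩
  · refine ENNReal.mul_ne_top (by simp [ENNReal.rpow_eq_top_iff]) (ENNReal.mul_ne_top (by simp)
      (ENNReal.mul_ne_top hG (by simp [ENNReal.rpow_eq_top_iff])))
  have h2 : ∀ u w : ℝ, (2 : ℝ≥0∞) ^ u * 2 ^ w = 2 ^ (u + w) := fun u w =>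
    (ENNReal.rpow_add _ _ (by norm_num) (by norm_num)).symm
  have hlevel : ∀ k : ℤ, MeasurableSet {x | (2 : ℝ≥0∞) ^ (k : ℝ) < hlMax g x} := fun k =>
    measurableSet_lt measurable_const (measurable_hlMax g)
  -- Marcinkiewicz interpolation with L^∞: the weak bound is used at level 2^(k-1) with `g`
  -- truncated there, and one power of 2^k is spent on it.
  have hterm : ∀ k : ℤ, (2 : ℝ≥0∞) ^ ((k : ℝ) * r) * volume {x | (2 : ℝ≥0∞) ^ (k : ℝ) < hlMax g x} ≤
      8 * ∫⁻ y, if (2 : ℝ≥0∞) ^ (k : ℝ) < 2 * g y then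
        (2 : ℝ≥0∞) ^ ((k : ℝ) * (r - 1)) * g y else 0 := by
    intro k
    have hw := mul_volume_two_mul_lt_hlMax_le (g := g) (l := 2 ^ ((k : ℝ) - 1))
      (by simp [ENNReal.rpow_eq_zero_iff]) (by simp [ENNReal.rpow_eq_top_iff])
    have e1 : (2 : ℝ≥0∞) * 2 ^ ((k : ℝ) - 1) = 2 ^ (k : ℝ) := by
      have := h2 1 ((k : ℝ) - 1)
      rwa [ENNReal.rpow_one, add_sub_cancel] at this
    rw [e1] at hw
    have e2 : ∀ y, ((2 : ℝ≥0∞) ^ ((k : ℝ) - 1) < g y ↔ (2 : ℝ≥0∞) ^ (k : ℝ) < 2 * g y) := by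
      intro y
      rw [← e1]
      exact (ENNReal.mul_lt_mul_iff_right (by norm_num) (by norm_num)).symm
    simp only [e2] at hw
    calc (2 : ℝ≥0∞) ^ ((k : ℝ) * r) * volume {x | (2 : ℝ≥0∞) ^ (k : ℝ) < hlMax g x}
        = 2 * 2 ^ ((k : ℝ) * (r - 1)) *
          (2 ^ ((k : ℝ) - 1) * volume {x | (2 : ℝ≥0∞) ^ (k : ℝ) < hlMax g x}) := by
          rw [← mul_assoc]
          congr 1
          rw [mul_right_comm, e1, h2]
          ring_nf
      _ ≤ 2 * 2 ^ ((k : ℝ) * (r - 1)) *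
          (4 * ∫⁻ y, if (2 : ℝ≥0∞) ^ (k : ℝ) < 2 * g y then g y else 0) := by gcongr
      _ = 8 * (2 ^ ((k : ℝ) * (r - 1)) *
          ∫⁻ y, if (2 : ℝ≥0∞) ^ (k : ℝ) < 2 * g y then g y else 0) := by ring
      _ = _ := by
          rw [← lintegral_const_mul' _ _ (by simp [ENNReal.rpow_eq_top_iff])]
          simp only [mul_ite, mul_zero]
  calc ∫⁻ x, hlMax g x ^ r
      ≤ ∫⁻ x, 2 ^ r * ∑' k : ℤ, if (2 : ℝ≥0∞) ^ (k : ℝ) < hlMax g x then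
          (2 : ℝ≥0∞) ^ ((k : ℝ) * r) else 0 :=
        lintegral_mono fun x => ENNReal.rpow_le_tsum_dyadic (by linarith) _
    _ = 2 ^ r * ∑' k : ℤ, (2 : ℝ≥0∞) ^ ((k : ℝ) * r) *
          volume {x | (2 : ℝ≥0∞) ^ (k : ℝ) < hlMax g x} := by
        rw [lintegral_const_mul' _ _ (by simp [ENNReal.rpow_eq_top_iff]), lintegral_tsum]
        · congr 2
          ext k
          rw [← lintegral_indicator_const (hlevel k)]
          refine lintegral_congr fun x => ?_
          simp only [Set.indicator_apply, Set.mem_ofPred_eq]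
        · intro k
          exact (Measurable.ite (hlevel k) measurable_const measurable_const).aemeasurable
    _ ≤ 2 ^ r * ∑' k : ℤ, 8 * ∫⁻ y, if (2 : ℝ≥0∞) ^ (k : ℝ) < 2 * g y then
        (2 : ℝ≥0∞) ^ ((k : ℝ) * (r - 1)) * g y else 0 := by
        exact mul_le_mul_right (ENNReal.tsum_le_tsum hterm) _
    _ = 2 ^ r * (8 * ∫⁻ y, ∑' k : ℤ, if (2 : ℝ≥0∞) ^ (k : ℝ) < 2 * g y then
        (2 : ℝ≥0∞) ^ ((k : ℝ) * (r - 1)) * g y else 0) := by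
        rw [ENNReal.tsum_mul_left, lintegral_tsum]
        intro k
        exact (Measurable.ite (measurableSet_lt measurable_const (hg.const_mul 2))
          (hg.const_mul _) measurable_const).aemeasurable
    _ ≤ 2 ^ r * (8 * ∫⁻ y, G * 2 ^ (r - 1) * g y ^ r) := by
        gcongr with y
        -- After the sum and the integral are exchanged, the remaining sum over levels below 2 g(y)
        -- has exponent r - 1; it converges because r > 1.
        have := ENNReal.tsum_dyadic_le_rpow (δ := r - 1) (by linarith) (2 * g y)
        calc (∑' k : ℤ, if (2 : ℝ≥0∞) ^ (k : ℝ) < 2 * g y then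
              (2 : ℝ≥0∞) ^ ((k : ℝ) * (r - 1)) * g y else 0)
            = (∑' k : ℤ, if (2 : ℝ≥0∞) ^ (k : ℝ) < 2 * g y then
              (2 : ℝ≥0∞) ^ ((k : ℝ) * (r - 1)) else 0) * g y := by
              rw [← ENNReal.tsum_mul_right]
              simp only [ite_mul, zero_mul]
          _ ≤ G * (2 * g y) ^ (r - 1) * g y := by gcongr
          _ = G * 2 ^ (r - 1) * (g y ^ (r - 1) * g y ^ (1 : ℝ)) := by
              rw [ENNReal.mul_rpow_of_nonneg _ _ (by linarith), ENNReal.rpow_one]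
              ring
          _ = _ := by
              rw [← ENNReal.rpow_add_of_nonneg _ _ (by linarith) (by norm_num)]
              ring_nf
    _ = _ := by
        rw [lintegral_const_mul' _ _ (ENNReal.mul_ne_top hG (by simp [ENNReal.rpow_eq_top_iff]))]
        ring

end HardyLittlewood

/-! ### Moving the base point in the grand maximal function. -/

section GrandMaximal

/-- The weight is submultiplicative: 1 + |y - s|/t ≤ (1 + |y - x|/t)(1 + |x - s|/t). Hence changing
the base point only costs a scalar. -/
lemma IsAdapted.smul_shift {N : ℕ} {x t : ℝ} (ht : 0 < t) {ψ : 𝓢(ℝ, ℂ)} (h : IsAdapted N x t ψ)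
    (y : ℝ) : IsAdapted N y t
      (((((1 + |y - x| / t) ^ (2 * (N + 1)))⁻¹ : ℝ) : ℂ) • ψ) := by
  intro k hk s
  set c : ℝ := (1 + |y - x| / t) ^ (2 * (N + 1)) with hc
  have hc0 : 0 < c := by positivity
  have h1 : iteratedDeriv k (⇑(((c⁻¹ : ℝ) : ℂ) • ψ)) s = ((c⁻¹ : ℝ) : ℂ) • iteratedDeriv k (⇑ψ) s := by
    exact iteratedDeriv_const_smul (ψ.smooth k).contDiffAt _
  rw [h1, norm_smul, Complex.norm_real, Real.norm_of_nonneg (by positivity)]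
  have h2 : (1 + |y - s| / t) ^ (2 * (N + 1)) ≤ c * (1 + |x - s| / t) ^ (2 * (N + 1)) := by
    rw [hc, ← mul_pow]
    gcongr
    have : |y - s| / t ≤ |y - x| / t + |x - s| / t := by
      rw [← add_div]
      gcongr
      exact abs_sub_le y x s
    have h3 : 0 ≤ |y - x| / t * (|x - s| / t) := by positivity
    nlinarith
  calc t ^ (k + 1) * (1 + |y - s| / t) ^ (2 * (N + 1)) * (c⁻¹ * ‖iteratedDeriv k (⇑ψ) s‖)
      ≤ t ^ (k + 1) * (c * (1 + |x - s| / t) ^ (2 * (N + 1))) *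
        (c⁻¹ * ‖iteratedDeriv k (⇑ψ) s‖) := by gcongr
    _ = t ^ (k + 1) * (1 + |x - s| / t) ^ (2 * (N + 1)) * ‖iteratedDeriv k (⇑ψ) s‖ := by
        field_simp
    _ ≤ 1 := h k hk s

lemma enorm_le_grandMaximal {N : ℕ} (u : 𝓢'(ℝ, ℂ)) {x t : ℝ} (ht : 0 < t) {ψ : 𝓢(ℝ, ℂ)}
    (h : IsAdapted N x t ψ) : ‖u ψ‖ₑ ≤ grandMaximal N u x :=
  le_iSup_of_le t <| le_iSup_of_le ht <| le_iSup_of_le ψ <| le_iSup_of_le h le_rfl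

lemma enorm_le_mul_grandMaximal {N : ℕ} (u : 𝓢'(ℝ, ℂ)) {x t : ℝ} (ht : 0 < t) {ψ : 𝓢(ℝ, ℂ)}
    (h : IsAdapted N x t ψ) (y : ℝ) :
    ‖u ψ‖ₑ ≤ grandMaximal N u y * ENNReal.ofReal ((1 + |y - x| / t) ^ (2 * (N + 1))) := by
  have h1 := enorm_le_grandMaximal u ht (h.smul_shift ht y)
  have hc0 : 0 < (1 + |y - x| / t) ^ (2 * (N + 1)) := by positivity
  rw [map_smul, enorm_smul, ← ofReal_norm, Complex.norm_real,
    Real.norm_of_nonneg (by positivity), ENNReal.ofReal_inv_of_pos hc0, mul_comm,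
    ← div_eq_mul_inv, ENNReal.div_le_iff (by simpa using hc0) ENNReal.ofReal_ne_top] at h1
  exact h1

/-- The price of moving a test function from x to y tends to 1 as y → x, so superlevel sets are
open. -/
lemma measurable_grandMaximal (N : ℕ) (u : 𝓢'(ℝ, ℂ)) : Measurable (grandMaximal N u) := by
  refine measurable_of_Ioi fun l => IsOpen.measurableSet ?_
  rw [isOpen_iff_mem_nhds]
  intro x hx
  obtain ⟨t, ht, ψ, hψ, hl⟩ : ∃ t : ℝ, 0 < t ∧ ∃ ψ : 𝓢(ℝ, ℂ), IsAdapted N x t ψ ∧ l < ‖u ψ‖ₑ := by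
    have hx' : l < grandMaximal N u x := hx
    simpa only [grandMaximal, lt_iSup_iff, exists_prop] using hx'
  have hcont : Continuous fun y : ℝ => l * ENNReal.ofReal ((1 + |y - x| / t) ^ (2 * (N + 1))) := by
    refine (ENNReal.continuous_const_mul (ne_top_of_lt hl)).comp
      (ENNReal.continuous_ofReal.comp ?_)
    fun_prop
  have hev : ∀ᶠ y in nhds x, l * ENNReal.ofReal ((1 + |y - x| / t) ^ (2 * (N + 1))) < ‖u ψ‖ₑ := by
    refine hcont.continuousAt.eventually_lt continuousAt_const ?_
    simpa using hl
  filter_upwards [hev] with y hy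
  have h2 := hy.trans_le (enorm_le_mul_grandMaximal u ht hψ y)
  exact lt_of_mul_lt_mul_right' h2

end GrandMaximal

/-! ### Fractional integration of local infima, for all 0 < q < p with p > 1. -/

section DyadicPotential

open Metric Set

/-- The infimum of `F` over the `n`-th interval of length `2 t` of the grid of step `t` centred
at `x`. -/
noncomputable def gridInf (F : ℝ → ℝ≥0∞) (x t : ℝ) (n : ℤ) : ℝ≥0∞ :=
  ⨅ y ∈ closedBall (x + n * t) t, F y

/-- The logarithmically weighted sum of the infima of `F` over the grid of step `t`. -/
noncomputable def gridSum (F : ℝ → ℝ≥0∞) (x t : ℝ) : ℝ≥0∞ :=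
  ∑' n : ℤ, ENNReal.ofReal ((1 + |(n : ℝ)|)⁻¹) * gridInf F x t n

/-- A discrete fractional integral of order `α` of the local infima of `F`. -/
noncomputable def dyadicPotential (α : ℝ) (F : ℝ → ℝ≥0∞) (x : ℝ) : ℝ≥0∞ :=
  ∑' i : ℤ, (2 : ℝ≥0∞) ^ (α * (i : ℝ)) * gridSum F x (2 ^ i)

lemma gridInf_le (F : ℝ → ℝ≥0∞) {x t : ℝ} {n : ℤ} {y : ℝ} (hy : y ∈ closedBall (x + n * t) t) :
    gridInf F x t n ≤ F y := iInf₂_le y hy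

/-- The grid intervals overlap, but their right halves tile the line. Integrating over the halves
lets the estimates be summed over n without loss. -/
lemma ofReal_mul_gridInf_rpow_le (F : ℝ → ℝ≥0∞) {r : ℝ} (hr : 0 ≤ r) (x : ℝ) {t : ℝ} (ht : 0 < t)
    (n : ℤ) : ENNReal.ofReal t * gridInf F x t n ^ r ≤
      ∫⁻ y in Ioc (x + n • t) (x + (n + 1) • t), F y ^ r := by
  calc ENNReal.ofReal t * gridInf F x t n ^ r
      = ∫⁻ _ in Ioc (x + n • t) (x + (n + 1) • t), gridInf F x t n ^ r := by
        rw [setLIntegral_const, Real.volume_Ioc, mul_comm]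
        congr 2
        rw [add_smul, one_smul]; ring
    _ ≤ _ := by
        refine setLIntegral_mono' measurableSet_Ioc fun y hy => ?_
        refine ENNReal.rpow_le_rpow (gridInf_le F ?_) hr
        have h1 := hy.1
        have h2 := hy.2
        rw [add_smul, one_smul] at h2
        rw [zsmul_eq_mul] at h1 h2
        rw [mem_closedBall, Real.dist_eq, abs_le]
        constructor <;> linarith

lemma ofReal_mul_tsum_gridInf_rpow_le (F : ℝ → ℝ≥0∞) {r : ℝ} (hr : 0 ≤ r) (x : ℝ) {t : ℝ}
    (ht : 0 < t) : ENNReal.ofReal t * ∑' n : ℤ, gridInf F x t n ^ r ≤ ∫⁻ y, F y ^ r := by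
  rw [← ENNReal.tsum_mul_left]
  refine (ENNReal.tsum_le_tsum fun n => ofReal_mul_gridInf_rpow_le F hr x ht n).trans ?_
  rw [← lintegral_iUnion (fun _ => measurableSet_Ioc) (pairwise_disjoint_Ioc_add_zsmul x t)]
  exact lintegral_mono' Measure.restrict_le_self le_rfl

/-- The tiles with |n| < 2^l lie in the ball of radius 2 · 2^l t about x, over which the mean of F^r
is at most its maximal function. -/
lemma sum_gridInf_rpow_le (F : ℝ → ℝ≥0∞) {r : ℝ} (hr : 0 ≤ r) (x : ℝ) {t : ℝ} (ht : 0 < t)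
    (l : ℕ) : ∑ n ∈ Finset.Ioo (-2 ^ l : ℤ) (2 ^ l), gridInf F x t n ^ r ≤
      4 * 2 ^ l * hlMax (fun y => F y ^ r) x := by
  have h1 : ENNReal.ofReal t * ∑ n ∈ Finset.Ioo (-2 ^ l : ℤ) (2 ^ l), gridInf F x t n ^ r ≤
      ∫⁻ y in ball x (2 * (2 ^ l * t)), F y ^ r := by
    rw [Finset.mul_sum]
    refine (Finset.sum_le_sum fun n _ => ofReal_mul_gridInf_rpow_le F hr x ht n).trans ?_
    rw [← lintegral_biUnion_finset ((pairwise_disjoint_Ioc_add_zsmul x t).set_pairwise _)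
      (fun _ _ => measurableSet_Ioc)]
    refine lintegral_mono_set (iUnion₂_subset fun n hn y hy => ?_)
    rw [Finset.mem_Ioo] at hn
    have hn1 : (-2 ^ l : ℝ) ≤ n := by exact_mod_cast hn.1.le
    have hn2 : ((n : ℝ) + 1) ≤ 2 ^ l := by exact_mod_cast hn.2
    have h1 := hy.1
    have h2 := hy.2
    rw [zsmul_eq_mul] at h1 h2
    push_cast at h2
    have h3 : (-2 ^ l : ℝ) * t ≤ n * t := by gcongr
    have h4 : ((n : ℝ) + 1) * t ≤ 2 ^ l * t := by gcongr
    have h5 : 0 < 2 ^ l * t := by positivity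
    rw [mem_ball, Real.dist_eq, abs_lt]
    constructor <;> linarith
  have h2 := h1.trans (lintegral_ball_le_hlMax _ (by positivity) (mem_ball_self (by positivity)))
  have h3 : ENNReal.ofReal (2 * (2 * (2 ^ l * t))) = ENNReal.ofReal t * (4 * 2 ^ l) := by
    rw [show 2 * (2 * (2 ^ l * t)) = t * (4 * 2 ^ l) by ring, ENNReal.ofReal_mul ht.le,
      ENNReal.ofReal_mul (by norm_num), ENNReal.ofReal_pow (by norm_num)]
    norm_num
  rw [h3, mul_assoc] at h2
  exact (ENNReal.mul_le_mul_iff_right (by simpa using ht) ENNReal.ofReal_ne_top).1 h2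

lemma ENNReal.min_le_rpow_mul_rpow {u : ℝ} (hu : 0 ≤ u) (hu' : u ≤ 1) {z a b : ℝ≥0∞} (ha : z ≤ a)
    (hb : z ≤ b) : z ≤ a ^ u * b ^ (1 - u) := by
  calc z = z ^ u * z ^ (1 - u) := by
        rw [← ENNReal.rpow_add_of_nonneg _ _ hu (by linarith)]; simp
    _ ≤ _ := by gcongr

/-- For q ≤ 1 this is the inclusion of ℓ^q in ℓ¹, with no loss; for q > 1 it is Hölder's inequality,
losing the power 1 - 1/q of the number of terms. -/
lemma ENNReal.sum_le_card_rpow_mul {ι : Type*} (s : Finset ι) (a : ι → ℝ≥0∞) {q : ℝ} (hq : 0 < q)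
    {y c : ℝ≥0∞} (hy : ∑ n ∈ s, a n ^ q ≤ y ^ q) (hc : (s.card : ℝ≥0∞) ≤ c) :
    ∑ n ∈ s, a n ≤ c ^ (1 - min 1 (1 / q)) * y := by
  rcases le_or_gt q 1 with h | h
  · rw [min_eq_left (by rw [le_div_iff₀ hq]; linarith), sub_self, ENNReal.rpow_zero, one_mul]
    have ha : ∀ n ∈ s, a n ≤ y := fun n hn =>
      (ENNReal.rpow_le_rpow_iff hq).1 ((Finset.single_le_sum (f := fun n => a n ^ q)
        (fun _ _ => zero_le) hn).trans hy)
    calc ∑ n ∈ s, a n ≤ ∑ n ∈ s, y ^ (1 - q) * a n ^ q := by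
          refine Finset.sum_le_sum fun n hn => ?_
          calc a n = a n ^ (1 - q) * a n ^ q := by
                rw [← ENNReal.rpow_add_of_nonneg _ _ (by linarith) hq.le]; simp
            _ ≤ _ := by
                gcongr
                exact ha n hn
      _ ≤ y ^ (1 - q) * y ^ q := by
          rw [← Finset.mul_sum]
          gcongr
      _ = y := by rw [← ENNReal.rpow_add_of_nonneg _ _ (by linarith) hq.le]; simp
  · rw [min_eq_right (by rw [div_le_iff₀ hq]; linarith)]
    rw [← ENNReal.rpow_le_rpow_iff hq]
    refine (ENNReal.rpow_sum_le_const_mul_sum_rpow s a h.le).trans ?_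
    rw [ENNReal.mul_rpow_of_nonneg _ _ hq.le, ← ENNReal.rpow_mul, sub_mul, one_mul,
      one_div_mul_cancel hq.ne']
    gcongr

/-- The harmonic weight is replaced by dyadic blocks. The binary length l of |n| satisfies |n| < 2^l
≤ 2(1 + |n|), so the block l alone accounts for the term n. -/
lemma gridSum_le_tsum (F : ℝ → ℝ≥0∞) (x t : ℝ) :
    gridSum F x t ≤ ∑' l : ℕ, 2 * (2 : ℝ≥0∞)⁻¹ ^ l *
      ∑ n ∈ Finset.Ioo (-2 ^ l : ℤ) (2 ^ l), gridInf F x t n := by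
  have h1 : ∀ l : ℕ, 2 * (2 : ℝ≥0∞)⁻¹ ^ l * ∑ n ∈ Finset.Ioo (-2 ^ l : ℤ) (2 ^ l), gridInf F x t n =
      ∑' n : ℤ, if n ∈ Finset.Ioo (-2 ^ l : ℤ) (2 ^ l) then
        2 * (2 : ℝ≥0∞)⁻¹ ^ l * gridInf F x t n else 0 := by
    intro l
    rw [tsum_eq_sum (s := Finset.Ioo (-2 ^ l : ℤ) (2 ^ l)), Finset.mul_sum]
    · exact Finset.sum_congr rfl fun n hn => by rw [if_pos hn]
    · intro n hn
      rw [if_neg hn]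
  simp_rw [h1]
  rw [ENNReal.tsum_comm]
  refine ENNReal.tsum_le_tsum fun n => ?_
  refine le_trans ?_ (ENNReal.le_tsum n.natAbs.size)
  have hlt : n.natAbs < 2 ^ n.natAbs.size := Nat.lt_size_self _
  rw [if_pos]
  · gcongr
    have h2 : (2 : ℝ) ^ n.natAbs.size ≤ 2 * (1 + |(n : ℝ)|) := by
      have h3 : 2 ^ n.natAbs.size ≤ 2 * (1 + n.natAbs) := by
        rcases Nat.eq_zero_or_pos n.natAbs.size with h0 | hpos
        · rw [h0]; omega
        · have h4 : 2 ^ (n.natAbs.size - 1) ≤ n.natAbs := by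
            rw [← Nat.lt_size]; omega
          calc 2 ^ n.natAbs.size = 2 ^ (n.natAbs.size - 1 + 1) := by congr 1; omega
            _ = 2 * 2 ^ (n.natAbs.size - 1) := by ring
            _ ≤ _ := by omega
      have h5 : ((n.natAbs : ℕ) : ℝ) = |(n : ℝ)| := by
        rw [Nat.cast_natAbs, Int.cast_abs]
      rw [← h5]
      exact_mod_cast h3
    calc ENNReal.ofReal ((1 + |(n : ℝ)|)⁻¹) ≤ ENNReal.ofReal (2 * 2⁻¹ ^ n.natAbs.size) := by
          apply ENNReal.ofReal_le_ofReal
          rw [inv_pow, ← div_eq_mul_inv, inv_le_comm₀ (by positivity) (by positivity), inv_div,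
            div_le_iff₀ (by norm_num)]
          linarith
      _ = _ := by
          rw [ENNReal.ofReal_mul (by norm_num), ENNReal.ofReal_pow (by norm_num),
            ENNReal.ofReal_inv_of_pos (by norm_num)]
          norm_num
  · rw [Finset.mem_Ioo]
    have : ((n.natAbs : ℕ) : ℤ) < 2 ^ n.natAbs.size := by exact_mod_cast hlt
    omega

/-- Each dyadic block has two bounds: the ℓ^q bound, which decays like 2^(-κ l), and the maximal
function bound, uniform in l. Their geometric mean with weight u > 0 on the first is summable over
l. The value u = 1 gives the pure ℓ^q bound, and u < 1 brings in the maximal function. -/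
lemma exists_gridSum_le {q θ u : ℝ} (hq : 0 < q) (hθ : 0 < θ) (hθ1 : θ < 1) (hu : 0 < u)
    (hu1 : u ≤ 1) :
    ∃ K : ℝ≥0∞, K ≠ ∞ ∧ ∀ (F : ℝ → ℝ≥0∞) (x t : ℝ), 0 < t → ∀ y : ℝ≥0∞,
      ∑' n : ℤ, gridInf F x t n ^ q ≤ y ^ q →
      gridSum F x t ≤ K * (y ^ (1 - θ * (1 - u)) * hlMax (fun z => F z ^ θ) x ^ (1 - u)) := by
  set κ := min 1 (1 / q) with hκ
  have hκ0 : 0 < κ := by positivity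
  have hκ1 : κ ≤ 1 := min_le_left _ _
  have hgeom : ∑' l : ℕ, ((2 : ℝ≥0∞) ^ (-κ * u)) ^ l ≠ ∞ := by
    rw [ENNReal.tsum_geometric]
    apply ENNReal.inv_ne_top.2
    apply ne_of_gt; apply tsub_pos_of_lt
    exact ENNReal.rpow_lt_one_of_one_lt_of_neg (by norm_num) (by nlinarith)
  refine ⟨2 * (2 ^ u * 4 ^ (1 - u) * ∑' l : ℕ, ((2 : ℝ≥0∞) ^ (-κ * u)) ^ l), ?_, ?_⟩
  · exact ENNReal.mul_ne_top (by simp) (ENNReal.mul_ne_top (ENNReal.mul_ne_top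
      (by simp [ENNReal.rpow_eq_top_iff]) (by simp [ENNReal.rpow_eq_top_iff])) hgeom)
  intro F x t ht y hy
  set H := hlMax (fun z => F z ^ θ) x
  refine (gridSum_le_tsum F x t).trans ?_
  simp only [mul_assoc (2 : ℝ≥0∞) (2⁻¹ ^ _) _]
  rw [ENNReal.tsum_mul_left, mul_assoc (2 : ℝ≥0∞)]
  refine mul_le_mul_right ?_ 2
  rw [← ENNReal.tsum_mul_left, ← ENNReal.tsum_mul_right]
  refine ENNReal.tsum_le_tsum fun l => ?_
  set s := Finset.Ioo (-2 ^ l : ℤ) (2 ^ l)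
  have h2 : ∀ u w : ℝ, (2 : ℝ≥0∞) ^ u * 2 ^ w = 2 ^ (u + w) := fun u w =>
    (ENNReal.rpow_add _ _ (by norm_num) (by norm_num)).symm
  have hsy : ∀ s : Finset ℤ, ∑ n ∈ s, gridInf F x t n ^ q ≤ y ^ q := fun s =>
    (ENNReal.sum_le_tsum s).trans hy
  have hay : ∀ n, gridInf F x t n ≤ y := fun n =>
    (ENNReal.rpow_le_rpow_iff hq).1 ((ENNReal.le_tsum n).trans hy)
  have hcard : (s.card : ℝ≥0∞) ≤ 2 ^ ((l : ℝ) + 1) := by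
    have h1 : (2 : ℝ≥0∞) ^ ((l : ℝ) + 1) = ((2 ^ (l + 1) : ℕ) : ℝ≥0∞) := by
      rw [show (l : ℝ) + 1 = ((l + 1 : ℕ) : ℝ) by push_cast; rfl, ENNReal.rpow_natCast]
      push_cast; rfl
    rw [h1, Nat.cast_le, Int.card_Ioo, pow_succ]
    have : ((2 ^ l : ℕ) : ℤ) = 2 ^ l := by push_cast; rfl
    omega
  have hinv : (2 : ℝ≥0∞)⁻¹ ^ l = 2 ^ (-(l : ℝ)) := by
    rw [ENNReal.rpow_neg, ENNReal.rpow_natCast, ENNReal.inv_pow]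
  have hA : (2 : ℝ≥0∞)⁻¹ ^ l * ∑ n ∈ s, gridInf F x t n ≤ 2 * (2 ^ (-κ * l) * y) := by
    calc (2 : ℝ≥0∞)⁻¹ ^ l * ∑ n ∈ s, gridInf F x t n
        ≤ 2 ^ (-(l : ℝ)) * ((2 ^ ((l : ℝ) + 1)) ^ (1 - κ) * y) := by
          rw [hinv]
          gcongr
          exact ENNReal.sum_le_card_rpow_mul s _ hq (hsy s) hcard
      _ = 2 ^ (1 - κ + -κ * l) * y := by
          rw [← ENNReal.rpow_mul, ← mul_assoc, h2]
          ring_nf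
      _ ≤ 2 ^ (1 + -κ * l) * y := by
          gcongr
          · norm_num
          · linarith
      _ = _ := by rw [← h2, ENNReal.rpow_one, mul_assoc]
  have hB : (2 : ℝ≥0∞)⁻¹ ^ l * ∑ n ∈ s, gridInf F x t n ≤ 4 * (y ^ (1 - θ) * H) := by
    calc (2 : ℝ≥0∞)⁻¹ ^ l * ∑ n ∈ s, gridInf F x t n
        ≤ (2 : ℝ≥0∞)⁻¹ ^ l * ∑ n ∈ s, y ^ (1 - θ) * gridInf F x t n ^ θ := by
          gcongr with n hn
          calc gridInf F x t n = gridInf F x t n ^ (1 - θ) * gridInf F x t n ^ θ := by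
                rw [← ENNReal.rpow_add_of_nonneg _ _ (by linarith) hθ.le]; simp
            _ ≤ _ := by
                gcongr
                exact hay n
      _ ≤ (2 : ℝ≥0∞)⁻¹ ^ l * (y ^ (1 - θ) * (4 * 2 ^ l * H)) := by
          rw [← Finset.mul_sum]
          gcongr
          exact sum_gridInf_rpow_le F hθ.le x ht l
      _ = ((2 : ℝ≥0∞)⁻¹ * 2) ^ l * (4 * (y ^ (1 - θ) * H)) := by rw [mul_pow]; ring
      _ = _ := by rw [ENNReal.inv_mul_cancel (by norm_num) (by norm_num), one_pow, one_mul]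
  refine (ENNReal.min_le_rpow_mul_rpow hu.le hu1 hA hB).trans (le_of_eq ?_)
  have hu1' : 0 ≤ 1 - u := by linarith
  rw [ENNReal.mul_rpow_of_nonneg _ _ hu.le, ENNReal.mul_rpow_of_nonneg _ _ hu.le,
    ENNReal.mul_rpow_of_nonneg _ _ hu1', ENNReal.mul_rpow_of_nonneg _ _ hu1',
    ← ENNReal.rpow_mul, ← ENNReal.rpow_mul, ← ENNReal.rpow_natCast, ← ENNReal.rpow_mul,
    show 1 - θ * (1 - u) = u + (1 - θ) * (1 - u) by ring,
    ENNReal.rpow_add_of_nonneg u _ hu.le (mul_nonneg (by linarith) hu1')]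
  ring_nf

/-- The fractional integration theorem for the discrete potential. -/
lemma exists_lintegral_dyadicPotential_le {p q α : ℝ} (hp : 1 < p) (hq : 0 < q) (hqp : q < p)
    (hα : α = 1 / q - 1 / p) :
    ∃ K : ℝ≥0∞, K ≠ ∞ ∧ ∀ F : ℝ → ℝ≥0∞, Measurable F → ∫⁻ x, F x ^ q ≠ ∞ →
      (∫⁻ x, dyadicPotential α F x ^ p) ^ (1 / p) ≤ K * (∫⁻ x, F x ^ q) ^ (1 / q) := by
  have hp0 : 0 < p := by linarith
  have hlo : q / p < min 1 q := by
    rw [lt_min_iff, div_lt_one hp0, div_lt_iff₀ hp0]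
    exact ⟨hqp, by nlinarith⟩
  -- Exponents with q/p < θ' < θ < min(1, q): θ < q makes the maximal operator bounded on L^(q/θ),
  -- θ' < θ leaves a positive weight u = 1 - θ'/θ, and θ' > q/p makes the small scales summable.
  obtain ⟨θ, hθlo, hθhi⟩ := exists_between hlo
  obtain ⟨θ', hθ'lo, hθ'hi⟩ := exists_between hθlo
  have hqp0 : 0 < q / p := by positivity
  have hθ0 : 0 < θ := hqp0.trans hθlo
  have hθ'0 : 0 < θ' := hqp0.trans hθ'lo
  have hθ1 : θ < 1 := hθhi.trans_le (min_le_left _ _)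
  have hθq : θ < q := hθhi.trans_le (min_le_right _ _)
  have hu : 0 < 1 - θ' / θ := by rw [sub_pos, div_lt_one hθ0]; exact hθ'hi
  have hu1 : 1 - θ' / θ < 1 := by have : 0 < θ' / θ := by positivity
                                  linarith
  obtain ⟨K₁, hK₁, hg₁⟩ := exists_gridSum_le hq hθ0 hθ1 one_pos le_rfl
  obtain ⟨K₂, hK₂, hg₂⟩ := exists_gridSum_le hq hθ0 hθ1 hu hu1.le
  -- Exponents of the scale 2^i in the two bounds: α - 1/q = -c from the ℓ^q bound, and α - (1 -
  -- θ')/q = d from the interpolated one.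
  set c := 1 / p with hc
  set d := θ' / q - 1 / p with hd
  have hc0 : 0 < c := by positivity
  have hd0 : 0 < d := by
    rw [hd, sub_pos, div_lt_div_iff₀ hp0 hq]
    rw [div_lt_iff₀ hp0] at hθ'lo
    linarith
  obtain ⟨K₃, hK₃, hsum⟩ := ENNReal.tsum_min_two_rpow_le hc0 hd0
  obtain ⟨K₄, hK₄, hmax⟩ := exists_lintegral_hlMax_rpow_le (r := q / θ) (by rwa [one_lt_div hθ0])
  refine ⟨(K₁ + K₂) * K₃ * K₄ ^ (1 / p), ENNReal.mul_ne_top (ENNReal.mul_ne_top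
    (ENNReal.add_ne_top.2 ⟨hK₁, hK₂⟩) hK₃) (by simp [ENNReal.rpow_eq_top_iff, hK₄, hp0.le]),
    fun F hF hfin => ?_⟩
  set N := (∫⁻ x, F x ^ q) ^ (1 / q) with hN
  have hNtop : N ≠ ∞ := by simp [hN, ENNReal.rpow_eq_top_iff, hfin, hq.le]
  have hNq : N ^ q = ∫⁻ x, F x ^ q := by
    rw [hN, ← ENNReal.rpow_mul, one_div_mul_cancel hq.ne', ENNReal.rpow_one]
  clear_value N
  have h2 : ∀ u w : ℝ, (2 : ℝ≥0∞) ^ u * 2 ^ w = 2 ^ (u + w) := fun u w =>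
    (ENNReal.rpow_add _ _ (by norm_num) (by norm_num)).symm
  -- Hedberg's inequality: at each scale the better of the two bounds is taken. The auxiliary θ'
  -- cancels from the final exponents.
  have hpt : ∀ x, dyadicPotential α F x ≤ (K₁ + K₂) * K₃ *
      (N ^ (1 - q / p) * hlMax (fun z => F z ^ θ) x ^ (q / (p * θ))) := by
    intro x
    set H := hlMax (fun z => F z ^ θ) x
    have hy : ∀ i : ℤ, ∑' n : ℤ, gridInf F x (2 ^ i) n ^ q ≤ ((2 : ℝ≥0∞) ^ (-(i : ℝ) / q) * N) ^ q := by
      intro i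
      have h := ofReal_mul_tsum_gridInf_rpow_le F hq.le x (t := 2 ^ i) (by positivity)
      have h3 : ENNReal.ofReal (2 ^ i) = (2 : ℝ≥0∞) ^ (i : ℝ) := by
        rw [← Real.rpow_intCast, ← ENNReal.ofReal_rpow_of_pos (by norm_num)]
        norm_num
      rw [ENNReal.mul_rpow_of_nonneg _ _ hq.le, ← ENNReal.rpow_mul, div_mul_cancel₀ _ hq.ne', hNq]
      calc ∑' n : ℤ, gridInf F x (2 ^ i) n ^ q
          = (2 : ℝ≥0∞) ^ (-(i : ℝ)) *
            (ENNReal.ofReal (2 ^ i) * ∑' n : ℤ, gridInf F x (2 ^ i) n ^ q) := by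
            rw [h3, ← mul_assoc, h2, neg_add_cancel, ENNReal.rpow_zero, one_mul]
        _ ≤ _ := by gcongr
    have hterm : ∀ i : ℤ, (2 : ℝ≥0∞) ^ (α * (i : ℝ)) * gridSum F x (2 ^ i) ≤
        (K₁ + K₂) * min ((2 : ℝ≥0∞) ^ (-c * (i : ℝ)) * N)
          ((2 : ℝ≥0∞) ^ (d * (i : ℝ)) * (N ^ (1 - θ') * H ^ (θ' / θ))) := by
      intro i
      rw [mul_min]
      refine le_min ?_ ?_
      · have h := hg₁ F x (2 ^ i) (by positivity) _ (hy i)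
        rw [sub_self, mul_zero, sub_zero, ENNReal.rpow_one, ENNReal.rpow_zero, mul_one] at h
        calc (2 : ℝ≥0∞) ^ (α * (i : ℝ)) * gridSum F x (2 ^ i)
            ≤ 2 ^ (α * (i : ℝ)) * (K₁ * (2 ^ (-(i : ℝ) / q) * N)) := by gcongr
          _ = K₁ * ((2 ^ (α * (i : ℝ)) * 2 ^ (-(i : ℝ) / q)) * N) := by ring
          _ ≤ (K₁ + K₂) * ((2 ^ (α * (i : ℝ)) * 2 ^ (-(i : ℝ) / q)) * N) := by
              gcongr
              exact le_self_add
          _ = _ := by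
              rw [h2]
              congr 4
              rw [hα, hc]; ring
      · have h := hg₂ F x (2 ^ i) (by positivity) _ (hy i)
        have e1 : θ * (1 - (1 - θ' / θ)) = θ' := by field_simp; ring
        rw [e1, sub_sub_cancel, ENNReal.mul_rpow_of_nonneg _ _ (by linarith : 0 ≤ 1 - θ'),
          ← ENNReal.rpow_mul] at h
        calc (2 : ℝ≥0∞) ^ (α * (i : ℝ)) * gridSum F x (2 ^ i)
            ≤ 2 ^ (α * (i : ℝ)) * (K₂ * (2 ^ (-(i : ℝ) / q * (1 - θ')) * N ^ (1 - θ') *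
                H ^ (θ' / θ))) := by gcongr
          _ = K₂ * ((2 ^ (α * (i : ℝ)) * 2 ^ (-(i : ℝ) / q * (1 - θ'))) *
                (N ^ (1 - θ') * H ^ (θ' / θ))) := by ring
          _ ≤ (K₁ + K₂) * ((2 ^ (α * (i : ℝ)) * 2 ^ (-(i : ℝ) / q * (1 - θ'))) *
                (N ^ (1 - θ') * H ^ (θ' / θ))) := by
              gcongr
              exact le_add_self
          _ = _ := by
              rw [h2]
              congr 4
              rw [hα, hd]; ring
    calc dyadicPotential α F x
        ≤ (K₁ + K₂) * ∑' i : ℤ, min ((2 : ℝ≥0∞) ^ (-c * (i : ℝ)) * N)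
          ((2 : ℝ≥0∞) ^ (d * (i : ℝ)) * (N ^ (1 - θ') * H ^ (θ' / θ))) := by
          rw [← ENNReal.tsum_mul_left]
          exact ENNReal.tsum_le_tsum hterm
      _ ≤ (K₁ + K₂) * (K₃ * (N ^ (d / (c + d)) *
          (N ^ (1 - θ') * H ^ (θ' / θ)) ^ (c / (c + d)))) := by
          gcongr
          exact hsum _ _ hNtop
      _ = _ := by
          have hcd : c + d = θ' / q := by rw [hc, hd]; ring
          have e1 : c / (c + d) = q / (p * θ') := by rw [hcd, hc]; field_simp
          have e2 : d / (c + d) = 1 - q / (p * θ') := by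
            rw [hcd, hd]; field_simp
          have e3 : 0 ≤ 1 - q / (p * θ') := by rw [← e2]; positivity
          have e4 : 0 ≤ 1 - θ' := by linarith
          rw [e1, e2, ENNReal.mul_rpow_of_nonneg _ _ (by positivity), ← ENNReal.rpow_mul,
            ← ENNReal.rpow_mul, ← mul_assoc (N ^ _),
            ← ENNReal.rpow_add_of_nonneg _ _ e3 (by positivity), mul_assoc]
          congr 4
          · field_simp; ring
          · field_simp
  calc (∫⁻ x, dyadicPotential α F x ^ p) ^ (1 / p)
      ≤ (∫⁻ x, ((K₁ + K₂) * K₃ * N ^ (1 - q / p)) ^ p *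
          hlMax (fun z => F z ^ θ) x ^ (q / θ)) ^ (1 / p) := by
        gcongr with x
        refine (ENNReal.rpow_le_rpow (hpt x) hp0.le).trans (le_of_eq ?_)
        rw [← mul_assoc, ENNReal.mul_rpow_of_nonneg _ _ hp0.le, ← ENNReal.rpow_mul _ (q / (p * θ))]
        congr 2
        field_simp
    _ ≤ (((K₁ + K₂) * K₃ * N ^ (1 - q / p)) ^ p * (K₄ * N ^ q)) ^ (1 / p) := by
        rw [lintegral_const_mul _ ((measurable_hlMax _).pow_const _)]
        gcongr
        refine (hmax _ (hF.pow_const θ)).trans ?_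
        rw [hNq]
        gcongr with x
        rw [← ENNReal.rpow_mul, mul_div_cancel₀ _ hθ0.ne']
    _ = (K₁ + K₂) * K₃ * K₄ ^ (1 / p) * (N ^ (1 - q / p) * N ^ (q / p)) := by
        rw [ENNReal.mul_rpow_of_nonneg _ _ (by positivity), ← ENNReal.rpow_mul,
          mul_one_div_cancel hp0.ne', ENNReal.rpow_one,
          ENNReal.mul_rpow_of_nonneg _ _ (by positivity), ← ENNReal.rpow_mul, mul_one_div]
        ring
    _ = _ := by
        have : 0 ≤ 1 - q / p := by rw [sub_nonneg, div_le_one hp0]; exact hqp.le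
        rw [← ENNReal.rpow_add_of_nonneg _ _ this (by positivity), sub_add_cancel,
          ENNReal.rpow_one]

end DyadicPotential

/-! ### Smoothing by Steklov averages and their combinations. -/

section Steklov

/-- The Steklov average `∫₀¹ f(s + t u) du`, as a linear operator on continuous functions. -/
noncomputable def steklov (t : ℝ) : Module.End ℂ C(ℝ, ℂ) where
  toFun f := ⟨fun s => ∫ u in (0 : ℝ)..1, f (s + t * u),
    intervalIntegral.continuous_parametric_intervalIntegral_of_continuous' (by fun_prop) _ _⟩
  map_add' f g := by
    ext s
    exact intervalIntegral.integral_add (Continuous.intervalIntegrable (by fun_prop) _ _)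
      (Continuous.intervalIntegrable (by fun_prop) _ _)
  map_smul' c f := by
    ext s
    exact intervalIntegral.integral_smul c _

lemma steklov_apply (t : ℝ) (f : C(ℝ, ℂ)) (s : ℝ) :
    steklov t f s = ∫ u in (0 : ℝ)..1, f (s + t * u) := rfl

/-- The difference operator `f ↦ f(· + h) - f`, as a linear operator on continuous functions. -/
noncomputable def diffOp (h : ℝ) : Module.End ℂ C(ℝ, ℂ) where
  toFun f := ⟨fun s => f (s + h) - f s, by fun_prop⟩
  map_add' f g := by
    ext s
    simp only [ContinuousMap.coe_mk, ContinuousMap.add_apply]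
    ring
  map_smul' c f := by
    ext s
    simp only [ContinuousMap.coe_mk, ContinuousMap.smul_apply, smul_eq_mul, RingHom.id_apply]
    ring

lemma diffOp_apply (h : ℝ) (f : C(ℝ, ℂ)) (s : ℝ) : diffOp h f s = f (s + h) - f s := rfl

lemma coe_diffOp_pow (h : ℝ) (k : ℕ) (f : C(ℝ, ℂ)) :
    ⇑((diffOp h ^ k) f) = (fwdDiff h)^[k] f := by
  induction k with
  | zero => rfl
  | succ k ih =>
    rw [pow_succ', Module.End.mul_apply, Function.iterate_succ_apply', ← ih]
    rfl

lemma commute_steklov_steklov (t t' : ℝ) : Commute (steklov t) (steklov t') := by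
  refine LinearMap.ext fun f => ContinuousMap.ext fun s => ?_
  change (∫ u in (0 : ℝ)..1, ∫ v in (0 : ℝ)..1, f (s + t * u + t' * v)) =
    ∫ v in (0 : ℝ)..1, ∫ u in (0 : ℝ)..1, f (s + t' * v + t * u)
  rw [intervalIntegral_intervalIntegral_swap]
  · simp only [add_right_comm]
  · have hc : Continuous (Function.uncurry fun u v : ℝ => f (s + t * u + t' * v)) := by
      unfold Function.uncurry
      fun_prop
    exact (hc.continuousOn.integrableOn_compact (isCompact_uIcc.prod isCompact_uIcc)).mono_set
      (Set.prod_mono Set.uIoc_subset_uIcc Set.uIoc_subset_uIcc)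

lemma commute_diffOp_steklov (h t : ℝ) : Commute (diffOp h) (steklov t) := by
  refine LinearMap.ext fun f => ContinuousMap.ext fun s => ?_
  change (∫ u in (0 : ℝ)..1, f (s + h + t * u)) - (∫ u in (0 : ℝ)..1, f (s + t * u)) =
    ∫ u in (0 : ℝ)..1, (f (s + t * u + h) - f (s + t * u))
  rw [intervalIntegral.integral_sub (Continuous.intervalIntegrable (by fun_prop) _ _)
    (Continuous.intervalIntegrable (by fun_prop) _ _)]
  simp only [add_right_comm]

lemma norm_steklov_sub_le {t : ℝ} {f : C(ℝ, ℂ)} {s a : ℝ} {z : ℂ}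
    (h : ∀ u ∈ Set.Icc (0 : ℝ) 1, ‖f (s + t * u) - z‖ ≤ a) : ‖steklov t f s - z‖ ≤ a := by
  have h1 : steklov t f s - z = ∫ u in (0 : ℝ)..1, (f (s + t * u) - z) := by
    rw [intervalIntegral.integral_sub (Continuous.intervalIntegrable (by fun_prop) _ _)
      (Continuous.intervalIntegrable (by fun_prop) _ _), steklov_apply]
    simp
  rw [h1]
  refine (intervalIntegral.norm_integral_le_of_norm_le_const (C := a) fun u hu => ?_).trans ?_
  · rw [Set.uIoc_of_le zero_le_one] at hu
    exact h u ⟨hu.1.le, hu.2⟩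
  · simp

lemma norm_steklov_pow_le (t : ℝ) (K : ℕ) {f : C(ℝ, ℂ)} {a : ℝ} (h : ∀ s, ‖f s‖ ≤ a) (s : ℝ) :
    ‖(steklov t ^ K) f s‖ ≤ a := by
  induction K generalizing s with
  | zero => exact h s
  | succ K ih =>
    rw [pow_succ', Module.End.mul_apply, ← sub_zero (steklov t _ s)]
    exact norm_steklov_sub_le fun u _ => by simpa using ih _

lemma norm_diffOp_pow_le (h : ℝ) (m : ℕ) {f : C(ℝ, ℂ)} {a : ℝ} (hf : ∀ s, ‖f s‖ ≤ a) (s : ℝ) :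
    ‖(diffOp h ^ m) f s‖ ≤ 2 ^ m * a := by
  induction m generalizing s with
  | zero => simpa using hf s
  | succ m ih =>
    rw [pow_succ', Module.End.mul_apply, diffOp_apply]
    calc _ ≤ 2 ^ m * a + 2 ^ m * a := (norm_sub_le _ _).trans (add_le_add (ih _) (ih _))
      _ = _ := by ring

/-- After a change of variable the average is t⁻¹ ∫ f over [s, s + t], so differentiating it
produces a difference of `f`; `f` itself need only be continuous. -/
lemma hasDerivAt_steklov {t : ℝ} (ht : t ≠ 0) (f : C(ℝ, ℂ)) (s : ℝ) :
    HasDerivAt (steklov t f) ((t⁻¹ : ℂ) • diffOp t f s) s := by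
  have h1 : ⇑(steklov t f) = fun s => (t⁻¹ : ℂ) * ((∫ v in (0 : ℝ)..(s + t), f v) -
      ∫ v in (0 : ℝ)..s, f v) := by
    ext s
    rw [steklov_apply, intervalIntegral.integral_comp_add_mul (fun v => f v) ht,
      intervalIntegral.integral_interval_sub_left (f.continuous.intervalIntegrable _ _)
        (f.continuous.intervalIntegrable _ _)]
    simp
  rw [h1, smul_eq_mul]
  refine HasDerivAt.const_mul _ (HasDerivAt.sub ?_ ?_)
  · exact (intervalIntegral.integral_hasDerivAt_right (f.continuous.intervalIntegrable _ _)
      (f.continuous.stronglyMeasurableAtFilter _ _) f.continuous.continuousAt).comp_add_const s t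
  · exact intervalIntegral.integral_hasDerivAt_right (f.continuous.intervalIntegrable _ _)
      (f.continuous.stronglyMeasurableAtFilter _ _) f.continuous.continuousAt

lemma hasDerivAt_steklov_of_hasDerivAt {t : ℝ} (ht : t ≠ 0) {f f' : C(ℝ, ℂ)}
    (hf : ∀ s, HasDerivAt f (f' s) s) (s : ℝ) : HasDerivAt (steklov t f) (steklov t f' s) s := by
  have h1 : steklov t f' s = (t⁻¹ : ℂ) • diffOp t f s := by
    rw [steklov_apply, intervalIntegral.integral_comp_add_mul (fun v => f' v) ht,
      intervalIntegral.integral_eq_sub_of_hasDerivAt (fun x _ => hf x)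
        (f'.continuous.intervalIntegrable _ _), diffOp_apply]
    simp
  rw [h1]
  exact hasDerivAt_steklov ht f s

lemma hasDerivAt_steklov_pow_of_hasDerivAt {t : ℝ} (ht : t ≠ 0) (K : ℕ) {f f' : C(ℝ, ℂ)}
    (hf : ∀ s, HasDerivAt f (f' s) s) (s : ℝ) :
    HasDerivAt ((steklov t ^ K) f) ((steklov t ^ K) f' s) s := by
  induction K generalizing s with
  | zero => exact hf s
  | succ K ih =>
    rw [pow_succ', Module.End.mul_apply, Module.End.mul_apply]
    exact hasDerivAt_steklov_of_hasDerivAt ht ih s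

lemma contDiff_diffOp {n : ℕ} {f : C(ℝ, ℂ)} (hf : ContDiff ℝ n f) (h : ℝ) :
    ContDiff ℝ n (diffOp h f) := by
  change ContDiff ℝ n fun s => f (s + h) - f s
  fun_prop

lemma contDiff_steklov {n : ℕ} {t : ℝ} (ht : t ≠ 0) {f : C(ℝ, ℂ)} (hf : ContDiff ℝ n f) :
    ContDiff ℝ (n + 1 : ℕ) (steklov t f) := by
  push_cast
  rw [contDiff_succ_iff_deriv]
  refine ⟨fun s => (hasDerivAt_steklov ht f s).differentiableAt, by simp, ?_⟩
  rw [show deriv (steklov t f) = fun s => (t⁻¹ : ℂ) • diffOp t f s from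
    funext fun s => (hasDerivAt_steklov ht f s).deriv]
  exact (contDiff_diffOp hf t).const_smul _

lemma contDiff_steklov_pow {t : ℝ} (ht : t ≠ 0) (K : ℕ) (f : C(ℝ, ℂ)) :
    ContDiff ℝ K ((steklov t ^ K) f) := by
  induction K with
  | zero => simpa using (contDiff_zero (𝕜 := ℝ)).2 f.continuous
  | succ K ih =>
    rw [pow_succ', Module.End.mul_apply]
    exact contDiff_steklov ht ih

lemma iteratedDeriv_diffOp {m : ℕ} {f : C(ℝ, ℂ)} (hf : ContDiff ℝ m f) (h : ℝ) (s : ℝ) :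
    iteratedDeriv m (diffOp h f) s = iteratedDeriv m f (s + h) - iteratedDeriv m f s := by
  change iteratedDeriv m (fun s => f (s + h) - f s) s = _
  rw [iteratedDeriv_fun_sub (by fun_prop) hf.contDiffAt, iteratedDeriv_comp_add_const]

/-- Every derivative consumes one average and leaves one difference divided by t. -/
lemma iteratedDeriv_steklov_pow {t : ℝ} (ht : t ≠ 0) (K m : ℕ) (f : C(ℝ, ℂ)) (s : ℝ) :
    iteratedDeriv m ((steklov t ^ (K + m)) f) s =
      (t⁻¹ : ℂ) ^ m • (diffOp t ^ m) ((steklov t ^ K) f) s := by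
  induction m generalizing s with
  | zero => simp
  | succ m ih =>
    have hc : ContDiff ℝ m ((steklov t ^ (K + m)) f) :=
      (contDiff_steklov_pow ht (K + m) f).of_le (by norm_cast; omega)
    rw [iteratedDeriv_succ', ← add_assoc, pow_succ', Module.End.mul_apply,
      show deriv (steklov t ((steklov t ^ (K + m)) f)) =
        (t⁻¹ : ℂ) • ⇑(diffOp t ((steklov t ^ (K + m)) f)) from
        funext fun s => (hasDerivAt_steklov ht _ s).deriv,
      iteratedDeriv_const_smul (contDiff_diffOp hc t).contDiffAt, iteratedDeriv_diffOp hc, ih, ih,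
      ← smul_sub, smul_smul, ← pow_succ', pow_succ' (diffOp t), Module.End.mul_apply]
    rfl

lemma norm_iteratedDeriv_steklov_pow_le {t : ℝ} (ht : 0 < t) {K m : ℕ} (hm : m ≤ K) {f : C(ℝ, ℂ)}
    {a : ℝ} (hf : ∀ s, ‖f s‖ ≤ a) (s : ℝ) :
    ‖iteratedDeriv m ((steklov t ^ K) f) s‖ ≤ 2 ^ m * t⁻¹ ^ m * a := by
  obtain ⟨j, rfl⟩ := Nat.exists_eq_add_of_le' hm
  rw [iteratedDeriv_steklov_pow ht.ne', norm_smul, norm_pow, norm_inv, Complex.norm_real,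
    Real.norm_of_nonneg ht.le]
  calc _ ≤ t⁻¹ ^ m * (2 ^ m * a) := by
        gcongr
        exact norm_diffOp_pow_le t m (norm_steklov_pow_le t j hf) s
    _ = _ := by ring

/-- High derivatives of the Steklov averages are controlled by differences. -/
lemma norm_iteratedDeriv_steklov_pow_le_of_diffOp {t : ℝ} (ht : 0 < t) {k K m : ℕ} (hkm : k ≤ m)
    (hm : m ≤ K) {f : C(ℝ, ℂ)} {a : ℝ} (hf : ∀ s, ‖(diffOp t ^ k) f s‖ ≤ a) (s : ℝ) :
    ‖iteratedDeriv m ((steklov t ^ K) f) s‖ ≤ 2 ^ m * t⁻¹ ^ m * a := by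
  obtain ⟨j, rfl⟩ := Nat.exists_eq_add_of_le' hm
  obtain ⟨n, rfl⟩ := Nat.exists_eq_add_of_le' hkm
  have ha : 0 ≤ a := (norm_nonneg _).trans (hf 0)
  -- Of the m = n + k differences, k are commuted past the averages onto `f`, where the hypothesis
  -- applies; each of the other n costs a factor 2.
  rw [iteratedDeriv_steklov_pow ht.ne', norm_smul, norm_pow, norm_inv, Complex.norm_real,
    Real.norm_of_nonneg ht.le, pow_add (diffOp t), Module.End.mul_apply,
    ← Module.End.mul_apply (diffOp t ^ k), ((commute_diffOp_steklov t t).pow_pow k j).eq,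
    Module.End.mul_apply]
  calc _ ≤ t⁻¹ ^ (n + k) * (2 ^ n * a) := by
        gcongr
        exact norm_diffOp_pow_le t n (norm_steklov_pow_le t j hf) s
    _ ≤ t⁻¹ ^ (n + k) * (2 ^ (n + k) * a) := by
        gcongr
        · norm_num
        · omega
    _ = _ := by ring

/-- The coefficients of `f(s + (l + 1) h)` in `f(s) - (-1)ᵏ Δₕᵏ f(s)`. -/
noncomputable def smoothCoeff (k l : ℕ) : ℂ := (-1) ^ l * (k.choose (l + 1) : ℂ)

/-- Steklov averages combined so as to approximate to the order `k`. -/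
noncomputable def smoothOp (k K : ℕ) (t : ℝ) : Module.End ℂ C(ℝ, ℂ) :=
  ∑ l ∈ Finset.range k, smoothCoeff k l • steklov (((l : ℝ) + 1) * t) ^ K

lemma smoothOp_apply (k K : ℕ) (t : ℝ) (f : C(ℝ, ℂ)) (s : ℝ) :
    smoothOp k K t f s =
      ∑ l ∈ Finset.range k, smoothCoeff k l * (steklov (((l : ℝ) + 1) * t) ^ K) f s := by
  simp [smoothOp, LinearMap.sum_apply, ContinuousMap.sum_apply]

lemma coe_smoothOp (k K : ℕ) (t : ℝ) (f : C(ℝ, ℂ)) :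
    ⇑(smoothOp k K t f) = fun s =>
      ∑ l ∈ Finset.range k, smoothCoeff k l • (steklov (((l : ℝ) + 1) * t) ^ K) f s :=
  funext fun s => smoothOp_apply k K t f s

lemma sum_norm_smoothCoeff_le (k : ℕ) : ∑ l ∈ Finset.range k, ‖smoothCoeff k l‖ ≤ 2 ^ k := by
  have h : ∑ l ∈ Finset.range k, k.choose (l + 1) ≤ 2 ^ k := by
    rw [← Nat.sum_range_choose, Finset.sum_range_succ' _ k]
    omega
  calc ∑ l ∈ Finset.range k, ‖smoothCoeff k l‖ = ∑ l ∈ Finset.range k, (k.choose (l + 1) : ℝ) := by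
        simp [smoothCoeff]
    _ ≤ 2 ^ k := by exact_mod_cast h

/-- This is the binomial expansion with its j = 0 term isolated. The combination of translates
therefore approximates `g` with an error that is exactly a k-th difference. -/
lemma sum_smoothCoeff_mul (k : ℕ) (g : ℝ → ℂ) (s a : ℝ) :
    ∑ l ∈ Finset.range k, smoothCoeff k l * g (s + ((l : ℝ) + 1) * a) =
      g s - (-1) ^ k * (fwdDiff a)^[k] g s := by
  have h : (-1 : ℂ) ^ k * (fwdDiff a)^[k] g s =
      ∑ j ∈ Finset.range (k + 1), (-1 : ℂ) ^ j * (k.choose j : ℂ) * g (s + j * a) := by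
    rw [fwdDiff_iter_eq_sum_shift, Finset.mul_sum]
    refine Finset.sum_congr rfl fun j hj => ?_
    have hjk : j ≤ k := by simpa [Nat.lt_succ_iff] using hj
    obtain ⟨m, rfl⟩ := Nat.exists_eq_add_of_le hjk
    rw [zsmul_eq_mul, nsmul_eq_mul, ← mul_assoc, Nat.add_sub_cancel_left]
    push_cast
    rw [← mul_assoc, pow_add, mul_assoc (_ ^ j), ← mul_pow]
    norm_num
  rw [h, Finset.sum_range_succ']
  simp only [smoothCoeff, pow_succ]
  push_cast
  simp only [pow_zero, Nat.choose_zero_right, Nat.cast_one, zero_mul, add_zero, one_mul, mul_neg,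
    mul_one, neg_mul, Finset.sum_neg_distrib]
  ring

lemma sum_smoothCoeff {k : ℕ} (hk : 0 < k) : ∑ l ∈ Finset.range k, smoothCoeff k l = 1 := by
  have h := sum_smoothCoeff_mul k (fun _ => 1) 0 0
  have h0 : (fwdDiff (0 : ℝ))^[k] (fun _ : ℝ => (1 : ℂ)) 0 = 0 := by
    obtain ⟨m, rfl⟩ := Nat.exists_eq_succ_of_ne_zero hk.ne'
    rw [Function.iterate_succ_apply, fwdDiff_const]
    clear h hk
    induction m with
    | zero => rfl
    | succ m ih => rw [Function.iterate_succ_apply, fwdDiff_const]; exact ih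
  simpa [h0] using h

/-- The deviation of the smoothed function at `s` is controlled by that of the combinations
of translates of `f` by at most `K t`. -/
lemma norm_smoothOp_sub_le_of_translates {k K : ℕ} {t : ℝ} (ht : 0 ≤ t) {f : C(ℝ, ℂ)} {s ε : ℝ}
    {z : ℂ} (h : ∀ a ∈ Set.Icc 0 (K * t),
      ‖∑ l ∈ Finset.range k, smoothCoeff k l * f (s + ((l : ℝ) + 1) * a) - z‖ ≤ ε) :
    ‖smoothOp k K t f s - z‖ ≤ ε := by
  -- All k averages are driven by the same variable u: the l-th one has step (l + 1)t, so one
  -- averaging moves the common parameter b to b + tu in every translate (l + 1)b. The error is thus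
  -- an average of k-th differences with step in [0, Kt].
  have key : ∀ (K : ℕ) (b : ℝ), (∀ a ∈ Set.Icc b (b + K * t),
      ‖∑ l ∈ Finset.range k, smoothCoeff k l * f (s + ((l : ℝ) + 1) * a) - z‖ ≤ ε) →
      ‖∑ l ∈ Finset.range k, smoothCoeff k l *
        (steklov (((l : ℝ) + 1) * t) ^ K) f (s + ((l : ℝ) + 1) * b) - z‖ ≤ ε := by
    intro K
    induction K with
    | zero => intro b hb; exact hb b (by simp)
    | succ K ih =>
      intro b hb
      have e : ∑ l ∈ Finset.range k, smoothCoeff k l *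
          (steklov (((l : ℝ) + 1) * t) ^ (K + 1)) f (s + ((l : ℝ) + 1) * b) - z =
          ∫ u in (0 : ℝ)..1, (∑ l ∈ Finset.range k, smoothCoeff k l *
            (steklov (((l : ℝ) + 1) * t) ^ K) f (s + ((l : ℝ) + 1) * (b + t * u)) - z) := by
        rw [intervalIntegral.integral_sub (Continuous.intervalIntegrable (by fun_prop) _ _)
          (Continuous.intervalIntegrable (by fun_prop) _ _), intervalIntegral.integral_finsetSum
          fun l _ => Continuous.intervalIntegrable (by fun_prop) _ _]
        simp only [intervalIntegral.integral_const_mul, intervalIntegral.integral_const, sub_zero,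
          one_smul]
        congr 1
        refine Finset.sum_congr rfl fun l _ => ?_
        rw [pow_succ', Module.End.mul_apply, steklov_apply]
        simp only [mul_add, add_assoc, mul_assoc]
      rw [e]
      refine (intervalIntegral.norm_integral_le_of_norm_le_const (C := ε) fun u hu => ?_).trans ?_
      · rw [Set.uIoc_of_le zero_le_one] at hu
        refine ih _ fun a ha => hb a ?_
        have h1 : 0 ≤ t * u := mul_nonneg ht hu.1.le
        have h2 : t * u ≤ t := mul_le_of_le_one_right ht hu.2
        have := ha.1
        have := ha.2
        push_cast
        constructor <;> linarith
      · simp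
  have := key K 0 (by simpa using h)
  simpa [smoothOp_apply] using this

lemma norm_smoothOp_sub_le_of_diffOp {k K : ℕ} {t α A : ℝ} (ht : 0 ≤ t) (hα : 0 ≤ α) (hA : 0 ≤ A)
    {f : C(ℝ, ℂ)} (hf : ∀ h s, ‖(diffOp h ^ k) f s‖ ≤ A * |h| ^ α) (s : ℝ) :
    ‖smoothOp k K t f s - f s‖ ≤ A * (K * t) ^ α := by
  refine norm_smoothOp_sub_le_of_translates ht fun a ha => ?_
  rw [sum_smoothCoeff_mul, sub_sub_cancel_left, norm_neg, norm_mul, norm_pow, norm_neg, norm_one,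
    one_pow, one_mul, ← coe_diffOp_pow]
  refine (hf a s).trans ?_
  rw [abs_of_nonneg ha.1]
  gcongr
  · exact ha.1
  · exact ha.2

/-- The coefficients sum to 1, so constants pass through, and their moduli sum to at most 2^k. Only
values of `f` close to s matter, which gives convergence without any regularity beyond continuity.
-/
lemma norm_smoothOp_sub_le_local {k K : ℕ} (hk : 0 < k) {t : ℝ} (ht : 0 ≤ t) {f : C(ℝ, ℂ)}
    {s ε : ℝ} {z : ℂ} (h : ∀ a ∈ Set.Icc 0 (k * (K * t)), ‖f (s + a) - z‖ ≤ ε) :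
    ‖smoothOp k K t f s - z‖ ≤ 2 ^ k * ε := by
  have hε : 0 ≤ ε := (norm_nonneg _).trans (h 0 ⟨le_rfl, by positivity⟩)
  refine norm_smoothOp_sub_le_of_translates ht fun a ha => ?_
  have e : ∑ l ∈ Finset.range k, smoothCoeff k l * f (s + ((l : ℝ) + 1) * a) - z =
      ∑ l ∈ Finset.range k, smoothCoeff k l * (f (s + ((l : ℝ) + 1) * a) - z) := by
    simp only [mul_sub, Finset.sum_sub_distrib, ← Finset.sum_mul, sum_smoothCoeff hk, one_mul]
  rw [e]
  calc _ ≤ ∑ l ∈ Finset.range k, ‖smoothCoeff k l‖ * ε := by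
        refine norm_sum_le_of_le _ fun l hl => ?_
        rw [norm_mul]
        have hlk : (l : ℝ) + 1 ≤ k := by exact_mod_cast Finset.mem_range.1 hl
        gcongr
        refine h _ ⟨mul_nonneg (by positivity) ha.1, ?_⟩
        have := ha.2
        gcongr
        exact ha.1
    _ ≤ _ := by
        rw [← Finset.sum_mul]
        gcongr
        exact sum_norm_smoothCoeff_le k

lemma norm_smoothOp_le (k K : ℕ) (t : ℝ) {f : C(ℝ, ℂ)} {a : ℝ} (h : ∀ s, ‖f s‖ ≤ a) (s : ℝ) :
    ‖smoothOp k K t f s‖ ≤ 2 ^ k * a := by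
  have ha : 0 ≤ a := (norm_nonneg _).trans (h 0)
  rw [smoothOp_apply]
  calc _ ≤ ∑ l ∈ Finset.range k, ‖smoothCoeff k l‖ * a := by
        refine norm_sum_le_of_le _ fun l _ => ?_
        rw [norm_mul]
        gcongr
        exact norm_steklov_pow_le _ K h s
    _ ≤ _ := by
        rw [← Finset.sum_mul]
        gcongr
        exact sum_norm_smoothCoeff_le k

lemma commute_smoothOp_smoothOp (k K : ℕ) (t t' : ℝ) :
    Commute (smoothOp k K t) (smoothOp k K t') :=
  Commute.sum_left _ _ _ fun _ _ => Commute.sum_right _ _ _ fun _ _ =>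
    (((commute_steklov_steklov _ _).pow_pow _ _).smul_left _).smul_right _

lemma commute_diffOp_smoothOp (k K : ℕ) (h t : ℝ) : Commute (diffOp h) (smoothOp k K t) :=
  Commute.sum_right _ _ _ fun _ _ => ((commute_diffOp_steklov _ _).pow_right _).smul_right _

lemma contDiff_smoothOp (k K : ℕ) {t : ℝ} (ht : 0 < t) (f : C(ℝ, ℂ)) :
    ContDiff ℝ K (smoothOp k K t f) := by
  rw [coe_smoothOp]
  exact ContDiff.sum fun l _ => (contDiff_steklov_pow (by positivity) K f).const_smul _

lemma iteratedDeriv_smoothOp (k : ℕ) {K m : ℕ} (hm : m ≤ K) {t : ℝ} (ht : 0 < t) (f : C(ℝ, ℂ))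
    (s : ℝ) : iteratedDeriv m (smoothOp k K t f) s =
      ∑ l ∈ Finset.range k, smoothCoeff k l *
        iteratedDeriv m ((steklov (((l : ℝ) + 1) * t) ^ K) f) s := by
  have hc : ∀ l : ℕ, ContDiff ℝ m ((steklov (((l : ℝ) + 1) * t) ^ K) f) := fun l =>
    (contDiff_steklov_pow (by positivity) K f).of_le (by norm_cast)
  rw [coe_smoothOp, iteratedDeriv_fun_sum fun l _ => ((hc l).const_smul _).contDiffAt]
  exact Finset.sum_congr rfl fun l _ => iteratedDeriv_fun_const_smul (hc l).contDiffAt _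

lemma norm_iteratedDeriv_smoothOp_le (k : ℕ) {K m : ℕ} (hm : m ≤ K) {t : ℝ} (ht : 0 < t)
    {f : C(ℝ, ℂ)} {a : ℝ} (hf : ∀ s, ‖f s‖ ≤ a) (s : ℝ) :
    ‖iteratedDeriv m (smoothOp k K t f) s‖ ≤ 2 ^ k * (2 ^ m * t⁻¹ ^ m * a) := by
  have ha : 0 ≤ a := (norm_nonneg _).trans (hf 0)
  rw [iteratedDeriv_smoothOp k hm ht]
  calc _ ≤ ∑ l ∈ Finset.range k, ‖smoothCoeff k l‖ * (2 ^ m * t⁻¹ ^ m * a) := by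
        refine norm_sum_le_of_le _ fun l _ => ?_
        rw [norm_mul]
        gcongr
        refine (norm_iteratedDeriv_steklov_pow_le (by positivity) hm hf s).trans ?_
        gcongr
        nlinarith
    _ ≤ _ := by
        rw [← Finset.sum_mul]
        gcongr
        exact sum_norm_smoothCoeff_le k

lemma norm_iteratedDeriv_smoothOp_le_of_diffOp {k K m : ℕ} (hkm : k ≤ m) (hm : m ≤ K) {t α A : ℝ}
    (ht : 0 < t) (hα : 0 ≤ α) (hA : 0 ≤ A) {f : C(ℝ, ℂ)}
    (hf : ∀ h s, ‖(diffOp h ^ k) f s‖ ≤ A * |h| ^ α) (s : ℝ) :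
    ‖iteratedDeriv m (smoothOp k K t f) s‖ ≤ 2 ^ k * (2 ^ m * t⁻¹ ^ m * (A * (k * t) ^ α)) := by
  rw [iteratedDeriv_smoothOp k hm ht]
  calc _ ≤ ∑ l ∈ Finset.range k, ‖smoothCoeff k l‖ * (2 ^ m * t⁻¹ ^ m * (A * (k * t) ^ α)) := by
        refine norm_sum_le_of_le _ fun l hl => ?_
        have hlk : (l : ℝ) + 1 ≤ k := by exact_mod_cast Finset.mem_range.1 hl
        have hpos : 0 < ((l : ℝ) + 1) * t := by positivity
        rw [norm_mul]
        gcongr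
        refine (norm_iteratedDeriv_steklov_pow_le_of_diffOp hpos hkm hm (hf _) s).trans ?_
        rw [abs_of_pos hpos]
        gcongr
        nlinarith
    _ ≤ _ := by
        rw [← Finset.sum_mul]
        gcongr
        exact sum_norm_smoothCoeff_le k

lemma hasDerivAt_smoothOp (k K : ℕ) {t : ℝ} (ht : 0 < t) {f f' : C(ℝ, ℂ)}
    (hf : ∀ s, HasDerivAt f (f' s) s) (s : ℝ) :
    HasDerivAt (smoothOp k K t f) (smoothOp k K t f' s) s := by
  rw [coe_smoothOp, coe_smoothOp]
  exact HasDerivAt.fun_sum fun l _ =>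
    (hasDerivAt_steklov_pow_of_hasDerivAt (by positivity) K hf s).fun_const_smul _

end Steklov

/-! ### Littlewood–Paley pieces and their derivatives. -/

section LittlewoodPaley

/-- The smoothing operator at the scale `t`. -/
noncomputable def smoothSq (k K : ℕ) (t : ℝ) : Module.End ℂ C(ℝ, ℂ) :=
  smoothOp k K t * smoothOp k K t

lemma contDiff_smoothSq (k K : ℕ) {t : ℝ} (ht : 0 < t) (f : C(ℝ, ℂ)) :
    ContDiff ℝ K (smoothSq k K t f) := contDiff_smoothOp k K ht _

lemma hasDerivAt_smoothSq (k K : ℕ) {t : ℝ} (ht : 0 < t) {f f' : C(ℝ, ℂ)}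
    (hf : ∀ s, HasDerivAt f (f' s) s) (s : ℝ) :
    HasDerivAt (smoothSq k K t f) (smoothSq k K t f' s) s :=
  hasDerivAt_smoothOp k K ht (fun s => hasDerivAt_smoothOp k K ht hf s) s

/-- Quantitative Littlewood–Paley bounds for functions with `‖Δₕᵏ f‖ ≤ A |h| ^ α`. -/
lemma exists_smoothSq_bounds (k K : ℕ) {α : ℝ} (hα : 0 ≤ α) :
    ∃ C : ℝ, 0 ≤ C ∧ ∀ (f : C(ℝ, ℂ)) (A : ℝ), 0 ≤ A →
      (∀ h s, ‖(diffOp h ^ k) f s‖ ≤ A * |h| ^ α) → ∀ t : ℝ, 0 < t →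
      (∀ m ≤ K, ∀ s, ‖iteratedDeriv m ((smoothSq k K t - smoothSq k K (2 * t)) f) s‖ ≤
        C * A * t ^ α * t⁻¹ ^ m) ∧
      (∀ m, k ≤ m → m ≤ K → ∀ s, ‖iteratedDeriv m (smoothSq k K t f) s‖ ≤
        C * A * t ^ α * t⁻¹ ^ m) ∧
      (∀ s, ‖smoothSq k K t f s - f s‖ ≤ C * A * t ^ α) := by
  set C₁ : ℝ := 2 * (2 ^ k * (2 ^ K * (2 * (2 * K) ^ α)))
  set C₂ : ℝ := 2 ^ k * (2 ^ K * (2 ^ k * k ^ α))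
  set C₃ : ℝ := 2 ^ k * K ^ α + K ^ α
  have hC₁ : 0 ≤ C₁ := by positivity
  have hC₂ : 0 ≤ C₂ := by positivity
  have hC₃ : 0 ≤ C₃ := by positivity
  refine ⟨C₁ + C₂ + C₃, by positivity, fun f A hA hf t ht => ?_⟩
  have htα : 0 < t ^ α := Real.rpow_pos_of_pos ht α
  have hAt : 0 ≤ A * t ^ α := by positivity
  -- One smoothing commutes with differences, so it preserves the hypothesis up to a factor 2^k and
  -- the second smoothing can be estimated like the first.
  have hSf : ∀ h s, ‖(diffOp h ^ k) (smoothOp k K t f) s‖ ≤ 2 ^ k * A * |h| ^ α := by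
    intro h s
    rw [← Module.End.mul_apply, ((commute_diffOp_smoothOp k K h t).pow_left k).eq,
      Module.End.mul_apply, mul_assoc]
    exact norm_smoothOp_le k K t (hf h) s
  refine ⟨fun m hm s => ?_, fun m hkm hm s => ?_, fun s => ?_⟩
  · set E := (smoothOp k K t - smoothOp k K (2 * t)) f
    have hE : ∀ s, ‖E s‖ ≤ 2 * (2 * K) ^ α * (A * t ^ α) := by
      intro s
      have h1 := norm_smoothOp_sub_le_of_diffOp (K := K) ht.le hα hA hf s
      have h2 := norm_smoothOp_sub_le_of_diffOp (K := K) (t := 2 * t) (by positivity) hα hA hf s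
      have h3 : ((K : ℝ) * t) ^ α ≤ (2 * K) ^ α * t ^ α := by
        rw [← Real.mul_rpow (by positivity) ht.le]
        gcongr
        nlinarith [(Nat.cast_nonneg K : (0 : ℝ) ≤ K)]
      have h4 : ((K : ℝ) * (2 * t)) ^ α = (2 * K) ^ α * t ^ α := by
        rw [← Real.mul_rpow (by positivity) ht.le]
        ring_nf
      calc ‖E s‖ = ‖(smoothOp k K t f s - f s) - (smoothOp k K (2 * t) f s - f s)‖ := by
            congr 1
            simp only [E, LinearMap.sub_apply, ContinuousMap.sub_apply]
            ring
        _ ≤ A * (K * t) ^ α + A * (K * (2 * t)) ^ α := (norm_sub_le _ _).trans (add_le_add h1 h2)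
        _ ≤ A * ((2 * K) ^ α * t ^ α) + A * ((2 * K) ^ α * t ^ α) := by
            rw [h4]; gcongr
        _ = _ := by ring
    -- The reason for squaring: for commuting operators S_t² - S_{2t}² = (S_t + S_{2t})(S_t -
    -- S_{2t}). The difference gives the size t^α, and the sum then absorbs the derivatives at a
    -- cost of t⁻¹ each.
    have e : (smoothSq k K t - smoothSq k K (2 * t)) f =
        smoothOp k K t E + smoothOp k K (2 * t) E := by
      have hcomm : smoothOp k K t (smoothOp k K (2 * t) f) = smoothOp k K (2 * t) (smoothOp k K t f) :=
        DFunLike.congr_fun (commute_smoothOp_smoothOp k K t (2 * t)).eq f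
      simp only [E, smoothSq, LinearMap.sub_apply, Module.End.mul_apply, map_sub, hcomm]
      abel
    have ht2 : 0 < 2 * t := by positivity
    rw [e, ContinuousMap.coe_add, iteratedDeriv_add
      ((contDiff_smoothOp k K ht E).of_le (by exact_mod_cast hm)).contDiffAt
      ((contDiff_smoothOp k K ht2 E).of_le (by exact_mod_cast hm)).contDiffAt]
    have h1 := norm_iteratedDeriv_smoothOp_le k hm ht hE s
    have h2 := norm_iteratedDeriv_smoothOp_le k hm ht2 hE s
    calc _ ≤ 2 ^ k * (2 ^ m * t⁻¹ ^ m * (2 * (2 * K) ^ α * (A * t ^ α))) +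
          2 ^ k * (2 ^ m * (2 * t)⁻¹ ^ m * (2 * (2 * K) ^ α * (A * t ^ α))) :=
          (norm_add_le _ _).trans (add_le_add h1 h2)
      _ ≤ 2 ^ k * (2 ^ K * t⁻¹ ^ m * (2 * (2 * K) ^ α * (A * t ^ α))) +
          2 ^ k * (2 ^ K * t⁻¹ ^ m * (2 * (2 * K) ^ α * (A * t ^ α))) := by
          gcongr
          · norm_num
          · norm_num
          · linarith
      _ = C₁ * (A * t ^ α) * t⁻¹ ^ m := by ring
      _ ≤ (C₁ + C₂ + C₃) * (A * t ^ α) * t⁻¹ ^ m := by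
          gcongr
          linarith
      _ = _ := by ring
  · have h1 := norm_iteratedDeriv_smoothOp_le_of_diffOp hkm hm ht hα (by positivity) hSf s
    calc _ ≤ 2 ^ k * (2 ^ m * t⁻¹ ^ m * (2 ^ k * A * (k * t) ^ α)) := h1
      _ ≤ 2 ^ k * (2 ^ K * t⁻¹ ^ m * (2 ^ k * A * (k * t) ^ α)) := by
          gcongr
          norm_num
      _ = C₂ * (A * t ^ α) * t⁻¹ ^ m := by
          rw [Real.mul_rpow (by positivity) ht.le]
          ring
      _ ≤ (C₁ + C₂ + C₃) * (A * t ^ α) * t⁻¹ ^ m := by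
          gcongr
          linarith
      _ = _ := by ring
  · have h1 := norm_smoothOp_sub_le_of_diffOp (K := K) ht.le hα hA hf s
    have h2 := norm_smoothOp_sub_le_of_diffOp (K := K) ht.le hα (by positivity) hSf s
    calc ‖smoothSq k K t f s - f s‖ = ‖(smoothOp k K t (smoothOp k K t f) s - smoothOp k K t f s) +
          (smoothOp k K t f s - f s)‖ := by
          congr 1
          rw [smoothSq, Module.End.mul_apply]
          ring
      _ ≤ 2 ^ k * A * (K * t) ^ α + A * (K * t) ^ α := (norm_add_le _ _).trans (add_le_add h2 h1)
      _ = C₃ * (A * t ^ α) := by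
          rw [Real.mul_rpow (by positivity) ht.le]
          ring
      _ ≤ (C₁ + C₂ + C₃) * (A * t ^ α) := by
          gcongr
          linarith
      _ = _ := by ring

/-- The smoothings converge locally uniformly. -/
lemma exists_norm_smoothSq_sub_le {k : ℕ} (hk : 0 < k) (K : ℕ) (f : C(ℝ, ℂ)) (R : ℝ) {ε : ℝ}
    (hε : 0 < ε) : ∃ δ > 0, ∀ t, 0 ≤ t → t ≤ δ → ∀ s, |s| ≤ R → ‖smoothSq k K t f s - f s‖ ≤ ε := by
  have huc : UniformContinuousOn f (Set.Icc (-(R + 1)) (R + 1)) :=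
    isCompact_Icc.uniformContinuousOn_of_continuous f.continuous.continuousOn
  obtain ⟨δ₀, hδ₀, h⟩ := Metric.uniformContinuousOn_iff.1 huc (ε / (2 ^ k * 2 ^ k)) (by positivity)
  set c : ℝ := 2 * (k * K) + 1
  have hc : 0 < c := by positivity
  refine ⟨min 1 (δ₀ / 2) / c, by positivity, fun t ht htδ s hs => ?_⟩
  have htc : c * t ≤ min 1 (δ₀ / 2) := by
    rw [le_div_iff₀ hc] at htδ
    linarith
  have htc1 : c * t ≤ 1 := htc.trans (min_le_left _ _)
  have htc2 : c * t < δ₀ := (htc.trans (min_le_right _ _)).trans_lt (by linarith)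
  have hct : 2 * (k * (K * t)) ≤ c * t := by simp only [c]; linarith
  have hs' := abs_le.1 hs
  have hloc : ∀ a ∈ Set.Icc 0 (k * (K * t)), ∀ b ∈ Set.Icc 0 (k * (K * t)),
      ‖f (s + a + b) - f s‖ ≤ ε / (2 ^ k * 2 ^ k) := by
    intro a ha b hb
    have := ha.1
    have := ha.2
    have := hb.1
    have := hb.2
    rw [← dist_eq_norm]
    refine (h _ ⟨by linarith, by linarith⟩ _ ⟨by linarith, by linarith⟩ ?_).le
    rw [Real.dist_eq, abs_of_nonneg] <;> linarith
  have h1 : ∀ a ∈ Set.Icc 0 (k * (K * t)), ‖smoothOp k K t f (s + a) - f s‖ ≤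
      2 ^ k * (ε / (2 ^ k * 2 ^ k)) := fun a ha =>
    norm_smoothOp_sub_le_local hk ht (hloc a ha)
  refine (norm_smoothOp_sub_le_local hk ht h1).trans (le_of_eq ?_)
  field_simp

end LittlewoodPaley

/-! ### Difference quotients as averages of the derivative over a segment. -/

section Hadamard

/-- Weighted average of `g` over the segment from `x` to `s`; for `g = D'` and `j = 0` it is the
difference quotient of `D`. -/
noncomputable def segAvg (g : ℝ → ℂ) (x : ℝ) (j : ℕ) (s : ℝ) : ℂ :=
  ∫ θ in (0 : ℝ)..1, (θ : ℂ) ^ j * g (x + θ * (s - x))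

lemma continuous_segAvg {g : ℝ → ℂ} (hg : Continuous g) (x : ℝ) (j : ℕ) :
    Continuous (segAvg g x j) :=
  intervalIntegral.continuous_parametric_intervalIntegral_of_continuous' (by fun_prop) _ _

lemma norm_segAvg_le {g : ℝ → ℂ} {x s a : ℝ} (j : ℕ)
    (h : ∀ y, |y - x| ≤ |s - x| → ‖g y‖ ≤ a) : ‖segAvg g x j s‖ ≤ a := by
  refine (intervalIntegral.norm_integral_le_of_norm_le_const (C := a) fun θ hθ => ?_).trans ?_
  · rw [Set.uIoc_of_le zero_le_one] at hθ
    have hg : ‖g (x + θ * (s - x))‖ ≤ a := by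
      refine h _ ?_
      rw [add_sub_cancel_left, abs_mul, abs_of_pos hθ.1]
      exact mul_le_of_le_one_left (abs_nonneg _) hθ.2
    rw [norm_mul, norm_pow, Complex.norm_real, Real.norm_of_nonneg hθ.1.le]
    calc θ ^ j * ‖g (x + θ * (s - x))‖ ≤ 1 * a := by
          gcongr
          exact pow_le_one₀ hθ.1.le hθ.2
      _ = a := one_mul a
  · simp

lemma hasDerivAt_segAvg {g g' : ℝ → ℂ} (hg : ∀ y, HasDerivAt g (g' y) y) (hg' : Continuous g')
    (x : ℝ) (j : ℕ) (s : ℝ) : HasDerivAt (segAvg g x j) (segAvg g' x (j + 1) s) s := by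
  have hgc : Continuous g := continuous_iff_continuousAt.2 fun y => (hg y).continuousAt
  obtain ⟨C, hC⟩ := (isCompact_closedBall x (|s - x| + 1)).exists_bound_of_continuousOn
    hg'.continuousOn
  refine (intervalIntegral.hasDerivAt_integral_of_dominated_loc_of_deriv_le
    (F := fun s θ => (θ : ℂ) ^ j * g (x + θ * (s - x)))
    (F' := fun s θ => (θ : ℂ) ^ (j + 1) * g' (x + θ * (s - x)))
    (bound := fun _ => C) (Metric.ball_mem_nhds s one_pos)
    (Filter.Eventually.of_forall fun y => Continuous.aestronglyMeasurable (by fun_prop))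
    (Continuous.intervalIntegrable (by fun_prop) _ _)
    (Continuous.aestronglyMeasurable (by fun_prop)) ?_ (by simp) ?_).2
  · refine Filter.Eventually.of_forall fun θ hθ y hy => ?_
    rw [Set.uIoc_of_le zero_le_one] at hθ
    have hy' : |y - x| ≤ |s - x| + 1 := by
      have h1 := abs_sub_le y s x
      rw [Metric.mem_ball, Real.dist_eq] at hy
      linarith
    have hb : ‖g' (x + θ * (y - x))‖ ≤ C := by
      refine hC _ ?_
      rw [Metric.mem_closedBall, Real.dist_eq, add_sub_cancel_left, abs_mul, abs_of_pos hθ.1]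
      exact (mul_le_of_le_one_left (abs_nonneg _) hθ.2).trans hy'
    rw [norm_mul, norm_pow, Complex.norm_real, Real.norm_of_nonneg hθ.1.le]
    calc θ ^ (j + 1) * ‖g' (x + θ * (y - x))‖ ≤ 1 * C := by
          gcongr
          exact pow_le_one₀ hθ.1.le hθ.2
      _ = C := one_mul C
  · refine Filter.Eventually.of_forall fun θ _ y _ => ?_
    have h1 : HasDerivAt (fun y : ℝ => x + θ * (y - x)) θ y := by
      simpa using (((hasDerivAt_id y).sub_const x).const_mul θ).const_add x
    have h2 := ((hg (x + θ * (y - x))).scomp y h1).const_mul ((θ : ℂ) ^ j)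
    rw [Complex.real_smul, ← mul_assoc, ← pow_succ] at h2
    exact h2

lemma contDiff_segAvg {M : ℕ} {g : ℝ → ℂ} (hg : ContDiff ℝ M g) (x : ℝ) (j : ℕ) :
    ContDiff ℝ M (segAvg g x j) := by
  induction M generalizing g j with
  | zero =>
    simp only [Nat.cast_zero, contDiff_zero] at hg ⊢
    exact continuous_segAvg hg x j
  | succ M ih =>
    push_cast at hg ⊢
    rw [contDiff_succ_iff_deriv] at hg ⊢
    have hd := hasDerivAt_segAvg (fun y => (hg.1 y).hasDerivAt) hg.2.2.continuous x j
    refine ⟨fun s => (hd s).differentiableAt, by simp, ?_⟩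
    rw [funext fun s => (hd s).deriv]
    exact ih hg.2.2 (j + 1)

lemma iteratedDeriv_segAvg {m : ℕ} {g : ℝ → ℂ} (hg : ContDiff ℝ m g) (x : ℝ) (j : ℕ) (s : ℝ) :
    iteratedDeriv m (segAvg g x j) s = segAvg (iteratedDeriv m g) x (j + m) s := by
  induction m generalizing g j with
  | zero => simp
  | succ m ih =>
    push_cast at hg
    rw [contDiff_succ_iff_deriv] at hg
    have hd := hasDerivAt_segAvg (fun y => (hg.1 y).hasDerivAt) hg.2.2.continuous x j
    rw [iteratedDeriv_succ', iteratedDeriv_succ', funext fun s => (hd s).deriv, ih hg.2.2,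
      add_assoc, add_comm 1 m]

lemma sub_mul_segAvg_zero {D D' : ℝ → ℂ} (hD : ∀ y, HasDerivAt D (D' y) y) (hD' : Continuous D')
    (x s : ℝ) : ((s - x : ℝ) : ℂ) * segAvg D' x 0 s = D s - D x := by
  have h1 : ∀ θ : ℝ, HasDerivAt (fun θ : ℝ => D (x + θ * (s - x)))
      (((s - x : ℝ) : ℂ) * D' (x + θ * (s - x))) θ := by
    intro θ
    have h2 : HasDerivAt (fun θ : ℝ => x + θ * (s - x)) (s - x) θ := by
      simpa using ((hasDerivAt_id θ).mul_const (s - x)).const_add x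
    have h3 := (hD (x + θ * (s - x))).scomp θ h2
    rwa [Complex.real_smul] at h3
  have h2 := intervalIntegral.integral_eq_sub_of_hasDerivAt (a := 0) (b := 1) (fun θ _ => h1 θ)
    (Continuous.intervalIntegrable (by fun_prop) _ _)
  rw [intervalIntegral.integral_const_mul] at h2
  simpa [segAvg] using h2

/-- (s - x) g'(x + θ(s - x)) is the θ-derivative of g(x + θ(s - x)). Integrating by parts gains the
decay 1/|s - x| at no cost in derivatives of g: the boundary terms contribute 2a, the derivative of
θ^m contributes ma. -/
lemma norm_sub_mul_segAvg_le {g g' : ℝ → ℂ} (hg : ∀ y, HasDerivAt g (g' y) y) (hg' : Continuous g')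
    {a : ℝ} (ha : ∀ y, ‖g y‖ ≤ a) (x : ℝ) (m : ℕ) (s : ℝ) :
    |s - x| * ‖segAvg g' x m s‖ ≤ (m + 2) * a := by
  have ha0 : 0 ≤ a := (norm_nonneg _).trans (ha 0)
  have hgc : Continuous g := continuous_iff_continuousAt.2 fun y => (hg y).continuousAt
  have h1 : ∀ θ : ℝ, HasDerivAt (fun θ : ℝ => g (x + θ * (s - x)))
      (((s - x : ℝ) : ℂ) * g' (x + θ * (s - x))) θ := by
    intro θ
    have h2 : HasDerivAt (fun θ : ℝ => x + θ * (s - x)) (s - x) θ := by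
      simpa using ((hasDerivAt_id θ).mul_const (s - x)).const_add x
    have h3 := (hg (x + θ * (s - x))).scomp θ h2
    rwa [Complex.real_smul] at h3
  have h0 : ∀ θ : ℝ, HasDerivAt (fun θ : ℝ => (θ : ℂ) ^ m) ((m : ℂ) * (θ : ℂ) ^ (m - 1)) θ := by
    intro θ
    simpa using (hasDerivAt_pow m (θ : ℂ)).comp_ofReal
  have h2 := intervalIntegral.integral_mul_deriv_eq_deriv_mul (a := 0) (b := 1)
    (fun θ _ => h0 θ) (fun θ _ => h1 θ)
    (Continuous.intervalIntegrable (by fun_prop) _ _)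
    (Continuous.intervalIntegrable (by fun_prop) _ _)
  have h3 : ((s - x : ℝ) : ℂ) * segAvg g' x m s =
      ∫ θ in (0 : ℝ)..1, (θ : ℂ) ^ m * (((s - x : ℝ) : ℂ) * g' (x + θ * (s - x))) := by
    rw [segAvg, ← intervalIntegral.integral_const_mul]
    simp only [mul_left_comm]
  have h4 : ‖∫ θ in (0 : ℝ)..1, (m : ℂ) * (θ : ℂ) ^ (m - 1) * g (x + θ * (s - x))‖ ≤ m * a := by
    refine (intervalIntegral.norm_integral_le_of_norm_le_const (C := m * a) fun θ hθ => ?_).trans ?_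
    · rw [Set.uIoc_of_le zero_le_one] at hθ
      rw [norm_mul, norm_mul, norm_pow, Complex.norm_real, Real.norm_of_nonneg hθ.1.le,
        Complex.norm_natCast]
      calc (m : ℝ) * θ ^ (m - 1) * ‖g (x + θ * (s - x))‖ ≤ m * 1 * a := by
            gcongr
            · exact pow_le_one₀ hθ.1.le hθ.2
            · exact ha _
        _ = m * a := by ring
    · simp
  have h5 : ‖((1 : ℝ) : ℂ) ^ m * g (x + 1 * (s - x))‖ ≤ a := by simpa using ha s
  have h6 : ‖((0 : ℝ) : ℂ) ^ m * g (x + 0 * (s - x))‖ ≤ a := by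
    rw [norm_mul, norm_pow]
    calc _ ≤ 1 * a := by
          gcongr
          · exact pow_le_one₀ (norm_nonneg _) (by simp)
          · exact ha _
      _ = a := one_mul a
  rw [← Real.norm_eq_abs, ← Complex.norm_real, ← norm_mul, h3, h2]
  calc _ ≤ a + a + m * a := (norm_sub_le _ _).trans (add_le_add ((norm_sub_le _ _).trans
        (add_le_add h5 h6)) h4)
    _ = _ := by ring

/-- Derivatives of the difference quotient of a function living at the scale `t`. -/
lemma norm_iteratedDeriv_segAvg_deriv_le {M : ℕ} {D : ℝ → ℂ} (hD : ContDiff ℝ (M + 1 : ℕ) D)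
    {t c : ℝ} (ht : 0 < t) (h : ∀ m ≤ M + 1, ∀ s, ‖iteratedDeriv m D s‖ ≤ c * t⁻¹ ^ m) (x : ℝ)
    {m : ℕ} (hm : m ≤ M) (s : ℝ) :
    (t + |s - x|) * ‖iteratedDeriv m (segAvg (deriv D) x 0) s‖ ≤ (m + 3) * c * t⁻¹ ^ m := by
  have hD' : ContDiff ℝ m (deriv D) :=
    ((contDiff_succ_iff_deriv (n := M)).1 (by exact_mod_cast hD)).2.2.of_le (by exact_mod_cast hm)
  rw [iteratedDeriv_segAvg hD', zero_add, ← iteratedDeriv_succ', add_mul]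
  -- The weight t + |s - x| is split: the part t pays for one more derivative of D, the part |s - x|
  -- is handled by integration by parts.
  have h1 : ‖segAvg (iteratedDeriv (m + 1) D) x m s‖ ≤ c * t⁻¹ ^ (m + 1) :=
    norm_segAvg_le m fun y _ => h (m + 1) (by omega) y
  have hdiff : ∀ y, HasDerivAt (iteratedDeriv m D) (iteratedDeriv (m + 1) D y) y := by
    intro y
    rw [iteratedDeriv_succ]
    exact (hD.differentiable_iteratedDeriv m (by exact_mod_cast Nat.lt_succ_of_le hm) y).hasDerivAt
  have h2 := norm_sub_mul_segAvg_le hdiff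
    (hD.continuous_iteratedDeriv (m + 1) (by exact_mod_cast Nat.succ_le_succ hm))
    (h m (by omega)) x m s
  have h3 : t * (c * t⁻¹ ^ (m + 1)) = c * t⁻¹ ^ m := by
    rw [pow_succ]; field_simp
  have h4 := mul_le_mul_of_nonneg_left h1 ht.le
  rw [h3] at h4
  linarith

end Hadamard

/-! ### Testing a distribution on functions of finite smoothness; cutoffs and partitions of unity.
-/

section TestFunctions

open Metric Filter Topology
open scoped Convolution ContDiff

lemma iteratedDeriv_eq_zero_of_eqOn_compl {F : Type*} [NormedAddCommGroup F] [NormedSpace ℝ F]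
    {ψ : ℝ → F} {S : Set ℝ} (hS : IsClosed S)
    (h : ∀ s ∉ S, ψ s = 0) (m : ℕ) {s : ℝ} (hs : s ∉ S) : iteratedDeriv m ψ s = 0 := by
  have h1 : ψ =ᶠ[𝓝 s] fun _ => 0 := by
    filter_upwards [hS.isOpen_compl.mem_nhds hs] with y hy using h y hy
  rw [h1.iteratedDeriv_eq m, iteratedDeriv_fun_const_zero]

lemma iteratedDeriv_normed_convolution (φ : ContDiffBump (0 : ℝ)) {M : ℕ} {ψ : ℝ → ℂ}
    (hψ : ContDiff ℝ M ψ) (hc : HasCompactSupport ψ) {m : ℕ} (hm : m ≤ M) :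
    iteratedDeriv m (φ.normed volume ⋆[ContinuousLinearMap.lsmul ℝ ℝ, volume] ψ) =
      φ.normed volume ⋆[ContinuousLinearMap.lsmul ℝ ℝ, volume] (iteratedDeriv m ψ) := by
  induction m with
  | zero => simp
  | succ m ih =>
    have hd : ContDiff ℝ 1 (iteratedDeriv m ψ) := by
      refine ContDiff.iterate_deriv' 1 m ?_ |> fun h => by simpa [iteratedDeriv_eq_iterate] using h
      exact hψ.of_le (by norm_cast; omega)
    have hcs : HasCompactSupport (iteratedDeriv m ψ) := by
      refine HasCompactSupport.intro hc.isCompact fun s hs => ?_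
      exact iteratedDeriv_eq_zero_of_eqOn_compl (isClosed_tsupport ψ)
        (fun y hy => image_eq_zero_of_notMem_tsupport hy) m hs
    rw [iteratedDeriv_succ, ih (by omega), iteratedDeriv_succ]
    ext x
    exact (hcs.hasDerivAt_convolution_right _ (φ.continuous_normed.locallyIntegrable) hd x).deriv

lemma norm_normed_convolution_le (φ : ContDiffBump (0 : ℝ)) {g : ℝ → ℂ} (hg : Continuous g)
    {a : ℝ} {x : ℝ} (h : ∀ y ∈ ball x φ.rOut, ‖g y‖ ≤ a) :
    ‖(φ.normed volume ⋆[ContinuousLinearMap.lsmul ℝ ℝ, volume] g) x‖ ≤ a := by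
  rw [← dist_zero_right]
  refine dist_convolution_le ((norm_nonneg _).trans (h x (mem_ball_self φ.rOut_pos)))
    φ.support_normed_eq.subset φ.nonneg_normed φ.integral_normed hg.aestronglyMeasurable ?_
  simpa using h

/-- The pairing of a locally integrable function with a `C^M` test function living on an interval
is controlled by the grand maximal function at any point of that interval. -/
lemma enorm_integral_mul_le_grandMaximal {M : ℕ} {u : 𝓢'(ℝ, ℂ)} {f : ℝ → ℂ} (hu : IsGivenBy u f)
    {c t a : ℝ} (ht : 0 < t) {ψ : ℝ → ℂ} (hψ : ContDiff ℝ M ψ)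
    (hsupp : ∀ s ∉ closedBall c t, ψ s = 0)
    (hb : ∀ m ≤ M, ∀ s, t ^ (m + 1) * ‖iteratedDeriv m ψ s‖ ≤ a) {y : ℝ} (hy : y ∈ closedBall c t) :
    ‖∫ s, f s * ψ s‖ₑ ≤ ENNReal.ofReal (4 ^ (2 * (M + 1)) * a) * grandMaximal M u y := by
  have ha : 0 ≤ a := le_trans (by positivity) (hb 0 (Nat.zero_le _) 0)
  rcases ha.eq_or_lt with rfl | ha
  · have h0 : ∀ s, ψ s = 0 := fun s => by
      have h1 := hb 0 (Nat.zero_le _) s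
      rw [iteratedDeriv_zero] at h1
      have h2 : ‖ψ s‖ ≤ 0 := by
        by_contra! h3
        have : 0 < t ^ (0 + 1) * ‖ψ s‖ := by positivity
        linarith
      simpa using h2
    simp [h0]
  have hψc : Continuous ψ := hψ.continuous
  have hcs : HasCompactSupport ψ := HasCompactSupport.intro (isCompact_closedBall c t) hsupp
  have hbm : ∀ m ≤ M, ∀ s, ‖iteratedDeriv m ψ s‖ ≤ a * t⁻¹ ^ (m + 1) := fun m hm s => by
    have := hb m hm s
    rw [inv_pow, ← div_eq_mul_inv, le_div_iff₀ (by positivity)]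
    linarith
  -- The distribution is tied to `f` only through Schwartz test functions, so ψ is mollified.
  -- Convolution with a probability density keeps the derivative bounds, and radii at most t keep
  -- the support within twice the interval.
  let φ : ℕ → ContDiffBump (0 : ℝ) := fun n =>
    ⟨t / (n + 1) / 2, t / (n + 1), by positivity, half_lt_self (by positivity)⟩
  have hφt : ∀ n, (φ n).rOut ≤ t := fun n => by
    change t / (n + 1) ≤ t
    exact div_le_self ht.le (by linarith [(Nat.cast_nonneg n : (0 : ℝ) ≤ n)])
  have hφ0 : Tendsto (fun n => (φ n).rOut) atTop (𝓝 0) :=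
    tendsto_const_div_atTop_nhds_zero_nat t |>.comp (tendsto_add_atTop_nat 1) |>.congr fun n => by
      simp [φ]
  set χ : ℕ → ℝ → ℂ := fun n =>
    (φ n).normed volume ⋆[ContinuousLinearMap.lsmul ℝ ℝ, volume] ψ with hχ
  have hder : ∀ n, ∀ m ≤ M, iteratedDeriv m (χ n) =
      (φ n).normed volume ⋆[ContinuousLinearMap.lsmul ℝ ℝ, volume] (iteratedDeriv m ψ) :=
    fun n m hm => iteratedDeriv_normed_convolution (φ n) hψ hcs hm
  have hmc : ∀ m ≤ M, Continuous (iteratedDeriv m ψ) := fun m hm =>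
    hψ.continuous_iteratedDeriv m (by exact_mod_cast hm)
  have hχb : ∀ n, ∀ m ≤ M, ∀ s, ‖iteratedDeriv m (χ n) s‖ ≤ a * t⁻¹ ^ (m + 1) := by
    intro n m hm s
    rw [hder n m hm]
    exact norm_normed_convolution_le (φ n) (hmc m hm) fun y _ => hbm m hm y
  have hχ0 : ∀ n, ∀ s ∉ closedBall c (2 * t), χ n s = 0 := by
    intro n s hs
    have h1 : ‖χ n s‖ ≤ 0 := norm_normed_convolution_le (φ n) hψc fun y hy => by
      rw [hsupp y, norm_zero]
      intro hyc
      apply hs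
      have := hφt n
      rw [mem_ball] at hy
      rw [mem_closedBall] at hyc ⊢
      have h2 := dist_triangle s y c
      rw [dist_comm s y] at h2
      linarith
    simpa using h1
  have hχs : ∀ n, ContDiff ℝ ∞ (χ n) := fun n =>
    (φ n).hasCompactSupport_normed.contDiff_convolution_left _ (φ n).contDiff_normed
      hψc.locallyIntegrable
  have hχcs : ∀ n, HasCompactSupport (χ n) := fun n =>
    HasCompactSupport.intro (isCompact_closedBall c (2 * t)) (hχ0 n)
  have hlim : Tendsto (fun n => ∫ s, f s * χ n s) atTop (𝓝 (∫ s, f s * ψ s)) := by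
    refine tendsto_integral_of_dominated_convergence
      ((closedBall c (2 * t)).indicator fun s => ‖f s‖ * (a * t⁻¹ ^ (0 + 1))) (fun n =>
        hu.1.aestronglyMeasurable.mul (hχs n).continuous.aestronglyMeasurable) ?_ ?_ ?_
    · rw [integrable_indicator_iff measurableSet_closedBall]
      exact (hu.1.integrableOn_isCompact (isCompact_closedBall _ _)).norm.mul_const _
    · refine fun n => Eventually.of_forall fun s => ?_
      by_cases hs : s ∈ closedBall c (2 * t)
      · rw [Set.indicator_of_mem hs, norm_mul]
        gcongr
        simpa using hχb n 0 (Nat.zero_le _) s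
      · rw [Set.indicator_of_notMem hs, hχ0 n s hs]
        simp
    · refine Eventually.of_forall fun s => ?_
      exact (ContDiffBump.convolution_tendsto_right_of_continuous hφ0 hψc s).const_mul (f s)
  refine le_of_tendsto ((continuous_enorm.tendsto _).comp hlim) (Eventually.of_forall fun n => ?_)
  -- For y within t of c and s within 2t of c one has 1 + |y - s|/t ≤ 4; this is the price of basing
  -- the test function at an arbitrary y.
  set κ : ℝ := 4 ^ (2 * (M + 1)) * a with hκ
  have hκ0 : 0 < κ := by positivity
  let Ψ : 𝓢(ℝ, ℂ) := (hχcs n).toSchwartzMap (hχs n)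
  have hΨ : (⇑Ψ : ℝ → ℂ) = χ n := rfl
  have hadapt : IsAdapted M y t (((κ⁻¹ : ℝ) : ℂ) • Ψ) := by
    intro m hm s
    have h1 : iteratedDeriv m (⇑(((κ⁻¹ : ℝ) : ℂ) • Ψ)) s =
        ((κ⁻¹ : ℝ) : ℂ) • iteratedDeriv m (χ n) s := iteratedDeriv_const_smul (Ψ.smooth m).contDiffAt _
    rw [h1, norm_smul, Complex.norm_real, Real.norm_of_nonneg (by positivity)]
    by_cases hs : s ∈ closedBall c (2 * t)
    · have h2 : (1 + |y - s| / t) ^ (2 * (M + 1)) ≤ 4 ^ (2 * (M + 1)) := by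
        gcongr
        have h3 : |y - s| ≤ 3 * t := by
          rw [mem_closedBall, Real.dist_eq] at hs hy
          have := abs_sub_le y c s
          rw [abs_sub_comm c s] at this
          linarith
        have : |y - s| / t ≤ 3 := by rwa [div_le_iff₀ ht]
        linarith
      calc t ^ (m + 1) * (1 + |y - s| / t) ^ (2 * (M + 1)) * (κ⁻¹ * ‖iteratedDeriv m (χ n) s‖)
          ≤ t ^ (m + 1) * 4 ^ (2 * (M + 1)) * (κ⁻¹ * (a * t⁻¹ ^ (m + 1))) := by
            gcongr
            exact hχb n m hm s
        _ = 1 := by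
            rw [hκ, inv_pow]
            field_simp
    · rw [iteratedDeriv_eq_zero_of_eqOn_compl isClosed_closedBall (hχ0 n) m hs]
      simp
  have h2 := enorm_le_grandMaximal u ht hadapt
  rw [map_smul, enorm_smul, ← ofReal_norm, Complex.norm_real, Real.norm_of_nonneg (by positivity),
    ENNReal.ofReal_inv_of_pos hκ0, mul_comm, ← div_eq_mul_inv,
    ENNReal.div_le_iff (by simpa using hκ0) ENNReal.ofReal_ne_top, mul_comm,
    hu.2 Ψ (hχcs n)] at h2
  exact h2

/-- By the Leibniz rule, derivative bounds of the form t^(-m) are stable under products. -/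
lemma norm_iteratedDeriv_mul_le_of_scale {M : ℕ} {ψ χ : ℝ → ℂ} (hψ : ContDiff ℝ M ψ)
    (hχ : ContDiff ℝ M χ) {a b t s : ℝ} (ht : 0 < t)
    (h1 : ∀ m ≤ M, ‖iteratedDeriv m ψ s‖ ≤ a * t⁻¹ ^ m)
    (h2 : ∀ m ≤ M, ‖iteratedDeriv m χ s‖ ≤ b * t⁻¹ ^ m) {m : ℕ} (hm : m ≤ M) :
    ‖iteratedDeriv m (fun s => ψ s * χ s) s‖ ≤ 2 ^ M * (a * b) * t⁻¹ ^ m := by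
  have ha : 0 ≤ a := by simpa using (norm_nonneg _).trans (h1 0 (Nat.zero_le _))
  have hb : 0 ≤ b := by simpa using (norm_nonneg _).trans (h2 0 (Nat.zero_le _))
  rw [iteratedDeriv_fun_mul (hψ.of_le (by exact_mod_cast hm)).contDiffAt
    (hχ.of_le (by exact_mod_cast hm)).contDiffAt]
  calc _ ≤ ∑ i ∈ Finset.range (m + 1), (m.choose i : ℝ) * (a * b * t⁻¹ ^ m) := by
        refine norm_sum_le_of_le _ fun i hi => ?_
        have him : i ≤ m := by simpa [Nat.lt_succ_iff] using hi
        rw [norm_mul, norm_mul, Complex.norm_natCast]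
        calc _ ≤ (m.choose i : ℝ) * (a * t⁻¹ ^ i) * (b * t⁻¹ ^ (m - i)) := by
              gcongr
              · exact h1 i (by omega)
              · exact h2 (m - i) (by omega)
          _ = (m.choose i : ℝ) * (a * b * (t⁻¹ ^ i * t⁻¹ ^ (m - i))) := by ring
          _ = _ := by rw [← pow_add, Nat.add_sub_cancel' him]
    _ = 2 ^ m * (a * b * t⁻¹ ^ m) := by
        rw [← Finset.sum_mul]
        congr 1
        exact_mod_cast Nat.sum_range_choose m
    _ ≤ 2 ^ M * (a * b * t⁻¹ ^ m) := by
        gcongr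
        norm_num
    _ = _ := by ring

/-- A smooth bump supported in `[-1, 1]` whose integer translates sum to one. -/
noncomputable def unitBump (y : ℝ) : ℂ :=
  ((Real.smoothTransition (y + 1) - Real.smoothTransition y : ℝ) : ℂ)

/-- A smooth cutoff equal to one on `[-1, 1]` and supported in `[-2, 2]`. -/
noncomputable def unitCutoff (y : ℝ) : ℂ :=
  ((Real.smoothTransition (y + 2) - Real.smoothTransition (y - 1) : ℝ) : ℂ)

lemma contDiff_unitBump {n : ℕ∞} : ContDiff ℝ n unitBump :=
  Complex.ofRealCLM.contDiff.comp ((Real.smoothTransition.contDiff.comp (by fun_prop)).sub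
    Real.smoothTransition.contDiff)

lemma contDiff_unitCutoff {n : ℕ∞} : ContDiff ℝ n unitCutoff :=
  Complex.ofRealCLM.contDiff.comp ((Real.smoothTransition.contDiff.comp (by fun_prop)).sub
    (Real.smoothTransition.contDiff.comp (by fun_prop)))

lemma unitBump_eq_zero {y : ℝ} (hy : 1 < |y|) : unitBump y = 0 := by
  unfold unitBump
  rcases lt_abs.1 hy with h | h
  · rw [Real.smoothTransition.one_of_one_le (by linarith),
      Real.smoothTransition.one_of_one_le (by linarith)]
    simp
  · rw [Real.smoothTransition.zero_of_nonpos (by linarith),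
      Real.smoothTransition.zero_of_nonpos (by linarith)]
    simp

lemma unitCutoff_eq_zero {y : ℝ} (hy : 2 < |y|) : unitCutoff y = 0 := by
  unfold unitCutoff
  rcases lt_abs.1 hy with h | h
  · rw [Real.smoothTransition.one_of_one_le (by linarith),
      Real.smoothTransition.one_of_one_le (by linarith)]
    simp
  · rw [Real.smoothTransition.zero_of_nonpos (by linarith),
      Real.smoothTransition.zero_of_nonpos (by linarith)]
    simp

lemma unitCutoff_eq_one {y : ℝ} (hy : |y| ≤ 1) : unitCutoff y = 1 := by
  have h := abs_le.1 hy
  unfold unitCutoff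
  rw [Real.smoothTransition.one_of_one_le (by linarith),
    Real.smoothTransition.zero_of_nonpos (by linarith)]
  simp

lemma norm_unitCutoff_le (y : ℝ) : ‖unitCutoff y‖ ≤ 1 := by
  unfold unitCutoff
  rw [Complex.norm_real, Real.norm_eq_abs, abs_le]
  have h1 := Real.smoothTransition.nonneg (y + 2)
  have h2 := Real.smoothTransition.le_one (y + 2)
  have h3 := Real.smoothTransition.nonneg (y - 1)
  have h4 := Real.smoothTransition.le_one (y - 1)
  constructor <;> linarith

/-- The sum telescopes to the transition at y + L + 1 minus the transition at y - L. -/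
lemma sum_unitBump {y : ℝ} {L : ℕ} (hy : |y| ≤ L) :
    ∑ n ∈ Finset.Icc (-L : ℤ) L, unitBump (y - n) = 1 := by
  have key : ∀ L : ℕ, ∑ n ∈ Finset.Icc (-L : ℤ) L, unitBump (y - n) =
      ((Real.smoothTransition (y + L + 1) - Real.smoothTransition (y - L) : ℝ) : ℂ) := by
    intro L
    induction L with
    | zero => simp [unitBump]
    | succ L ih =>
      have e : Finset.Icc (-(L + 1 : ℕ) : ℤ) (L + 1 : ℕ) =
          insert (-(L + 1 : ℕ) : ℤ) (insert ((L + 1 : ℕ) : ℤ) (Finset.Icc (-L : ℤ) L)) := by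
        ext n
        simp only [Finset.mem_Icc, Finset.mem_insert]
        push_cast
        omega
      rw [e, Finset.sum_insert, Finset.sum_insert, ih]
      · simp only [unitBump]
        push_cast
        ring_nf
      · simp
      · simp only [Finset.mem_insert, Finset.mem_Icc]
        push_cast
        omega
  have h := abs_le.1 hy
  rw [key, Real.smoothTransition.one_of_one_le (by linarith),
    Real.smoothTransition.zero_of_nonpos (by linarith)]
  simp

lemma exists_norm_iteratedDeriv_le {g : ℝ → ℂ} (hg : ∀ n : ℕ∞, ContDiff ℝ n g)
    (hc : HasCompactSupport g) (M : ℕ) :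
    ∃ Z : ℝ, 0 ≤ Z ∧ ∀ m ≤ M, ∀ y, ‖iteratedDeriv m g y‖ ≤ Z := by
  have h : ∀ m : ℕ, ∃ Z : ℝ, ∀ y, ‖iteratedDeriv m g y‖ ≤ Z := fun m => by
    have hcm : HasCompactSupport (iteratedDeriv m g) :=
      HasCompactSupport.intro hc.isCompact fun s hs =>
        iteratedDeriv_eq_zero_of_eqOn_compl (isClosed_tsupport g)
          (fun y hy => image_eq_zero_of_notMem_tsupport hy) m hs
    exact ((hg m).continuous_iteratedDeriv m le_rfl).bounded_above_of_compact_support hcm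
  choose Z hZ using h
  have hZ0 : ∀ m, 0 ≤ Z m := fun m => (norm_nonneg _).trans (hZ m 0)
  refine ⟨∑ m ∈ Finset.range (M + 1), Z m, Finset.sum_nonneg fun m _ => hZ0 m, fun m hm y => ?_⟩
  exact (hZ m y).trans (Finset.single_le_sum (fun m _ => hZ0 m)
    (Finset.mem_range.2 (Nat.lt_succ_of_le hm)))

lemma exists_unitBump_bound (M : ℕ) :
    ∃ Z : ℝ, 0 ≤ Z ∧ ∀ m ≤ M, ∀ y, ‖iteratedDeriv m unitBump y‖ ≤ Z :=
  exists_norm_iteratedDeriv_le (fun _ => contDiff_unitBump)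
    (HasCompactSupport.intro (isCompact_closedBall 0 1) fun y hy => unitBump_eq_zero (by
      simpa using hy)) M

lemma exists_unitCutoff_bound (M : ℕ) :
    ∃ Z : ℝ, 0 ≤ Z ∧ ∀ m ≤ M, ∀ y, ‖iteratedDeriv m unitCutoff y‖ ≤ Z :=
  exists_norm_iteratedDeriv_le (fun _ => contDiff_unitCutoff)
    (HasCompactSupport.intro (isCompact_closedBall 0 2) fun y hy => unitCutoff_eq_zero (by
      simpa using hy)) M

lemma norm_iteratedDeriv_rescale_le {M : ℕ} {g : ℝ → ℂ} (hg : ContDiff ℝ M g) {Z : ℝ}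
    (hZ : ∀ m ≤ M, ∀ y, ‖iteratedDeriv m g y‖ ≤ Z) {t : ℝ} (ht : 0 < t) (c : ℝ) {m : ℕ}
    (hm : m ≤ M) (s : ℝ) : ‖iteratedDeriv m (fun s => g (t⁻¹ * (s - c))) s‖ ≤ Z * t⁻¹ ^ m := by
  have h1 := iteratedDeriv_comp_sub_const m (fun y => g (t⁻¹ * y)) c
  rw [h1, iteratedDeriv_comp_const_smul (hg.of_le (by exact_mod_cast hm))]
  simp only
  rw [norm_smul, norm_pow, Real.norm_of_nonneg (by positivity), mul_comm]
  gcongr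
  exact hZ m hm _

end TestFunctions

/-! ### One Littlewood–Paley piece, and the growth of the low frequencies. -/

section PointwiseEstimate

open Metric Filter Topology

/-- The pairing of `f` with the difference quotient at `x` of a primitive of `g`, cut off at the
scale `T`. -/
noncomputable def cutPairing (f : ℝ → ℂ) (x T : ℝ) (g : C(ℝ, ℂ)) : ℂ :=
  ∫ s, f s * (unitCutoff (T⁻¹ * (s - x)) * segAvg g x 0 s)

lemma cutoff_eq_zero {x T s : ℝ} (hT : 0 < T) (hs : s ∉ closedBall x (2 * T)) :
    unitCutoff (T⁻¹ * (s - x)) = 0 := by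
  apply unitCutoff_eq_zero
  rw [mem_closedBall, Real.dist_eq, not_le] at hs
  rw [abs_mul, abs_of_pos (inv_pos.2 hT), inv_mul_eq_div, lt_div_iff₀ hT]
  exact hs

lemma continuous_cutoff (x T : ℝ) : Continuous fun s => unitCutoff (T⁻¹ * (s - x)) :=
  (contDiff_unitCutoff (n := 0)).continuous.comp (by fun_prop)

lemma integrable_mul_cutoff {f : ℝ → ℂ} (hf : LocallyIntegrable f) {x T : ℝ} (hT : 0 < T)
    {g : ℝ → ℂ} (hg : Continuous g) :
    Integrable fun s => f s * (unitCutoff (T⁻¹ * (s - x)) * g s) := by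
  have hc : Continuous fun s => unitCutoff (T⁻¹ * (s - x)) * g s := (continuous_cutoff x T).mul hg
  have hcs : HasCompactSupport fun s => unitCutoff (T⁻¹ * (s - x)) * g s :=
    HasCompactSupport.intro (isCompact_closedBall x (2 * T)) fun s hs => by
      simp [cutoff_eq_zero hT hs]
  have := hf.integrable_smul_right_of_hasCompactSupport hc hcs
  simpa only [smul_eq_mul] using this

lemma segAvg_sub {g₁ g₂ : ℝ → ℂ} (h₁ : Continuous g₁) (h₂ : Continuous g₂) (x : ℝ) (j : ℕ) (s : ℝ) :
    segAvg (fun y => g₁ y - g₂ y) x j s = segAvg g₁ x j s - segAvg g₂ x j s := by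
  unfold segAvg
  rw [← intervalIntegral.integral_sub (Continuous.intervalIntegrable (by fun_prop) _ _)
    (Continuous.intervalIntegrable (by fun_prop) _ _)]
  simp only [mul_sub]

lemma cutPairing_sub {f : ℝ → ℂ} (hf : LocallyIntegrable f) (x : ℝ) {T : ℝ} (hT : 0 < T)
    (g₁ g₂ : C(ℝ, ℂ)) :
    cutPairing f x T (g₁ - g₂) = cutPairing f x T g₁ - cutPairing f x T g₂ := by
  unfold cutPairing
  rw [← integral_sub (integrable_mul_cutoff hf hT (continuous_segAvg g₁.continuous x 0))
    (integrable_mul_cutoff hf hT (continuous_segAvg g₂.continuous x 0))]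
  refine integral_congr_ae (Eventually.of_forall fun s => ?_)
  have := segAvg_sub g₁.continuous g₂.continuous x 0 s
  simp only
  rw [ContinuousMap.coe_sub, show (⇑g₁ - ⇑g₂) = fun y => g₁ y - g₂ y from rfl, this]
  ring

lemma norm_cutPairing_le {f : ℝ → ℂ} (hf : LocallyIntegrable f) {x T ε : ℝ} (hT : 0 < T)
    {g : C(ℝ, ℂ)} (hg : ∀ y, |y - x| ≤ 2 * T → ‖g y‖ ≤ ε) :
    ‖cutPairing f x T g‖ ≤ (∫ s in closedBall x (2 * T), ‖f s‖) * ε := by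
  have hint : IntegrableOn f (closedBall x (2 * T)) :=
    hf.integrableOn_isCompact (isCompact_closedBall _ _)
  rw [← integral_mul_const, ← integral_indicator measurableSet_closedBall]
  refine norm_integral_le_of_norm_le ?_ (Eventually.of_forall fun s => ?_)
  · rw [integrable_indicator_iff measurableSet_closedBall]
    exact hint.norm.mul_const _
  · by_cases hs : s ∈ closedBall x (2 * T)
    · rw [Set.indicator_of_mem hs, norm_mul, norm_mul]
      rw [mem_closedBall, Real.dist_eq] at hs
      have h1 : ‖segAvg g x 0 s‖ ≤ ε := norm_segAvg_le 0 fun y hy => hg y (hy.trans hs)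
      calc _ ≤ ‖f s‖ * (1 * ‖segAvg g x 0 s‖) := by
            gcongr
            exact norm_unitCutoff_le _
        _ ≤ _ := by
            rw [one_mul]
            gcongr
    · rw [Set.indicator_of_notMem hs, cutoff_eq_zero hT hs]
      simp

lemma ENNReal.le_mul_iInf₂ {ι : Type*} {S : Set ι} {F : ι → ℝ≥0∞} (hS : S.Nonempty) {v a : ℝ≥0∞}
    (ha : a ≠ ∞) (h : ∀ y ∈ S, v ≤ a * F y) : v ≤ a * ⨅ y ∈ S, F y := by
  rcases eq_or_ne a 0 with rfl | h0
  · obtain ⟨y, hy⟩ := hS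
    simpa using h y hy
  · calc v = a * (v / a) := (ENNReal.mul_div_cancel h0 ha).symm
      _ ≤ _ := by
        gcongr
        exact le_iInf₂ fun y hy => ENNReal.div_le_of_le_mul' (h y hy)

/-- The contribution of a function living at the scale `t`. -/
lemma exists_enorm_cutPairing_le (M : ℕ) :
    ∃ C : ℝ, 0 ≤ C ∧ ∀ (u : 𝓢'(ℝ, ℂ)) (f : ℝ → ℂ), IsGivenBy u f → ∀ (x t T c : ℝ) (D : ℝ → ℂ)
      (D' : C(ℝ, ℂ)), 0 < t → t ≤ T → ContDiff ℝ (M + 1 : ℕ) D → (∀ y, HasDerivAt D (D' y) y) →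
      (∀ m ≤ M + 1, ∀ s, ‖iteratedDeriv m D s‖ ≤ c * t⁻¹ ^ m) →
      ‖cutPairing f x T D'‖ₑ ≤ ENNReal.ofReal (C * c) * gridSum (grandMaximal M u) x t := by
  obtain ⟨Z₁, hZ₁0, hZ₁⟩ := exists_unitBump_bound M
  obtain ⟨Z₂, hZ₂0, hZ₂⟩ := exists_unitCutoff_bound M
  set C₀ : ℝ := 2 ^ M * (2 ^ M * (Z₂ * (2 * (M + 3))) * Z₁)
  have hC₀ : 0 ≤ C₀ := by positivity
  refine ⟨4 ^ (2 * (M + 1)) * C₀, by positivity, ?_⟩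
  intro u f hu x t T c D D' ht htT hD hDD' hb
  have hT : 0 < T := ht.trans_le htT
  have hc : 0 ≤ c := by simpa using (norm_nonneg _).trans (hb 0 (Nat.zero_le _) 0)
  have hderiv : deriv D = D' := funext fun y => (hDD' y).deriv
  set η : ℝ → ℂ := fun s => unitCutoff (T⁻¹ * (s - x))
  set Q : ℝ → ℂ := segAvg D' x 0 with hQ
  set ζ : ℤ → ℝ → ℂ := fun n s => unitBump (t⁻¹ * (s - (x + n * t)))
  have hD'c : ContDiff ℝ M D' := by
    rw [← hderiv]
    exact ((contDiff_succ_iff_deriv (n := M)).1 (by exact_mod_cast hD)).2.2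
  have hηc : ContDiff ℝ M η := (contDiff_unitCutoff (n := M)).comp (by fun_prop)
  have hQc : ContDiff ℝ M Q := contDiff_segAvg hD'c x 0
  have hζc : ∀ n, ContDiff ℝ M (ζ n) := fun n => (contDiff_unitBump (n := M)).comp (by fun_prop)
  have hηQc : ContDiff ℝ M fun s => η s * Q s := hηc.mul hQc
  have hζ0 : ∀ n : ℤ, ∀ s ∉ closedBall (x + n * t) t, ζ n s = 0 := by
    intro n s hs
    apply unitBump_eq_zero
    rw [mem_closedBall, Real.dist_eq, not_le] at hs
    rw [abs_mul, abs_of_pos (inv_pos.2 ht), inv_mul_eq_div, lt_div_iff₀ ht, one_mul]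
    exact hs
  have hpiece : ∀ n : ℤ, ‖∫ s, f s * (η s * Q s * ζ n s)‖ₑ ≤
      ENNReal.ofReal (4 ^ (2 * (M + 1)) * C₀ * c) *
        (ENNReal.ofReal ((1 + |(n : ℝ)|)⁻¹) * gridInf (grandMaximal M u) x t n) := by
    intro n
    have hψ0 : ∀ s ∉ closedBall (x + n * t) t, η s * Q s * ζ n s = 0 := fun s hs => by
      rw [hζ0 n s hs, mul_zero]
    have hn : 0 < 1 + |(n : ℝ)| := by positivity
    have hbound : ∀ m ≤ M, ∀ s, t ^ (m + 1) *
        ‖iteratedDeriv m (fun s => η s * Q s * ζ n s) s‖ ≤ C₀ * c * (1 + |(n : ℝ)|)⁻¹ := by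
      intro m hm s
      by_cases hs : s ∈ closedBall (x + n * t) t
      -- On the n-th interval the decay 1/(t + |s - x|) of the difference quotient turns into the
      -- weight (1 + |n|)⁻¹ of `gridSum`.
      · have hdist : t * (1 + |(n : ℝ)|) ≤ 2 * (t + |s - x|) := by
          rw [mem_closedBall, Real.dist_eq] at hs
          have h1 : |(n : ℝ)| * t ≤ |s - x| + t := by
            calc |(n : ℝ)| * t = |n * t| := by rw [abs_mul, abs_of_pos ht]
              _ = |(s - x) - (s - (x + n * t))| := by congr 1; ring
              _ ≤ |s - x| + |s - (x + n * t)| := abs_sub _ _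
              _ ≤ _ := by linarith
          have := abs_nonneg (s - x)
          linarith
        have hQb : ∀ m ≤ M, ‖iteratedDeriv m Q s‖ ≤
            (2 * (M + 3)) * c * (t * (1 + |(n : ℝ)|))⁻¹ * t⁻¹ ^ m := by
          intro m hm
          have h1 := norm_iteratedDeriv_segAvg_deriv_le hD ht hb x hm s
          rw [hderiv] at h1
          have h2 : t * (1 + |(n : ℝ)|) * ‖iteratedDeriv m Q s‖ ≤
              2 * (M + 3) * c * t⁻¹ ^ m := by
            calc _ ≤ 2 * (t + |s - x|) * ‖iteratedDeriv m Q s‖ := by gcongr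
              _ ≤ 2 * ((m + 3) * c * t⁻¹ ^ m) := by rw [mul_assoc]; gcongr
              _ ≤ 2 * ((M + 3) * c * t⁻¹ ^ m) := by gcongr
              _ = _ := by ring
          rw [mul_right_comm, ← div_eq_mul_inv, le_div_iff₀ (by positivity)]
          linarith
        -- The cutoff lives at the larger scale T ≥ t, so it satisfies the bounds of scale t and
        -- leaves no trace of T in the estimate.
        have hηb : ∀ m ≤ M, ‖iteratedDeriv m η s‖ ≤ Z₂ * t⁻¹ ^ m := by
          intro m hm
          refine (norm_iteratedDeriv_rescale_le contDiff_unitCutoff hZ₂ hT x hm s).trans ?_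
          gcongr
        have hζb : ∀ m ≤ M, ‖iteratedDeriv m (ζ n) s‖ ≤ Z₁ * t⁻¹ ^ m := fun m hm =>
          norm_iteratedDeriv_rescale_le contDiff_unitBump hZ₁ ht _ hm s
        have h3 := norm_iteratedDeriv_mul_le_of_scale hηQc (hζc n) ht
          (fun m hm => norm_iteratedDeriv_mul_le_of_scale hηc hQc ht hηb hQb hm) hζb hm
        calc _ ≤ t ^ (m + 1) * (2 ^ M * (2 ^ M * (Z₂ * ((2 * (M + 3)) * c *
              (t * (1 + |(n : ℝ)|))⁻¹)) * Z₁) * t⁻¹ ^ m) := by gcongr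
          _ = C₀ * c * (1 + |(n : ℝ)|)⁻¹ * (t * t⁻¹ * (t ^ m * t⁻¹ ^ m)) := by
              rw [mul_inv, pow_succ]; ring
          _ = _ := by
              rw [← mul_pow, mul_inv_cancel₀ ht.ne']; simp
      · rw [iteratedDeriv_eq_zero_of_eqOn_compl isClosed_closedBall hψ0 m hs]
        simp only [norm_zero, mul_zero]
        positivity
    -- The bound holds at every y of the interval, so the grand maximal function may be replaced by
    -- its infimum there.
    have h4 : ∀ y ∈ closedBall (x + n * t) t, ‖∫ s, f s * (η s * Q s * ζ n s)‖ₑ ≤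
        ENNReal.ofReal (4 ^ (2 * (M + 1)) * (C₀ * c * (1 + |(n : ℝ)|)⁻¹)) * grandMaximal M u y :=
      fun y hy => enorm_integral_mul_le_grandMaximal hu ht (hηQc.mul (hζc n)) hψ0 hbound hy
    refine (ENNReal.le_mul_iInf₂ ⟨_, mem_closedBall_self ht.le⟩ ENNReal.ofReal_ne_top h4).trans ?_
    rw [← mul_assoc (ENNReal.ofReal (_ * c)), ← ENNReal.ofReal_mul (by positivity), gridInf,
      mul_assoc _ C₀, mul_assoc (4 ^ _) (C₀ * c)]
  -- The cutoff is supported within 2T of x, so finitely many bumps already sum to one where it is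
  -- nonzero.
  obtain ⟨L, hL⟩ := exists_nat_ge (t⁻¹ * (2 * T))
  have hsum : cutPairing f x T D' =
      ∑ n ∈ Finset.Icc (-L : ℤ) L, ∫ s, f s * (η s * Q s * ζ n s) := by
    rw [← integral_finsetSum]
    · refine integral_congr_ae (Eventually.of_forall fun s => ?_)
      simp only
      rw [← Finset.mul_sum, ← Finset.mul_sum]
      by_cases hs : s ∈ closedBall x (2 * T)
      · have h1 : ∑ n ∈ Finset.Icc (-L : ℤ) L, ζ n s = 1 := by
          rw [← sum_unitBump (y := t⁻¹ * (s - x)) (L := L)]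
          · refine Finset.sum_congr rfl fun n _ => ?_
            simp only [ζ]
            congr 1
            field_simp
            ring
          · refine le_trans ?_ hL
            rw [mem_closedBall, Real.dist_eq] at hs
            rw [abs_mul, abs_of_pos (inv_pos.2 ht)]
            gcongr
        rw [h1, mul_one]
      · have h1 : η s = 0 := cutoff_eq_zero hT hs
        rw [h1]
        simp only [zero_mul]
        rw [show unitCutoff (T⁻¹ * (s - x)) = 0 from h1, zero_mul]
    · intro n _
      simp only [mul_assoc]
      exact integrable_mul_cutoff hu.1 hT (hQc.continuous.mul (hζc n).continuous)
  rw [hsum, gridSum, ← ENNReal.tsum_mul_left]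
  calc _ ≤ ∑ n ∈ Finset.Icc (-L : ℤ) L, ‖∫ s, f s * (η s * Q s * ζ n s)‖ₑ := enorm_sum_le _ _
    _ ≤ _ := (Finset.sum_le_sum fun n _ => hpiece n).trans (ENNReal.sum_le_tsum _)

/-- Growth of the derivatives of the low frequency parts. -/
lemma exists_norm_iteratedDeriv_smoothSq_le {k K : ℕ} {α : ℝ} (hα : 0 ≤ α)
    (hkα : ∀ m : ℕ, m < k → (m : ℝ) ≤ α) (hkK : k ≤ K) {f : C(ℝ, ℂ)} {A : ℝ} (hA : 0 ≤ A)
    (hf : ∀ h s, ‖(diffOp h ^ k) f s‖ ≤ A * |h| ^ α) (x : ℝ) :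
    ∃ G : ℝ, 0 ≤ G ∧ ∀ m ≤ K, ∀ (J : ℕ) (y : ℝ), |y - x| ≤ 2 * 2 ^ J →
      ‖iteratedDeriv m (smoothSq k K (2 ^ J) f) y‖ ≤
        G * (1 + J) * ((2 : ℝ) ^ J) ^ α * ((2 : ℝ) ^ J)⁻¹ ^ m := by
  obtain ⟨C, hC, hCb⟩ := exists_smoothSq_bounds k K hα
  have hT : ∀ J : ℕ, (0 : ℝ) < 2 ^ J := fun J => by positivity
  have hTα : ∀ J : ℕ, (0 : ℝ) < ((2 : ℝ) ^ J) ^ α := fun J => Real.rpow_pos_of_pos (hT J) α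
  have hcd : ∀ J : ℕ, ContDiff ℝ K (smoothSq k K (2 ^ J) f) := fun J => contDiff_smoothSq k K (hT J) f
  -- At the centre the derivatives are telescoped over scales. The increments are at most a constant
  -- times 2^(J(α - m)) with α - m ≥ 0; when α = m they need not decrease, hence the factor linear
  -- in J.
  have hcenter : ∀ m < k, ∀ J : ℕ, ‖iteratedDeriv m (smoothSq k K (2 ^ J) f) x‖ ≤
      (‖iteratedDeriv m (smoothSq k K (2 ^ 0) f) x‖ + C * A * J) *
        (((2 : ℝ) ^ J) ^ α * ((2 : ℝ) ^ J)⁻¹ ^ m) := by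
    intro m hm J
    have hmK : m ≤ K := by omega
    have e : ∀ J : ℕ, ((2 : ℝ) ^ J) ^ α * ((2 : ℝ) ^ J)⁻¹ ^ m = ((2 : ℝ) ^ J) ^ (α - m) := fun J => by
      rw [Real.rpow_sub (hT J), Real.rpow_natCast, inv_pow, div_eq_mul_inv]
    have hmono : ∀ J : ℕ, ((2 : ℝ) ^ J) ^ (α - m) ≤ ((2 : ℝ) ^ (J + 1)) ^ (α - m) := fun J => by
      apply Real.rpow_le_rpow (hT J).le _ (by linarith [hkα m hm])
      gcongr
      · norm_num
      · omega
    induction J with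
    | zero => simp
    | succ J ih =>
      have h1 := (hCb f A hA hf (2 ^ J) (hT J)).1 m hmK x
      rw [mul_assoc, e] at h1
      rw [e] at ih ⊢
      have h2 : iteratedDeriv m (smoothSq k K (2 ^ (J + 1)) f) x =
          iteratedDeriv m (smoothSq k K (2 ^ J) f) x -
          iteratedDeriv m ((smoothSq k K (2 ^ J) - smoothSq k K (2 * 2 ^ J)) f) x := by
        rw [← pow_succ', LinearMap.sub_apply, ContinuousMap.coe_sub,
          iteratedDeriv_sub ((hcd J).of_le (by exact_mod_cast hmK)).contDiffAt
            ((hcd (J + 1)).of_le (by exact_mod_cast hmK)).contDiffAt]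
        ring
      rw [h2]
      set u₀ := ‖iteratedDeriv m (smoothSq k K (2 ^ 0) f) x‖
      have hu₀ : 0 ≤ u₀ := norm_nonneg _
      calc _ ≤ (u₀ + C * A * J) * ((2 : ℝ) ^ J) ^ (α - m) + C * A * ((2 : ℝ) ^ J) ^ (α - m) :=
            (norm_sub_le _ _).trans (add_le_add ih h1)
        _ = (u₀ + C * A * (J + 1)) * ((2 : ℝ) ^ J) ^ (α - m) := by ring
        _ ≤ (u₀ + C * A * (J + 1)) * ((2 : ℝ) ^ (J + 1)) ^ (α - m) := by
            gcongr ?_ * ?_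
            exact hmono J
        _ = _ := by push_cast; rfl
  -- Downward induction on the order m = K - j. Orders m ≥ k are controlled everywhere by the k-th
  -- differences; lower orders follow from the value at x and the mean value inequality over a
  -- distance 2 · 2^J.
  have key : ∀ j m : ℕ, m + j = K → ∃ G : ℝ, 0 ≤ G ∧ ∀ (J : ℕ) (y : ℝ), |y - x| ≤ 2 * 2 ^ J →
      ‖iteratedDeriv m (smoothSq k K (2 ^ J) f) y‖ ≤
        G * (1 + J) * ((2 : ℝ) ^ J) ^ α * ((2 : ℝ) ^ J)⁻¹ ^ m := by
    intro j
    induction j with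
    | zero =>
      intro m hm
      refine ⟨C * A, by positivity, fun J y _ => ?_⟩
      refine ((hCb f A hA hf (2 ^ J) (hT J)).2.1 m (by omega) (by omega) y).trans ?_
      have := hTα J
      gcongr ?_ * _ * _
      exact le_mul_of_one_le_right (by positivity) (by linarith [(Nat.cast_nonneg J : (0 : ℝ) ≤ J)])
    | succ j ih =>
      intro m hm
      rcases le_or_gt k m with hkm | hkm
      · refine ⟨C * A, by positivity, fun J y _ => ?_⟩
        refine ((hCb f A hA hf (2 ^ J) (hT J)).2.1 m hkm (by omega) y).trans ?_
        have := hTα J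
        gcongr ?_ * _ * _
        exact le_mul_of_one_le_right (by positivity) (by linarith [(Nat.cast_nonneg J : (0 : ℝ) ≤ J)])
      · obtain ⟨G, hG0, hG⟩ := ih (m + 1) (by omega)
        set u₀ := ‖iteratedDeriv m (smoothSq k K (2 ^ 0) f) x‖ with hu₀'
        have hu₀ : 0 ≤ u₀ := norm_nonneg _
        refine ⟨u₀ + C * A + 2 * G, by positivity, fun J y hy => ?_⟩
        have h1 := hcenter m hkm J
        set P : ℝ := ((2 : ℝ) ^ J) ^ α * ((2 : ℝ) ^ J)⁻¹ ^ m with hP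
        have hP0 : 0 ≤ P := by have := hTα J; positivity
        have h2 : ‖iteratedDeriv m (smoothSq k K (2 ^ J) f) y -
            iteratedDeriv m (smoothSq k K (2 ^ J) f) x‖ ≤
            G * (1 + J) * ((2 : ℝ) ^ J) ^ α * ((2 : ℝ) ^ J)⁻¹ ^ (m + 1) * ‖y - x‖ := by
          refine (convex_closedBall x (2 * 2 ^ J)).norm_image_sub_le_of_norm_deriv_le
            (fun z _ => ?_) (fun z hz => ?_) (mem_closedBall_self (by positivity)) ?_
          · exact (hcd J).differentiable_iteratedDeriv m (by norm_cast; omega) z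
          · rw [← iteratedDeriv_succ]
            rw [mem_closedBall, Real.dist_eq] at hz
            exact hG J z hz
          · rwa [mem_closedBall, Real.dist_eq]
        have h3 : G * (1 + J) * ((2 : ℝ) ^ J) ^ α * ((2 : ℝ) ^ J)⁻¹ ^ (m + 1) * ‖y - x‖ ≤
            2 * G * (1 + J) * P := by
          have := hTα J
          calc _ ≤ G * (1 + J) * ((2 : ℝ) ^ J) ^ α * ((2 : ℝ) ^ J)⁻¹ ^ (m + 1) * (2 * 2 ^ J) := by
                rw [Real.norm_eq_abs]
                gcongr
            _ = 2 * G * (1 + J) * P * (((2 : ℝ) ^ J)⁻¹ * 2 ^ J) := by rw [hP, pow_succ]; ring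
            _ = _ := by rw [inv_mul_cancel₀ (hT J).ne', mul_one]
        have hJ : (0 : ℝ) ≤ J := Nat.cast_nonneg J
        calc ‖iteratedDeriv m (smoothSq k K (2 ^ J) f) y‖
            ≤ ‖iteratedDeriv m (smoothSq k K (2 ^ J) f) x‖ +
              ‖iteratedDeriv m (smoothSq k K (2 ^ J) f) y -
                iteratedDeriv m (smoothSq k K (2 ^ J) f) x‖ := by
              simpa using norm_add_le (iteratedDeriv m (smoothSq k K (2 ^ J) f) x)
                (iteratedDeriv m (smoothSq k K (2 ^ J) f) y -
                iteratedDeriv m (smoothSq k K (2 ^ J) f) x)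
          _ ≤ (u₀ + C * A * J) * P + 2 * G * (1 + J) * P := add_le_add h1 (h2.trans h3)
          _ ≤ (u₀ * (1 + J) + C * A * (1 + J)) * P + 2 * G * (1 + J) * P := by
              gcongr
              · nlinarith
              · linarith
          _ = (u₀ + C * A + 2 * G) * (1 + J) * P := by ring
          _ = _ := by rw [hP]; ring
  choose! G hG0 hG using key
  refine ⟨∑ m ∈ Finset.range (K + 1), G (K - m) m, Finset.sum_nonneg fun m hm => ?_,
    fun m hm J y hy => ?_⟩
  · exact hG0 _ _ (by have := Finset.mem_range.1 hm; omega)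
  · refine (hG (K - m) m (by omega) J y hy).trans ?_
    have := hTα J
    gcongr
    exact Finset.single_le_sum (f := fun m => G (K - m) m)
      (fun m hm => hG0 _ _ (by have := Finset.mem_range.1 hm; omega))
      (Finset.mem_range.2 (Nat.lt_succ_of_le hm))

end PointwiseEstimate

/-! ### Summing over scales: the pointwise bound by the discrete potential. -/

section PointwiseBound

open Metric Filter Topology

/-- The low frequency parts do not contribute in the limit. -/
lemma tendsto_cutPairing_smoothSq_atTop {k K M : ℕ} {α q : ℝ} (hα : 0 ≤ α) (hq : 0 < q)
    (hαq : α < 1 / q) (hkα : ∀ m : ℕ, m < k → (m : ℝ) ≤ α) (hkK : k ≤ K) (hMK : M + 1 ≤ K)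
    {u : 𝓢'(ℝ, ℂ)} {f : ℝ → ℂ} (hu : IsGivenBy u f) (hfin : ∫⁻ y, grandMaximal M u y ^ q ≠ ∞)
    {B B' : C(ℝ, ℂ)} (hB : ∀ y, HasDerivAt B (B' y) y) {A : ℝ} (hA : 0 ≤ A)
    (hlip : ∀ h s, ‖(diffOp h ^ k) B s‖ ≤ A * |h| ^ α) (x : ℝ) :
    Tendsto (fun J : ℕ => ‖cutPairing f x (2 ^ J) (smoothSq k K (2 ^ J) B')‖ₑ) atTop (𝓝 0) := by
  obtain ⟨G, hG0, hG⟩ := exists_norm_iteratedDeriv_smoothSq_le hα hkα hkK hA hlip x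
  obtain ⟨Z, hZ0, hZ⟩ := exists_unitCutoff_bound M
  set N := (∫⁻ y, grandMaximal M u y ^ q) ^ (1 / q) with hN
  have hNtop : N ≠ ∞ := by simp [hN, ENNReal.rpow_eq_top_iff, hfin, hq.le]
  set c₁ : ℝ := 4 ^ (2 * (M + 1)) * (2 ^ (M + 1) * (2 ^ M * (Z * G))) * 2 ^ (-(1 / q)) with hc₁
  -- Ratio per scale of the low frequency contribution. Since α < 1/q it is below 1, which beats the
  -- factor 1 + J.
  set r : ℝ := 2 ^ (α - 1 / q) with hr
  have hr0 : 0 ≤ r := by positivity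
  have hr1 : r < 1 := Real.rpow_lt_one_of_one_lt_of_neg (by norm_num) (by linarith)
  have hbound : ∀ J : ℕ, ‖cutPairing f x (2 ^ J) (smoothSq k K (2 ^ J) B')‖ₑ ≤
      ENNReal.ofReal (c₁ * ((1 + J) * r ^ J)) * N := by
    intro J
    set T : ℝ := 2 ^ J with hTdef
    have hT : 0 < T := by positivity
    have hTα : 0 < T ^ α := Real.rpow_pos_of_pos hT α
    set D' := smoothSq k K T B'
    have hDD' : ∀ y, HasDerivAt (smoothSq k K T B) (D' y) y := hasDerivAt_smoothSq k K hT hB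
    have hderiv : deriv (smoothSq k K T B) = D' := funext fun y => (hDD' y).deriv
    have hDc : ContDiff ℝ (M + 1 : ℕ) (smoothSq k K T B) :=
      (contDiff_smoothSq k K hT B).of_le (by exact_mod_cast hMK)
    have hD'c : ContDiff ℝ M D' := by
      rw [← hderiv]
      exact ((contDiff_succ_iff_deriv (n := M)).1 (by exact_mod_cast hDc)).2.2
    set η : ℝ → ℂ := fun s => unitCutoff (T⁻¹ * (s - x))
    set Q : ℝ → ℂ := segAvg D' x 0
    have hηc : ContDiff ℝ M η := (contDiff_unitCutoff (n := M)).comp (by fun_prop)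
    have hQc : ContDiff ℝ M Q := contDiff_segAvg hD'c x 0
    have hψ0 : ∀ s ∉ closedBall x (2 * T), η s * Q s = 0 := fun s hs => by
      simp only [η]
      rw [cutoff_eq_zero hT hs, zero_mul]
    have hb : ∀ m ≤ M, ∀ s, (2 * T) ^ (m + 1) * ‖iteratedDeriv m (fun s => η s * Q s) s‖ ≤
        2 ^ (M + 1) * (2 ^ M * (Z * G)) * ((1 + J) * T ^ α) := by
      intro m hm s
      by_cases hs : s ∈ closedBall x (2 * T)
      · rw [mem_closedBall, Real.dist_eq] at hs
        have hQb : ∀ m ≤ M, ‖iteratedDeriv m Q s‖ ≤ G * (1 + J) * T ^ α * T⁻¹ * T⁻¹ ^ m := by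
          intro m hm
          rw [iteratedDeriv_segAvg (hD'c.of_le (by exact_mod_cast hm)), ← hderiv,
            ← iteratedDeriv_succ', mul_assoc _ T⁻¹, ← pow_succ']
          exact norm_segAvg_le _ fun y hy => hG (m + 1) (by omega) J y (hy.trans hs)
        have hηb : ∀ m ≤ M, ‖iteratedDeriv m η s‖ ≤ Z * T⁻¹ ^ m := fun m hm =>
          norm_iteratedDeriv_rescale_le contDiff_unitCutoff hZ hT x hm s
        have h3 := norm_iteratedDeriv_mul_le_of_scale hηc hQc hT hηb hQb hm
        calc _ ≤ (2 * T) ^ (m + 1) *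
              (2 ^ M * (Z * (G * (1 + J) * T ^ α * T⁻¹)) * T⁻¹ ^ m) := by gcongr
          _ = 2 ^ (m + 1) * (2 ^ M * (Z * G)) * ((1 + J) * T ^ α) * (T * T⁻¹) ^ (m + 1) := by
              ring
          _ = 2 ^ (m + 1) * (2 ^ M * (Z * G)) * ((1 + J) * T ^ α) := by
              rw [mul_inv_cancel₀ hT.ne', one_pow, mul_one]
          _ ≤ _ := by
              gcongr
              norm_num
      · rw [iteratedDeriv_eq_zero_of_eqOn_compl isClosed_closedBall hψ0 m hs]
        simp only [norm_zero, mul_zero]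
        positivity
    have h2T : 0 < 2 * T := by positivity
    have h4 : ∀ y ∈ closedBall (x + ((0 : ℤ) : ℝ) * (2 * T)) (2 * T), ‖cutPairing f x T D'‖ₑ ≤
        ENNReal.ofReal (4 ^ (2 * (M + 1)) *
          (2 ^ (M + 1) * (2 ^ M * (Z * G)) * ((1 + J) * T ^ α))) * grandMaximal M u y := by
      intro y hy
      rw [Int.cast_zero, zero_mul, add_zero] at hy
      exact enorm_integral_mul_le_grandMaximal hu h2T (hηc.mul hQc) hψ0 hb hy
    have h5 := ENNReal.le_mul_iInf₂ ⟨_, mem_closedBall_self h2T.le⟩ ENNReal.ofReal_ne_top h4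
    -- An infimum over an interval of length comparable to T is at most the L^q norm times T^(-1/q),
    -- up to a constant.
    have h6 : gridInf (grandMaximal M u) x (2 * T) 0 ≤ ENNReal.ofReal ((2 * T) ^ (-(1 / q))) * N := by
      have h7 := ofReal_mul_tsum_gridInf_rpow_le (grandMaximal M u) hq.le x h2T
      have h8 : ENNReal.ofReal (2 * T) * gridInf (grandMaximal M u) x (2 * T) 0 ^ q ≤
          ∫⁻ y, grandMaximal M u y ^ q :=
        (mul_le_mul_right (ENNReal.le_tsum (f := fun n : ℤ =>
          gridInf (grandMaximal M u) x (2 * T) n ^ q) 0) _).trans h7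
      rw [← ENNReal.rpow_le_rpow_iff hq, ENNReal.mul_rpow_of_nonneg _ _ hq.le, hN,
        ← ENNReal.rpow_mul, one_div_mul_cancel hq.ne', ENNReal.rpow_one,
        ENNReal.ofReal_rpow_of_pos (by positivity), ← Real.rpow_mul h2T.le, neg_mul,
        one_div_mul_cancel hq.ne', Real.rpow_neg_one, ENNReal.ofReal_inv_of_pos h2T,
        mul_comm (ENNReal.ofReal (2 * T))⁻¹, ← div_eq_mul_inv, ENNReal.le_div_iff_mul_le (Or.inl (by simpa using hT))
          (Or.inl ENNReal.ofReal_ne_top)]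
      exact (mul_comm _ _).le.trans h8
    refine h5.trans ((mul_le_mul_right h6 _).trans (le_of_eq ?_))
    rw [← mul_assoc, ← ENNReal.ofReal_mul (by positivity)]
    congr 2
    have e1 : T ^ α * T ^ (-(1 / q)) = r ^ J := by
      rw [← Real.rpow_add hT, hr, ← Real.rpow_natCast, ← Real.rpow_mul (by norm_num), hTdef,
        ← Real.rpow_natCast, ← Real.rpow_mul (by norm_num), sub_eq_add_neg]
      ring_nf
    rw [Real.mul_rpow (by norm_num) hT.le, ← e1, hc₁]
    ring
  have hreal : Tendsto (fun J : ℕ => c₁ * ((1 + (J : ℝ)) * r ^ J)) atTop (𝓝 0) := by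
    have h1 : Tendsto (fun J : ℕ => c₁ * (r ^ J + (J : ℝ) * r ^ J)) atTop (𝓝 (c₁ * (0 + 0))) :=
      ((tendsto_pow_atTop_nhds_zero_of_lt_one hr0 hr1).add
        (tendsto_self_mul_const_pow_of_lt_one hr0 hr1)).const_mul c₁
    simp only [add_zero, mul_zero] at h1
    refine h1.congr fun J => ?_
    ring
  have hlim := ENNReal.Tendsto.mul_const (ENNReal.tendsto_ofReal hreal) (Or.inr hNtop)
  rw [ENNReal.ofReal_zero, zero_mul] at hlim
  exact tendsto_of_tendsto_of_tendsto_of_le_of_le tendsto_const_nhds hlim (fun _ => zero_le) hbound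

lemma tendsto_cutPairing_smoothSq_small {k : ℕ} (hk : 0 < k) (K : ℕ) {f : ℝ → ℂ}
    (hf : LocallyIntegrable f) (x : ℝ) {T : ℝ} (hT : 0 < T) (g : C(ℝ, ℂ)) {t : ℕ → ℝ}
    (ht : ∀ n, 0 ≤ t n) (ht0 : Tendsto t atTop (𝓝 0)) :
    Tendsto (fun n => cutPairing f x T (smoothSq k K (t n) g)) atTop (𝓝 (cutPairing f x T g)) := by
  rw [Metric.tendsto_atTop']
  intro ε hε
  set I := ∫ s in closedBall x (2 * T), ‖f s‖ with hI
  have hI0 : 0 ≤ I := integral_nonneg fun s => norm_nonneg _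
  obtain ⟨δ, hδ, h⟩ := exists_norm_smoothSq_sub_le hk K g (|x| + 2 * T)
    (ε := ε / (I + 1)) (by positivity)
  obtain ⟨n₀, hn₀⟩ := (Metric.tendsto_atTop.1 ht0) δ hδ
  refine ⟨n₀, fun n hn => ?_⟩
  have htn : t n ≤ δ := by
    have := hn₀ n hn.le
    rw [Real.dist_eq, sub_zero] at this
    exact (le_abs_self _).trans this.le
  rw [dist_eq_norm, ← cutPairing_sub hf x hT]
  have h1 : ‖cutPairing f x T (smoothSq k K (t n) g - g)‖ ≤ I * (ε / (I + 1)) :=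
    norm_cutPairing_le hf hT fun y hy => by
      rw [ContinuousMap.sub_apply]
      refine h (t n) (ht n) htn y ?_
      have := abs_add_le (y - x) x
      rw [sub_add_cancel] at this
      linarith
  refine h1.trans_lt ?_
  rw [← mul_div_assoc, div_lt_iff₀ (by positivity)]
  nlinarith

lemma tendsto_cutPairing_atTop {f : ℝ → ℂ} (hf : LocallyIntegrable f) (x : ℝ) (g : C(ℝ, ℂ))
    (hint : Integrable fun s => f s * segAvg g x 0 s) :
    Tendsto (fun J : ℕ => cutPairing f x (2 ^ J) g) atTop (𝓝 (∫ s, f s * segAvg g x 0 s)) := by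
  refine tendsto_integral_of_dominated_convergence (fun s => ‖f s * segAvg g x 0 s‖)
    (fun J => (integrable_mul_cutoff hf (by positivity)
      (continuous_segAvg g.continuous x 0)).aestronglyMeasurable) hint.norm
    (fun J => Eventually.of_forall fun s => ?_) (Eventually.of_forall fun s => ?_)
  · rw [norm_mul, norm_mul, norm_mul]
    gcongr
    exact mul_le_of_le_one_left (norm_nonneg _) (norm_unitCutoff_le _)
  · refine tendsto_const_nhds.congr' ?_
    have h2 : Tendsto (fun J : ℕ => (2 : ℝ) ^ J) atTop atTop :=
      tendsto_pow_atTop_atTop_of_one_lt (by norm_num)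
    filter_upwards [h2.eventually_ge_atTop |s - x|] with J hJ
    rw [unitCutoff_eq_one, one_mul]
    rw [abs_mul, abs_of_pos (by positivity), inv_mul_eq_div, div_le_one (by positivity)]
    exact hJ

/-- The pointwise bound of the pairing of `f` with a difference quotient by the discrete
fractional integral of the grand maximal function. -/
lemma exists_enorm_integral_mul_segAvg_le {α q : ℝ} (hα : 0 < α) (hq : 0 < q) (hαq : α < 1 / q)
    (M : ℕ) : ∃ C : ℝ, 0 ≤ C ∧ ∀ (u : 𝓢'(ℝ, ℂ)) (f : ℝ → ℂ), IsGivenBy u f →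
      ∫⁻ y, grandMaximal M u y ^ q ≠ ∞ → ∀ (B B' : C(ℝ, ℂ)), (∀ y, HasDerivAt B (B' y) y) →
      ∀ A : ℝ, 0 ≤ A → (∀ h s, ‖(diffOp h ^ (⌊α⌋₊ + 1)) B s‖ ≤ A * |h| ^ α) → ∀ x : ℝ,
      Integrable (fun s => f s * segAvg B' x 0 s) →
      ‖∫ s, f s * segAvg B' x 0 s‖ₑ ≤
        ENNReal.ofReal (C * A) * dyadicPotential α (grandMaximal M u) x := by
  set k := ⌊α⌋₊ + 1 with hk
  -- Enough averages to differentiate the pieces M + 1 times (one derivative goes into the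
  -- difference quotient) and to reach the order k.
  set K := M + 1 + k with hK
  obtain ⟨C₁, hC₁, h₁⟩ := exists_enorm_cutPairing_le M
  obtain ⟨C₂, hC₂, h₂⟩ := exists_smoothSq_bounds k K hα.le
  refine ⟨C₁ * C₂, by positivity, fun u f hu hfin B B' hB A hA hlip x hint => ?_⟩
  set S := ENNReal.ofReal (C₁ * C₂ * A) * dyadicPotential α (grandMaximal M u) x with hS
  have hkα : ∀ m : ℕ, m < k → (m : ℝ) ≤ α := fun m hm =>
    (Nat.cast_le.2 (Nat.lt_succ_iff.1 hm)).trans (Nat.floor_le hα.le)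
  have hlow := tendsto_cutPairing_smoothSq_atTop hα.le hq hαq hkα (K := K) (by omega) (by omega)
    hu hfin hB hA hlip x
  have hstep : ∀ (J : ℕ) (i : ℤ), i ≤ J →
      ‖cutPairing f x (2 ^ J) ((smoothSq k K (2 ^ i) - smoothSq k K (2 * 2 ^ i)) B')‖ₑ ≤
        ENNReal.ofReal (C₁ * C₂ * A) *
          ((2 : ℝ≥0∞) ^ (α * (i : ℝ)) * gridSum (grandMaximal M u) x (2 ^ i)) := by
    intro J i hi
    have ht : (0 : ℝ) < 2 ^ i := by positivity
    have h := h₁ u f hu x (2 ^ i) (2 ^ J) (C₂ * A * ((2 : ℝ) ^ i) ^ α)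
      ((smoothSq k K (2 ^ i) - smoothSq k K (2 * 2 ^ i)) B)
      ((smoothSq k K (2 ^ i) - smoothSq k K (2 * 2 ^ i)) B') ht
      (by rw [← zpow_natCast]; gcongr; norm_num)
      (((contDiff_smoothSq k K ht B).sub (contDiff_smoothSq k K (by positivity) B)).of_le
        (by norm_cast; omega))
      (fun y => (hasDerivAt_smoothSq k K ht hB y).sub
        (hasDerivAt_smoothSq k K (by positivity) hB y))
      (fun m hm s => (h₂ B A hA hlip _ ht).1 m (by omega) s)
    refine h.trans (le_of_eq ?_)
    rw [← mul_assoc, ← mul_assoc, ← mul_assoc, ENNReal.ofReal_mul (by positivity)]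
    congr 2
    rw [← Real.rpow_intCast, ← Real.rpow_mul (by norm_num), ← ENNReal.ofReal_rpow_of_pos
      (by norm_num), ENNReal.ofReal_ofNat, mul_comm (i : ℝ)]
  -- For a fixed cutoff 2^J, telescoping descends from scale 2^J to 2^(J - n). Letting n → ∞
  -- recovers B' locally uniformly; letting J → ∞ afterwards removes both the low frequency term and
  -- the cutoff.
  have htel : ∀ J n : ℕ, ‖cutPairing f x (2 ^ J) (smoothSq k K (2 ^ ((J : ℤ) - n)) B')‖ₑ ≤
      ‖cutPairing f x (2 ^ J) (smoothSq k K (2 ^ J) B')‖ₑ + ∑ j ∈ Finset.range n,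
        ENNReal.ofReal (C₁ * C₂ * A) * ((2 : ℝ≥0∞) ^ (α * (((J : ℤ) - (j + 1 : ℕ) : ℤ) : ℝ)) *
          gridSum (grandMaximal M u) x (2 ^ ((J : ℤ) - (j + 1 : ℕ)))) := by
    intro J n
    induction n with
    | zero => simp
    | succ n ih =>
      rw [Finset.sum_range_succ, ← add_assoc]
      have e : cutPairing f x (2 ^ J) (smoothSq k K (2 ^ ((J : ℤ) - (n + 1 : ℕ))) B') =
          cutPairing f x (2 ^ J) (smoothSq k K (2 ^ ((J : ℤ) - n)) B') +
          cutPairing f x (2 ^ J) ((smoothSq k K (2 ^ ((J : ℤ) - (n + 1 : ℕ))) -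
            smoothSq k K (2 * 2 ^ ((J : ℤ) - (n + 1 : ℕ)))) B') := by
        rw [LinearMap.sub_apply, cutPairing_sub hu.1 x (by positivity)]
        have : (2 : ℝ) * 2 ^ ((J : ℤ) - (n + 1 : ℕ)) = 2 ^ ((J : ℤ) - n) := by
          rw [← zpow_one_add₀ (by norm_num)]
          congr 1
          push_cast
          ring
        rw [this]
        ring
      rw [e]
      exact (enorm_add_le _ _).trans (add_le_add ih (hstep J _ (by omega)))
  have hJ : ∀ J : ℕ, ‖cutPairing f x (2 ^ J) B'‖ₑ ≤
      ‖cutPairing f x (2 ^ J) (smoothSq k K (2 ^ J) B')‖ₑ + S := by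
    intro J
    have ht0 : Tendsto (fun n : ℕ => (2 : ℝ) ^ ((J : ℤ) - n)) atTop (𝓝 0) := by
      have h1 : Tendsto (fun n : ℕ => (2 : ℝ) ^ (J : ℤ) * (2⁻¹ : ℝ) ^ n) atTop
          (𝓝 ((2 : ℝ) ^ (J : ℤ) * 0)) :=
        (tendsto_pow_atTop_nhds_zero_of_lt_one (by norm_num) (by norm_num)).const_mul _
      rw [mul_zero] at h1
      refine h1.congr fun n => ?_
      rw [zpow_sub₀ (by norm_num), inv_pow, zpow_natCast, zpow_natCast, div_eq_mul_inv]
    have hlim := (continuous_enorm.tendsto _).comp (tendsto_cutPairing_smoothSq_small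
      (by omega : 0 < k) K hu.1 x (T := 2 ^ J) (by positivity) B' (fun n => by positivity) ht0)
    refine le_of_tendsto hlim (Eventually.of_forall fun n => (htel J n).trans ?_)
    gcongr
    rw [← Finset.mul_sum, hS, dyadicPotential]
    gcongr
    have hinj : Function.Injective fun j : ℕ => (J : ℤ) - (j + 1 : ℕ) := fun a b hab => by
      simp only at hab
      omega
    exact (ENNReal.sum_le_tsum _).trans (ENNReal.tsum_comp_le_tsum_of_injective hinj
      (fun i : ℤ => (2 : ℝ≥0∞) ^ (α * (i : ℝ)) * gridSum (grandMaximal M u) x (2 ^ i)))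
  have hl1 := (continuous_enorm.tendsto _).comp (tendsto_cutPairing_atTop hu.1 x B' hint)
  have hl2 := hlow.add_const S
  rw [zero_add] at hl2
  exact le_of_tendsto_of_tendsto' hl1 hl2 hJ

end PointwiseBound

/-! ### For p > 1, L^p functions belong to H^p. -/

section LpToHardy

open Metric

/-- Only the bound of order 0 is used: |ψ(s)| ≤ 1/(t(1 + |x - s|/t)²). The smallest dyadic ball
about x containing s supplies the dominating term. -/
lemma enorm_adapted_le {N : ℕ} {x t : ℝ} (ht : 0 < t) {ψ : 𝓢(ℝ, ℂ)} (h : IsAdapted N x t ψ) (s : ℝ) :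
    ‖ψ s‖ₑ ≤ ∑' l : ℕ, ENNReal.ofReal (4 * (1 / 4) ^ l / t) *
      (ball x (2 ^ l * t)).indicator (fun _ => (1 : ℝ≥0∞)) s := by
  set r : ℝ := |x - s| / t with hr
  have hr0 : 0 ≤ r := by positivity
  have hψ : ‖ψ s‖ * (t * (1 + r) ^ 2) ≤ 1 := by
    have h0 := h 0 (Nat.zero_le _) s
    simp only [iteratedDeriv_zero, zero_add, pow_one] at h0
    refine le_trans ?_ h0
    have : (1 + r) ^ 2 ≤ (1 + r) ^ (2 * (N + 1)) :=
      pow_le_pow_right₀ (by linarith) (by omega)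
    nlinarith [mul_le_mul_of_nonneg_left this (mul_nonneg ht.le (norm_nonneg (ψ s)))]
  have hex : ∃ l : ℕ, r < 2 ^ l := pow_unbounded_of_one_lt r one_lt_two
  classical
  have hl := Nat.find_spec hex
  have hmin : ∀ m < Nat.find hex, ¬ r < 2 ^ m := fun m hm => Nat.find_min hex hm
  generalize Nat.find hex = l at hl hmin
  have hmem : s ∈ ball x (2 ^ l * t) := by
    rw [mem_ball, dist_comm, Real.dist_eq]
    rwa [hr, div_lt_iff₀ ht] at hl
  refine le_trans ?_ (ENNReal.le_tsum l)
  rw [Set.indicator_of_mem hmem, mul_one, ← ofReal_norm]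
  apply ENNReal.ofReal_le_ofReal
  have hlow : (1 : ℝ) ≤ 4 * (1 / 4) ^ l * (1 + r) ^ 2 := by
    cases l with
    | zero => nlinarith
    | succ m =>
      have h1 : (2 : ℝ) ^ m ≤ r := not_lt.1 (hmin m (Nat.lt_succ_self m))
      have h2 : ((2 : ℝ) ^ m) ^ 2 ≤ (1 + r) ^ 2 := pow_le_pow_left₀ (by positivity) (by linarith) 2
      have h3 : (4 : ℝ) * (1 / 4) ^ (m + 1) * ((2 : ℝ) ^ m) ^ 2 = 1 := by
        rw [← pow_mul, mul_comm m 2, pow_mul, pow_succ, one_div, inv_pow]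
        field_simp
        norm_num
      exact h3.symm.trans_le (mul_le_mul_of_nonneg_left h2 (by positivity))
  have hpos : 0 < t * (1 + r) ^ 2 := by positivity
  calc ‖ψ s‖ ≤ 1 / (t * (1 + r) ^ 2) := by rwa [le_div_iff₀ hpos]
    _ ≤ (4 * (1 / 4) ^ l * (1 + r) ^ 2) / (t * (1 + r) ^ 2) := by gcongr
    _ = 4 * (1 / 4) ^ l / t := by field_simp

/-- The ball of index l has length 2 · 2^l t, so its weight becomes 8 · 2^(-l); these sum to 16. -/
lemma enorm_integral_adapted_le {N : ℕ} {x t : ℝ} (ht : 0 < t) {ψ : 𝓢(ℝ, ℂ)}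
    (h : IsAdapted N x t ψ) {g : ℝ → ℂ} {G : ℝ → ℝ≥0∞} (hG : Measurable G)
    (hgG : ∀ᵐ s, ‖g s‖ₑ = G s) :
    ‖∫ s, ψ s • g s‖ₑ ≤ 16 * hlMax G x := by
  calc ‖∫ s, ψ s • g s‖ₑ ≤ ∫⁻ s, ‖ψ s • g s‖ₑ := enorm_integral_le_lintegral_enorm _
    _ ≤ ∫⁻ s, ∑' l : ℕ, ENNReal.ofReal (4 * (1 / 4) ^ l / t) *
          (ball x (2 ^ l * t)).indicator G s := by
        refine lintegral_mono_ae ?_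
        filter_upwards [hgG] with s hs
        rw [enorm_smul, hs]
        refine (mul_le_mul_left (enorm_adapted_le ht h s) _).trans (le_of_eq ?_)
        rw [← ENNReal.tsum_mul_right]
        refine tsum_congr fun l => ?_
        rw [mul_assoc]
        congr 1
        by_cases hs' : s ∈ ball x (2 ^ l * t) <;> simp [hs']
    _ = ∑' l : ℕ, ENNReal.ofReal (4 * (1 / 4) ^ l / t) * ∫⁻ s in ball x (2 ^ l * t), G s := by
        rw [lintegral_tsum fun l =>
          ((hG.indicator measurableSet_ball).const_mul _).aemeasurable]
        refine tsum_congr fun l => ?_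
        rw [lintegral_const_mul _ (hG.indicator measurableSet_ball),
          lintegral_indicator measurableSet_ball]
    _ ≤ ∑' l : ℕ, ENNReal.ofReal (8 * (1 / 2) ^ l) * hlMax G x := by
        refine ENNReal.tsum_le_tsum fun l => ?_
        have hpos : 0 < 2 ^ l * t := by positivity
        refine (mul_le_mul_right (lintegral_ball_le_hlMax G hpos (mem_ball_self hpos)) _).trans
          (le_of_eq ?_)
        rw [← mul_assoc, ← ENNReal.ofReal_mul (by positivity)]
        congr 2
        have : ((1 : ℝ) / 4) ^ l = (1 / 2) ^ l * (1 / 2) ^ l := by rw [← mul_pow]; norm_num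
        have h2 : ((1 : ℝ) / 2) ^ l * 2 ^ l = 1 := by rw [← mul_pow]; norm_num
        rw [this, show 4 * ((1 / 2 : ℝ) ^ l * (1 / 2) ^ l) / t * (2 * (2 ^ l * t)) =
          8 * (1 / 2) ^ l * ((1 / 2) ^ l * 2 ^ l) * (t / t) by ring, h2, div_self ht.ne']
        ring
    _ = 16 * hlMax G x := by
        rw [ENNReal.tsum_mul_right]
        congr 1
        rw [← ENNReal.ofReal_tsum_of_nonneg (fun l => by positivity)
          (summable_geometric_two.mul_left 8), tsum_mul_left, tsum_geometric_two]
        norm_num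

/-- The grand maximal function of an L^p function is at most 16 times its Hardy–Littlewood maximal
function, which is bounded on L^p. -/
lemma exists_hardyNorm_le {p : ℝ} (hp : 1 < p) :
    ∃ K : ℝ≥0∞, K ≠ ∞ ∧ ∀ g : ℝ → ℂ, MemLp g (ENNReal.ofReal p) →
      ∃ v : 𝓢'(ℝ, ℂ), IsGivenBy v g ∧ hardyNorm p v ≤ K * (∫⁻ x, ‖g x‖ₑ ^ p) ^ (1 / p) := by
  obtain ⟨K, hK, hle⟩ := exists_lintegral_hlMax_rpow_le hp
  have hp0 : 0 < p := one_pos.trans hp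
  refine ⟨16 * K ^ (1 / p), ENNReal.mul_ne_top (by norm_num)
    (ENNReal.rpow_ne_top_of_nonneg (by positivity) hK), fun g hg => ?_⟩
  have : Fact (1 ≤ ENNReal.ofReal p) := ⟨by
    rw [ENNReal.one_le_ofReal]; exact hp.le⟩
  have hae := hg.coeFn_toLp
  refine ⟨Lp.toTemperedDistribution (hg.toLp g), ⟨hg.locallyIntegrable Fact.out, fun φ _ => ?_⟩, ?_⟩
  · rw [Lp.toTemperedDistribution_apply]
    refine integral_congr_ae ?_
    filter_upwards [hae] with s hs
    rw [hs, smul_eq_mul, mul_comm]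
  · set G : ℝ → ℝ≥0∞ := fun s => ‖hg.aestronglyMeasurable.mk g s‖ₑ with hGdef
    have hG : Measurable G := hg.aestronglyMeasurable.stronglyMeasurable_mk.enorm
    have hgG : ∀ᵐ s, ‖g s‖ₑ = G s := by
      filter_upwards [hg.aestronglyMeasurable.ae_eq_mk] with s hs
      exact congrArg _ hs
    have hpt : ∀ x, grandMaximal (⌊1 / p⌋₊ + 1) (Lp.toTemperedDistribution (hg.toLp g)) x ≤
        16 * hlMax G x := by
      intro x
      refine iSup₂_le fun t ht => iSup₂_le fun ψ hψ => ?_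
      rw [Lp.toTemperedDistribution_apply]
      refine enorm_integral_adapted_le ht hψ hG ?_
      filter_upwards [hae, hgG] with s h1 h2
      rw [h1, h2]
    rw [hardyNorm]
    calc _ ≤ (∫⁻ x, (16 * hlMax G x) ^ p) ^ (1 / p) := by gcongr with x; exact hpt x
      _ = (16 ^ p * ∫⁻ x, hlMax G x ^ p) ^ (1 / p) := by
          simp_rw [ENNReal.mul_rpow_of_nonneg _ _ hp0.le]
          rw [lintegral_const_mul _ ((measurable_hlMax G).pow_const p)]
      _ ≤ (16 ^ p * (K * ∫⁻ x, G x ^ p)) ^ (1 / p) := by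
          gcongr
          exact hle G hG
      _ = 16 * K ^ (1 / p) * (∫⁻ x, ‖g x‖ₑ ^ p) ^ (1 / p) := by
          have hi : ∫⁻ x, G x ^ p = ∫⁻ x, ‖g x‖ₑ ^ p :=
            lintegral_congr_ae (by filter_upwards [hgG] with s hs; rw [hs])
          rw [hi, ← mul_assoc, ENNReal.mul_rpow_of_nonneg _ _ (by positivity),
            ENNReal.mul_rpow_of_nonneg _ _ (by positivity), ← ENNReal.rpow_mul,
            mul_one_div_cancel hp0.ne', ENNReal.rpow_one]

end LpToHardy

/-! ### Domination of a function by its grand maximal function. -/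

section PointwiseBound

open Metric Filter Topology
open scoped Convolution ContDiff

/-- A locally integrable function is dominated by the grand maximal function almost everywhere. -/
lemma exists_ae_enorm_le_grandMaximal (M : ℕ) : ∃ C : ℝ, 0 ≤ C ∧ ∀ (u : 𝓢'(ℝ, ℂ)) (f : ℝ → ℂ),
    IsGivenBy u f → ∀ᵐ x, ‖f x‖ₑ ≤ ENNReal.ofReal C * grandMaximal M u x := by
  let φ : ∀ t : ℝ, 0 < t → ContDiffBump (0 : ℝ) := fun t ht => ⟨t, 2 * t, ht, by linarith⟩
  set g : ℝ → ℂ := fun y => ((φ 1 one_pos y : ℝ) : ℂ) with hg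
  have hgs : ∀ n : ℕ∞, ContDiff ℝ n g := fun n =>
    Complex.ofRealCLM.contDiff.comp (φ 1 one_pos).contDiff
  have hgc : HasCompactSupport g :=
    (φ 1 one_pos).hasCompactSupport.comp_left (g := fun r : ℝ => (r : ℂ)) Complex.ofReal_zero
  have hscale : ∀ (t : ℝ) (ht : 0 < t) (y : ℝ), ((φ t ht y : ℝ) : ℂ) = g (t⁻¹ * y) := by
    intro t ht y
    simp only [hg, φ, ContDiffBump.apply]
    rw [mul_div_cancel_right₀ _ ht.ne']
    simp
  have hg0 : ∀ y, 2 < |y| → g y = 0 := by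
    intro y hy
    simp only [hg]
    rw [(φ 1 one_pos).zero_of_le_dist, Complex.ofReal_zero]
    simp only [φ, dist_zero_right, Real.norm_eq_abs]
    linarith
  obtain ⟨Z, hZ, hZb⟩ := exists_norm_iteratedDeriv_le hgs hgc M
  refine ⟨4 ^ (2 * (M + 1)) * (2 ^ M * Z), by positivity, fun u f hu => ?_⟩
  have hpos : ∀ n : ℕ, (0 : ℝ) < 1 / (n + 1) := fun n => Nat.one_div_pos_of_nat
  have hlim : Tendsto (fun n : ℕ => (φ (1 / (n + 1)) (hpos n)).rOut) atTop (𝓝 0) := by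
    have := (tendsto_one_div_add_atTop_nhds_zero_nat (𝕜 := ℝ)).const_mul 2
    rwa [mul_zero] at this
  -- Lebesgue differentiation along normalised bumps recovers f(x) for almost every x, and each such
  -- convolution is a pairing with a test function near x.
  filter_upwards [ContDiffBump.ae_convolution_tendsto_right_of_locallyIntegrable (K := 2) hlim
    (Eventually.of_forall fun n => le_rfl) hu.1] with x hx
  refine le_of_tendsto hx.enorm (Eventually.of_forall fun n => ?_)
  set t : ℝ := 1 / (n + 1)
  have ht : 0 < t := hpos n
  set I : ℝ := ∫ y, φ t ht y with hI
  -- The bump equals 1 on an interval of length 2t, so normalising it multiplies by at most 1/(2t).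
  have hIt : 2 * t ≤ I := by
    have := (φ t ht).measure_closedBall_le_integral volume
    rwa [Real.volume_real_closedBall ht.le] at this
  have hI0 : 0 < I := lt_of_lt_of_le (by positivity) hIt
  have hψc : ContDiff ℝ M fun s => g (t⁻¹ * (s - x)) :=
    (hgs M).comp (by fun_prop)
  have key := enorm_integral_mul_le_grandMaximal hu (c := x) (t := 2 * t) (a := 2 ^ M * Z)
    (by positivity) (ψ := fun s => ((I⁻¹ : ℝ) : ℂ) * g (t⁻¹ * (s - x)))
    (contDiff_const.mul hψc) (fun s hs => by
      rw [hg0, mul_zero]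
      rw [mem_closedBall, Real.dist_eq, not_le] at hs
      rw [abs_mul, abs_of_pos (by positivity), inv_mul_eq_div, lt_div_iff₀ ht]
      exact hs) (fun m hm s => by
      rw [iteratedDeriv_const_mul_field, norm_mul, Complex.norm_real,
        Real.norm_of_nonneg (by positivity)]
      calc (2 * t) ^ (m + 1) * (I⁻¹ * ‖iteratedDeriv m (fun s => g (t⁻¹ * (s - x))) s‖)
          ≤ (2 * t) ^ (m + 1) * ((2 * t)⁻¹ * (Z * t⁻¹ ^ m)) := by
            gcongr
            exact norm_iteratedDeriv_rescale_le (hgs M) hZb ht x hm s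
        _ = 2 ^ m * Z * (t * t⁻¹) ^ m * ((2 * t) * (2 * t)⁻¹) := by
            rw [pow_succ, mul_pow, mul_pow]
            ring
        _ = 2 ^ m * Z := by
            rw [mul_inv_cancel₀ ht.ne', mul_inv_cancel₀ (by positivity), one_pow, mul_one, mul_one]
        _ ≤ 2 ^ M * Z := by
            gcongr
            norm_num) (mem_closedBall_self (by positivity))
  refine le_of_eq_of_le (congrArg _ ?_) key
  rw [convolution_eq_swap]
  refine integral_congr_ae (Eventually.of_forall fun s => ?_)
  simp only [ContinuousLinearMap.lsmul_apply, Complex.real_smul, ContDiffBump.normed]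
  rw [Complex.ofReal_div, ← neg_sub s x, (φ t ht).neg, hscale t ht, Complex.ofReal_inv]
  rw [div_eq_inv_mul]
  ring

end PointwiseBound

/-! ### Reduction to a difference quotient, and absolute convergence. -/

section Reduction

open Metric

/-- A dilation by β turns the step h into βh. Hence the Lipschitz seminorm scales by |β|^α,
uniformly in the centre x. -/
lemma fwdDiff_iter_comp_affine (b : ℝ → ℂ) (x β h : ℝ) (k : ℕ) (s : ℝ) :
    (fwdDiff h)^[k] (fun s => b (x + β * (s - x))) s =
      (fwdDiff (β * h))^[k] b (x + β * (s - x)) := by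
  induction k generalizing b with
  | zero => rfl
  | succ k ih =>
    rw [Function.iterate_succ_apply, Function.iterate_succ_apply, ← ih]
    refine congrArg (fun g => (fwdDiff h)^[k] g s) (funext fun s => ?_)
    simp only [fwdDiff]
    congr 2
    ring_nf

lemma norm_fwdDiff_iter_le_lipSeminorm {α : ℝ} {b : ℝ → ℂ} (hb : lipSeminorm α b < ∞)
    (h y : ℝ) :
    ‖(fwdDiff h)^[⌊α⌋₊ + 1] b y‖ ≤ (lipSeminorm α b).toReal * |h| ^ α := by
  rcases eq_or_ne h 0 with rfl | hh
  · rw [Function.iterate_succ_apply']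
    simp only [fwdDiff, add_zero, sub_self, norm_zero]
    positivity
  · have h1 : ‖(fwdDiff h)^[⌊α⌋₊ + 1] b y‖ₑ / ENNReal.ofReal (|h| ^ α) ≤ lipSeminorm α b :=
      le_iSup_of_le y (le_iSup₂_of_le h hh le_rfl)
    have hpos : 0 < |h| ^ α := Real.rpow_pos_of_pos (abs_pos.2 hh) α
    rw [ENNReal.div_le_iff (by simpa using hpos) ENNReal.ofReal_ne_top,
      ← ENNReal.ofReal_toReal hb.ne, ← ENNReal.ofReal_mul ENNReal.toReal_nonneg,
      ← ofReal_norm, ENNReal.ofReal_le_ofReal_iff (by positivity)] at h1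
    exact h1

/-- The dilate `s ↦ b (x + β (s - x))` of a continuous function about the point `x`. -/
noncomputable def dilate (x β : ℝ) (b : ℝ → ℂ) (hb : Continuous b) : C(ℝ, ℂ) where
  toFun s := b (x + β * (s - x))

/-- The derivative of the dilate `s ↦ b (x + β (s - x))`. -/
noncomputable def dilateDeriv (x β : ℝ) (b : ℝ → ℂ) (hb : ContDiff ℝ 1 b) : C(ℝ, ℂ) where
  toFun s := β * deriv b (x + β * (s - x))
  continuous_toFun := by
    have := hb.continuous_deriv le_rfl
    fun_prop

lemma hasDerivAt_dilate (x β : ℝ) {b : ℝ → ℂ} (hb : ContDiff ℝ 1 b) (y : ℝ) :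
    HasDerivAt (dilate x β b hb.continuous) (dilateDeriv x β b hb y) y := by
  have h1 : HasDerivAt (fun s : ℝ => x + β * (s - x)) β y := by
    simpa using (((hasDerivAt_id y).sub_const x).const_mul β).const_add x
  have h2 := (hb.differentiable one_ne_zero (x + β * (y - x))).hasDerivAt.scomp y h1
  rwa [Complex.real_smul] at h2

lemma norm_diffOp_pow_dilate_le {α : ℝ} (x β : ℝ) {b : ℝ → ℂ} (hb : Continuous b)
    (hlip : lipSeminorm α b < ∞) (h s : ℝ) :
    ‖(diffOp h ^ (⌊α⌋₊ + 1)) (dilate x β b hb) s‖ ≤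
      |β| ^ α * (lipSeminorm α b).toReal * |h| ^ α := by
  rw [coe_diffOp_pow]
  refine (congrArg norm (fwdDiff_iter_comp_affine b x β h _ s)).trans_le ?_
  refine (norm_fwdDiff_iter_le_lipSeminorm hlip _ _).trans_eq ?_
  rw [abs_mul, Real.mul_rpow (abs_nonneg _) (abs_nonneg _)]
  ring

lemma sub_mul_segAvg_dilateDeriv (x β : ℝ) {b : ℝ → ℂ} (hb : ContDiff ℝ 1 b) (s : ℝ) :
    ((s - x : ℝ) : ℂ) * segAvg (dilateDeriv x β b hb) x 0 s = b (x + β * (s - x)) - b x := by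
  rw [sub_mul_segAvg_zero (hasDerivAt_dilate x β hb) (map_continuous _)]
  change b (x + β * (s - x)) - b (x + β * (x - x)) = _
  rw [sub_self, mul_zero, add_zero]

/-- Off s = x the integrand is minus `f` times the difference quotient of the dilate. As b is C¹,
this quotient extends continuously across x, so no principal value is involved. -/
lemma bilinIntegrand_ae_eq (x β : ℝ) {b : ℝ → ℂ} (hb : ContDiff ℝ 1 b) (f : ℝ → ℂ) :
    bilinIntegrand β b f x =ᵐ[volume] fun s => -(f s * segAvg (dilateDeriv x β b hb) x 0 s) := by
  have hne : ∀ᵐ s : ℝ, s ≠ x := by simp [ae_iff]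
  filter_upwards [hne] with s hs
  have h0 : ((x - s : ℝ) : ℂ) ≠ 0 := Complex.ofReal_ne_zero.2 (sub_ne_zero.2 hs.symm)
  rw [bilinIntegrand, ← sub_mul_segAvg_dilateDeriv x β hb s, div_eq_iff h0]
  push_cast
  ring

lemma norm_segAvg_dilateDeriv_le (x β : ℝ) {b : ℝ → ℂ} (hb : ContDiff ℝ 1 b) {s : ℝ}
    (hs : 1 < |s - x|) : ‖segAvg (dilateDeriv x β b hb) x 0 s‖ ≤
      ‖b (x + β * (s - x)) - b x‖ * |s - x|⁻¹ := by
  rw [← sub_mul_segAvg_dilateDeriv x β hb s, norm_mul, Complex.norm_real, Real.norm_eq_abs,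
    mul_comm, ← mul_assoc, inv_mul_cancel₀ (by positivity), one_mul]

/-- Near x, local integrability of `f` and continuity of κ suffice; only |s - x| > 1 needs a
majorant. -/
lemma integrable_mul_of_far {f κ : ℝ → ℂ} (hf : LocallyIntegrable f) (hκ : Continuous κ) (x : ℝ)
    {w : ℝ → ℝ} (hw : Integrable fun s => w s)
    (h : ∀ᵐ s, 1 < |s - x| → ‖f s‖ * ‖κ s‖ ≤ w s) : Integrable fun s => f s * κ s := by
  have h1 : IntegrableOn (fun s => f s * κ s) (closedBall x 1) :=
    (hf.integrableOn_isCompact (isCompact_closedBall x 1)).mul_continuousOn hκ.continuousOn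
      (isCompact_closedBall x 1)
  have h2 : IntegrableOn (fun s => f s * κ s) (closedBall x 1)ᶜ := by
    refine Integrable.mono' hw.integrableOn
      (hf.aestronglyMeasurable.mul hκ.aestronglyMeasurable).restrict ?_
    refine (ae_restrict_iff' measurableSet_closedBall.compl).2 ?_
    filter_upwards [h] with s hs hmem
    rw [norm_mul]
    refine hs ?_
    rwa [Set.mem_compl_iff, mem_closedBall, Real.dist_eq, not_le] at hmem
  exact integrableOn_univ.1 (by simpa using h1.union h2)

lemma integrable_bilinIntegrand {β x : ℝ} {b f : ℝ → ℂ} (hb : ContDiff ℝ 1 b)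
    (hf : LocallyIntegrable f) {w : ℝ → ℝ} (hw : Integrable w)
    (h : ∀ᵐ s, 1 < |s - x| → ‖f s‖ * (‖b (x + β * (s - x)) - b x‖ * |s - x|⁻¹) ≤ w s) :
    Integrable (bilinIntegrand β b f x) := by
  refine Integrable.congr ?_ (bilinIntegrand_ae_eq x β hb f).symm
  refine (integrable_mul_of_far hf (continuous_segAvg (map_continuous _) x 0) x hw ?_).neg
  filter_upwards [h] with s hs hs1
  exact (mul_le_mul_of_nonneg_left (norm_segAvg_dilateDeriv_le x β hb hs1) (norm_nonneg _)).trans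
    (hs hs1)

lemma integrable_bilinIntegrand_of_bounded {β x M : ℝ} {b f : ℝ → ℂ} (hb : ContDiff ℝ 1 b)
    (hM : ∀ y, ‖b y‖ ≤ M) (hf : Integrable f) : Integrable (bilinIntegrand β b f x) := by
  refine integrable_bilinIntegrand hb hf.locallyIntegrable (hf.norm.mul_const (M + M))
    (Filter.Eventually.of_forall fun s hs => ?_)
  have h1 : ‖b (x + β * (s - x)) - b x‖ ≤ M + M :=
    (norm_sub_le _ _).trans (add_le_add (hM _) (hM x))
  refine mul_le_mul_of_nonneg_left ?_ (norm_nonneg _)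
  exact (mul_le_of_le_one_right (norm_nonneg _) (inv_le_one_of_one_le₀ hs.le)).trans h1

/-- For a measurable representative of `f` the integrand is jointly measurable, and replacing `f` by
it changes no integral. -/
lemma aestronglyMeasurable_bilinHilbert (β : ℝ) {b f : ℝ → ℂ} (hb : Continuous b)
    (hf : AEStronglyMeasurable f) : AEStronglyMeasurable (bilinHilbert β b f) := by
  have h1 : StronglyMeasurable (Function.uncurry (bilinIntegrand β b (hf.mk f))) := by
    have hm := hf.stronglyMeasurable_mk.measurable
    have : Measurable (Function.uncurry (bilinIntegrand β b (hf.mk f))) := by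
      unfold bilinIntegrand Function.uncurry
      have := hb.measurable
      fun_prop
    exact this.stronglyMeasurable
  have h2 : bilinHilbert β b f = fun x => ∫ s, bilinIntegrand β b (hf.mk f) x s := by
    ext x
    refine integral_congr_ae ?_
    filter_upwards [hf.ae_eq_mk] with s hs
    rw [bilinIntegrand, bilinIntegrand, hs]
  rw [h2]
  exact h1.integral_prod_right.aestronglyMeasurable

/-- At distance about 2^J from x the dilate differs from its smoothing at scale 2^J by O(2^(Jα)),
and the smoothing grows like (1 + J)2^(Jα). With 1 + J ≤ 2^J this is O(|s - x|^(1 + α)), rounded up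
to an integer power to meet Schwartz decay. -/
lemma exists_norm_dilate_le_pow {α : ℝ} (hα : 0 < α) (x β : ℝ) {b : ℝ → ℂ} (hb : Continuous b)
    (hlip : lipSeminorm α b < ∞) : ∃ (G : ℝ) (m : ℕ), 0 ≤ G ∧ ∀ s, 1 < |s - x| →
      ‖b (x + β * (s - x))‖ ≤ G * |s - x| ^ m := by
  set k := ⌊α⌋₊ + 1 with hk
  set B := dilate x β b hb
  set A := |β| ^ α * (lipSeminorm α b).toReal
  have hA : 0 ≤ A := by positivity
  have hB := norm_diffOp_pow_dilate_le x β hb hlip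
  have hkα : ∀ m : ℕ, m < k → (m : ℝ) ≤ α := fun m hm =>
    (Nat.cast_le.2 (Nat.lt_succ_iff.1 hm)).trans (Nat.floor_le hα.le)
  obtain ⟨G, hG, hGb⟩ := exists_norm_iteratedDeriv_smoothSq_le hα.le hkα le_rfl hA hB x
  obtain ⟨C, hC, hCb⟩ := exists_smoothSq_bounds k k hα.le
  refine ⟨G + C * A, ⌈1 + α⌉₊, by positivity, fun s hs => ?_⟩
  obtain ⟨J, hJ1, hJ2⟩ := exists_nat_pow_near hs.le one_lt_two
  have h1 := hGb 0 (Nat.zero_le _) J s (by rw [← pow_succ']; exact hJ2.le)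
  have h2 := (hCb B A hA hB (2 ^ J) (by positivity)).2.2 s
  rw [iteratedDeriv_zero, pow_zero, mul_one] at h1
  have hJ : (1 : ℝ) + J ≤ 2 ^ J := by
    rw [add_comm]
    exact_mod_cast Nat.lt_two_pow_self
  have hT : (1 : ℝ) ≤ 2 ^ J := one_le_pow₀ one_le_two
  change ‖B s‖ ≤ _
  calc ‖B s‖ ≤ ‖smoothSq k k (2 ^ J) B s‖ + ‖smoothSq k k (2 ^ J) B s - B s‖ := by
        rw [norm_sub_rev, add_comm]
        simpa using norm_add_le (B s - smoothSq k k (2 ^ J) B s) (smoothSq k k (2 ^ J) B s)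
    _ ≤ G * (1 + J) * ((2 : ℝ) ^ J) ^ α + C * A * ((2 : ℝ) ^ J) ^ α := add_le_add h1 h2
    _ ≤ G * 2 ^ J * ((2 : ℝ) ^ J) ^ α + C * A * 2 ^ J * ((2 : ℝ) ^ J) ^ α := by
        gcongr ?_ * _ + ?_ * _
        · exact mul_le_mul_of_nonneg_left hJ hG
        · exact le_mul_of_one_le_right (by positivity) hT
    _ = (G + C * A) * ((2 : ℝ) ^ J) ^ (1 + α) := by
        rw [Real.rpow_add (by positivity), Real.rpow_one]
        ring
    _ ≤ (G + C * A) * |s - x| ^ (1 + α) := by gcongr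
    _ ≤ (G + C * A) * |s - x| ^ ⌈1 + α⌉₊ := by
        rw [← Real.rpow_natCast]
        gcongr
        · exact hs.le
        · exact Nat.le_ceil _

lemma integrable_bilinIntegrand_schwartz {α β x : ℝ} (hα : 0 < α) {b : ℝ → ℂ}
    (hb : ContDiff ℝ 1 b) (hlip : lipSeminorm α b < ∞) (g : 𝓢(ℝ, ℂ)) :
    Integrable (bilinIntegrand β b g x) := by
  obtain ⟨G, m, hG, hGb⟩ := exists_norm_dilate_le_pow hα x β hb.continuous hlip
  have hpow := g.integrable_pow_mul volume m
  have hint : Integrable fun s => ‖g s‖ := g.integrable.norm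
  have hw : Integrable fun s => G * 2 ^ (m - 1) * (‖s‖ ^ m * ‖g s‖) +
      (G * 2 ^ (m - 1) * |x| ^ m + ‖b x‖) * ‖g s‖ := (hpow.const_mul _).add (hint.const_mul _)
  refine integrable_bilinIntegrand hb g.integrable.locallyIntegrable hw
    (Filter.Eventually.of_forall fun s hs => ?_)
  have h1 : |s - x| ^ m ≤ 2 ^ (m - 1) * (|s| ^ m + |x| ^ m) :=
    (pow_le_pow_left₀ (abs_nonneg _) (abs_sub s x) m).trans
      (add_pow_le (abs_nonneg _) (abs_nonneg _) m)
  calc ‖g s‖ * (‖b (x + β * (s - x)) - b x‖ * |s - x|⁻¹)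
      ≤ ‖g s‖ * (G * (2 ^ (m - 1) * (|s| ^ m + |x| ^ m)) + ‖b x‖) := by
        refine mul_le_mul_of_nonneg_left ?_ (norm_nonneg _)
        refine (mul_le_of_le_one_right (norm_nonneg _) (inv_le_one_of_one_le₀ hs.le)).trans ?_
        refine (norm_sub_le _ _).trans (add_le_add_left ((hGb s hs).trans ?_) _)
        gcongr
    _ = _ := by
        rw [Real.norm_eq_abs s]
        ring

/-- Here α < 1/q ≤ 1, so the seminorm uses first differences and the quotient is O(|s - x|^(α - 1))
away from x. For q = 1 it is bounded; for q > 1 it is in L^q' at infinity, and Young's inequality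
concludes. -/
lemma integrable_bilinIntegrand_of_rpow {α β q x : ℝ} (hα : 0 < α) (hq : 1 ≤ q) (hαq : α < 1 / q)
    {b f : ℝ → ℂ} (hb : ContDiff ℝ 1 b) (hlip : lipSeminorm α b < ∞) (hf : LocallyIntegrable f)
    (hfq : Integrable fun s => ‖f s‖ ^ q) : Integrable (bilinIntegrand β b f x) := by
  have hα1 : α < 1 := hαq.trans_le (by rw [div_le_one (by linarith)]; exact hq)
  set A := |β| ^ α * (lipSeminorm α b).toReal with hA
  have hA0 : 0 ≤ A := by positivity
  have hbA : ∀ s, 1 < |s - x| → ‖b (x + β * (s - x)) - b x‖ * |s - x|⁻¹ ≤ A * |s - x| ^ (α - 1) := by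
    intro s hs
    have h1 := norm_fwdDiff_iter_le_lipSeminorm hlip (β * (s - x)) x
    rw [Nat.floor_eq_zero.2 hα1, zero_add, Function.iterate_one, fwdDiff, abs_mul,
      Real.mul_rpow (abs_nonneg _) (abs_nonneg _), ← mul_assoc, mul_comm _ (|β| ^ α)] at h1
    rw [Real.rpow_sub_one (by positivity), div_eq_mul_inv, ← mul_assoc]
    gcongr
  rcases hq.eq_or_lt with rfl | hq1
  · simp only [Real.rpow_one] at hfq
    refine integrable_bilinIntegrand hb hf (hfq.mul_const A)
      (Filter.Eventually.of_forall fun s hs => ?_)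
    refine mul_le_mul_of_nonneg_left ((hbA s hs).trans ?_) (norm_nonneg _)
    exact mul_le_of_le_one_right hA0 (Real.rpow_le_one_of_one_le_of_nonpos hs.le (by linarith))
  · have hc := Real.HolderConjugate.conjExponent hq1
    set q' := q.conjExponent
    have hq' : 0 < q' := hc.symm.pos
    set r := (1 - α) * q' with hr
    -- (1 - α)q' > 1 is a restatement of α < 1/q.
    have hr1 : 1 < r := by
      have h1 := hc.inv_add_inv_eq_one
      have h2 : q'⁻¹ < 1 - α := by rw [one_div] at hαq; linarith
      rw [hr]
      calc 1 = q'⁻¹ * q' := (inv_mul_cancel₀ hq'.ne').symm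
        _ < (1 - α) * q' := by gcongr
    have hdec : Integrable fun s : ℝ => (1 + ‖s - x‖) ^ (-r) :=
      (integrable_one_add_norm (μ := volume) (E := ℝ) (r := r) (by simpa using hr1)).comp_sub_right x
    refine integrable_bilinIntegrand hb hf ((hfq.add (hdec.const_mul (2 ^ r))).const_mul A)
      (Filter.Eventually.of_forall fun s hs => ?_)
    have hs0 : 0 < |s - x| := one_pos.trans hs
    have hyoung := Real.young_inequality_of_nonneg (norm_nonneg (f s))
      (Real.rpow_nonneg (abs_nonneg (s - x)) (α - 1)) hc
    have hpow : (|s - x| ^ (α - 1)) ^ q' ≤ 2 ^ r * (1 + ‖s - x‖) ^ (-r) := by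
      rw [← Real.rpow_mul hs0.le, show (α - 1) * q' = -r by rw [hr]; ring, Real.norm_eq_abs,
        Real.rpow_neg hs0.le, Real.rpow_neg (by positivity), ← div_eq_mul_inv,
        ← Real.div_rpow (by positivity) (by positivity), ← Real.inv_rpow hs0.le]
      refine Real.rpow_le_rpow (by positivity) ?_ (by linarith)
      rw [inv_eq_one_div, div_le_div_iff₀ hs0 (by positivity)]
      linarith
    have hq'1 : 1 ≤ q' := hc.symm.lt.le
    calc ‖f s‖ * (‖b (x + β * (s - x)) - b x‖ * |s - x|⁻¹)
        ≤ ‖f s‖ * (A * |s - x| ^ (α - 1)) := by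
          gcongr ?_ * ?_
          exact hbA s hs
      _ = A * (‖f s‖ * |s - x| ^ (α - 1)) := by ring
      _ ≤ A * (‖f s‖ ^ q + 2 ^ r * (1 + ‖s - x‖) ^ (-r)) := by
          refine mul_le_mul_of_nonneg_left (hyoung.trans (add_le_add ?_ ?_)) hA0
          · exact div_le_self (by positivity) hq
          · exact (div_le_self (by positivity) hq'1).trans hpow

end Reduction

/-! ### Assembling the estimate. -/

section Main

lemma lintegral_grandMaximal_ne_top {q : ℝ} (hq : 0 < q) {u : 𝓢'(ℝ, ℂ)}
    (hu : hardyNorm q u < ∞) :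
    ∫⁻ x, grandMaximal (⌊1 / q⌋₊ + 1) u x ^ q ≠ ∞ :=
  ((ENNReal.rpow_lt_top_iff_of_pos (one_div_pos.2 hq)).1 hu).ne

/-- Almost everywhere |f| is at most a constant times its grand maximal function, so a locally
integrable member of H^q is in L^q. -/
lemma integrable_norm_rpow_of_hardyNorm {q : ℝ} (hq : 0 < q) {u : 𝓢'(ℝ, ℂ)} {f : ℝ → ℂ}
    (hf : IsGivenBy u f) (hu : hardyNorm q u < ∞) : Integrable fun s => ‖f s‖ ^ q := by
  obtain ⟨C, _, hCb⟩ := exists_ae_enorm_le_grandMaximal (⌊1 / q⌋₊ + 1)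
  have hm : AEMeasurable fun s => ‖f s‖ ^ q :=
    hf.1.aestronglyMeasurable.norm.aemeasurable.pow_const q
  refine ⟨hm.aestronglyMeasurable, ?_⟩
  calc ∫⁻ s, ‖‖f s‖ ^ q‖ₑ = ∫⁻ s, ‖f s‖ₑ ^ q := by
        refine lintegral_congr fun s => ?_
        rw [Real.enorm_rpow_of_nonneg (norm_nonneg _) hq.le, enorm_norm]
    _ ≤ ∫⁻ s, (ENNReal.ofReal C * grandMaximal (⌊1 / q⌋₊ + 1) u s) ^ q := by
        refine lintegral_mono_ae ?_
        filter_upwards [hCb u f hf] with s hs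
        gcongr
    _ = ENNReal.ofReal C ^ q * ∫⁻ s, grandMaximal (⌊1 / q⌋₊ + 1) u s ^ q := by
        simp_rw [ENNReal.mul_rpow_of_nonneg _ _ hq.le]
        rw [lintegral_const_mul _ ((measurable_grandMaximal _ u).pow_const q)]
    _ < ∞ := ENNReal.mul_lt_top (ENNReal.rpow_lt_top_of_nonneg hq.le ENNReal.ofReal_ne_top)
        (lintegral_grandMaximal_ne_top hq hu).lt_top

/-- The pointwise bound of `bilinHilbert` by the discrete fractional integral. -/
lemma exists_enorm_bilinHilbert_le {α q : ℝ} (hα : 0 < α) (hq : 0 < q) (hαq : α < 1 / q) :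
    ∃ C : ℝ, 0 ≤ C ∧ ∀ (β : ℝ) (b f : ℝ → ℂ) (u : 𝓢'(ℝ, ℂ)), ContDiff ℝ 1 b →
      lipSeminorm α b < ∞ → IsGivenBy u f → hardyNorm q u < ∞ → ∀ x,
      Integrable (bilinIntegrand β b f x) → ‖bilinHilbert β b f x‖ₑ ≤
        ENNReal.ofReal (C * (|β| ^ α * (lipSeminorm α b).toReal)) *
          dyadicPotential α (grandMaximal (⌊1 / q⌋₊ + 1) u) x := by
  obtain ⟨C, hC, hCb⟩ := exists_enorm_integral_mul_segAvg_le hα hq hαq (⌊1 / q⌋₊ + 1)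
  refine ⟨C, hC, fun β b f u hb hlip hf hu x hx => ?_⟩
  have hae := bilinIntegrand_ae_eq x β hb f
  have hint : Integrable fun s => f s * segAvg (dilateDeriv x β b hb) x 0 s :=
    ((hx.congr hae).neg).congr (Filter.Eventually.of_forall fun s => neg_neg _)
  rw [bilinHilbert, integral_congr_ae hae, integral_neg, enorm_neg]
  exact hCb u f hf (lintegral_grandMaximal_ne_top hq hu) _ _ (hasDerivAt_dilate x β hb) _
    (by positivity) (norm_diffOp_pow_dilate_le x β hb.continuous hlip) x hint

end Main

theorem proposition3p4 (p q α : ℝ) (hp : 1 < p) (hq : 0 < q) (hqp : q < p)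
    (hα : α = 1 / q - 1 / p) :
    ∃ (N : ℕ) (C : ℝ → ℝ),
      (∀ β, 0 < C β) ∧
      (∀ K : Set ℝ, IsCompact K → BddAbove (C '' K)) ∧
      ∀ (β : ℝ) (b f : ℝ → ℂ) (u : 𝓢'(ℝ, ℂ)),
        ContDiff ℝ N b → lipSeminorm α b < ∞ →
        IsGivenBy u f → hardyNorm q u < ∞ →
        -- absolute convergence of the integral at every point in the standard situations
        ((1 ≤ q ∨ (∃ g : 𝓢(ℝ, ℂ), f = ⇑g) ∨ ((∃ M : ℝ, ∀ x, ‖b x‖ ≤ M) ∧ Integrable f)) →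
          ∀ x, Integrable (bilinIntegrand β b f x)) ∧
        -- the estimate, whenever the integral converges absolutely almost everywhere
        ((∀ᵐ x : ℝ, Integrable (bilinIntegrand β b f x)) →
          ∃ v : 𝓢'(ℝ, ℂ), IsGivenBy v (bilinHilbert β b f) ∧
            hardyNorm p v ≤ ENNReal.ofReal (C β) * hardyNorm q u * lipSeminorm α b) := by
  have hp0 : 0 < p := one_pos.trans hp
  have hα0 : 0 < α := by
    rw [hα, sub_pos]
    exact one_div_lt_one_div_of_lt hq hqp
  have hαq : α < 1 / q := by
    have := one_div_pos.2 hp0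
    linarith
  obtain ⟨c, hc, hcb⟩ := exists_enorm_bilinHilbert_le hα0 hq hαq
  obtain ⟨K₁, hK₁, hK₁b⟩ := exists_lintegral_dyadicPotential_le hp hq hqp hα
  obtain ⟨K₂, hK₂, hK₂b⟩ := exists_hardyNorm_le hp
  -- One continuous derivative of b is enough. |β|^α is the scaling of the seminorm under dilation;
  -- the added 1 keeps the constant positive, also at β = 0.
  refine ⟨1, fun β => K₂.toReal * K₁.toReal * c * |β| ^ α + 1, fun β => by positivity,
    fun K hK => hK.bddAbove_image (Continuous.continuousOn ?_), ?_⟩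
  · exact (continuous_const.mul (continuous_abs.rpow_const fun _ => Or.inr hα0.le)).add
      continuous_const
  intro β b f u hb hlip hf hu
  have hb : ContDiff ℝ 1 b := by exact_mod_cast hb
  refine ⟨?_, fun hint => ?_⟩
  · rintro (h | ⟨g, rfl⟩ | ⟨⟨M, hM⟩, hfi⟩) x
    · exact integrable_bilinIntegrand_of_rpow hα0 h hαq hb hlip hf.1
        (integrable_norm_rpow_of_hardyNorm hq hf hu)
    · exact integrable_bilinIntegrand_schwartz hα0 hb hlip g
    · exact integrable_bilinIntegrand_of_bounded hb hM hfi
  · set L := (lipSeminorm α b).toReal with hL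
    set P := dyadicPotential α (grandMaximal (⌊1 / q⌋₊ + 1) u) with hP
    set a := ENNReal.ofReal (c * (|β| ^ α * L)) with ha
    have hbound : (∫⁻ x, ‖bilinHilbert β b f x‖ₑ ^ p) ^ (1 / p) ≤
        a * (K₁ * hardyNorm q u) := by
      calc _ ≤ (∫⁻ x, a ^ p * P x ^ p) ^ (1 / p) := by
            refine ENNReal.rpow_le_rpow (lintegral_mono_ae ?_) (by positivity)
            -- The pointwise bound is only available where the integral converges absolutely;
            -- elsewhere `bilinHilbert` takes the default value 0, on a null set.
            filter_upwards [hint] with x hx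
            rw [← ENNReal.mul_rpow_of_nonneg _ _ hp0.le]
            exact ENNReal.rpow_le_rpow (hcb β b f u hb hlip hf hu x hx) hp0.le
        _ = a * (∫⁻ x, P x ^ p) ^ (1 / p) := by
            rw [lintegral_const_mul' _ _ (ENNReal.rpow_ne_top_of_nonneg hp0.le
              ENNReal.ofReal_ne_top), ENNReal.mul_rpow_of_nonneg _ _ (by positivity),
              ← ENNReal.rpow_mul, mul_one_div_cancel hp0.ne', ENNReal.rpow_one]
        _ ≤ a * (K₁ * hardyNorm q u) := by
            gcongr
            exact hK₁b _ (measurable_grandMaximal _ u) (lintegral_grandMaximal_ne_top hq hu)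
    have hmem : MemLp (bilinHilbert β b f) (ENNReal.ofReal p) := by
      refine ⟨aestronglyMeasurable_bilinHilbert β hb.continuous hf.1.aestronglyMeasurable, ?_⟩
      rw [eLpNorm_eq_lintegral_rpow_enorm_toReal (by simpa using hp0) ENNReal.ofReal_ne_top,
        ENNReal.toReal_ofReal hp0.le]
      exact hbound.trans_lt (ENNReal.mul_lt_top ENNReal.ofReal_lt_top
        (ENNReal.mul_lt_top hK₁.lt_top hu))
    obtain ⟨v, hv, hvb⟩ := hK₂b _ hmem
    refine ⟨v, hv, hvb.trans ?_⟩
    have hLe : ENNReal.ofReal L = lipSeminorm α b := ENNReal.ofReal_toReal hlip.ne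
    calc K₂ * (∫⁻ x, ‖bilinHilbert β b f x‖ₑ ^ p) ^ (1 / p)
        ≤ K₂ * (a * (K₁ * hardyNorm q u)) := by gcongr
      _ = ENNReal.ofReal (K₂.toReal * K₁.toReal * c * |β| ^ α) * hardyNorm q u *
          lipSeminorm α b := by
          rw [← hLe, ha, ENNReal.ofReal_mul hc, ENNReal.ofReal_mul (by positivity),
            ENNReal.ofReal_mul (by positivity), ENNReal.ofReal_mul (by positivity),
            ENNReal.ofReal_mul ENNReal.toReal_nonneg, ENNReal.ofReal_toReal hK₁,
            ENNReal.ofReal_toReal hK₂]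
          ring
      _ ≤ _ := by
          gcongr
          linarith
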